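/- Let $1<p<2$, $C_1,C_2>0$, $\zeta_1,\zeta_2,\zeta_3>0$ and $H=\mathrm{diag}(\zeta_1,\zeta_2,\zeta_3)$, and suppose that $R-H\neq a\otimes e_1$ for all $R\in SO(3)$ and $a\in\mathbb R^3$. Let $W_1,W_2:\mathbb M^{3\times3}\to[0,\infty)$ be continuous and frame indifferent ($W_i(RA)=W_i(A)$ for $R\in SO(3)$), and suppose that for all $A\in\mathbb M^{3\times 3}$ (with $|\cdot|$ and $\mathrm{dist}$ Euclidean) $$C_1\big(\mathrm{dist}^2(A,SO(3))\wedge(|A|^p+1)\big)\le W_1(A)\le C_2\big(\mathrm{dist}^2(A,SO(3))\wedge(|A|^p+1)\big),$$ $$C_1\big(\mathrm{dist}^2(A,SO(3)H)\wedge(|A|^p+1)\big)\le W_2(A)\le C_2\big(\mathrm{dist}^2(A,SO(3)H)\wedge(|A|^p+1)\big).$$ Put $W(x,A)=W_1(A)$ if $x_1<0$ and $W(x,A)=W_2(A)$ if $x_1>0$. For $r>0$ let $S_r\subset\mathbb R^2$ be the open disk of radius $r$ centred at $0$. A dislocation line in $S_r$ is a simple, relatively closed Lipschitz curve in $S_r$: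 a closed loop contained in $S_r$, or an arc in $S_r$ whose two endpoints lie on $\partial S_r$. A dislocation system $\Gamma$ in $S_r$ consists of finitely many dislocation lines $\Gamma_1,\dots,\Gamma_N$ in $S_r$, any two of which meet in at most finitely many points, with Burgers vectors $b_1,\dots,b_N\in\mathbb R^3$, $|b_m|=1$; it is empty, $\Gamma=\varnothing$, if $N=0$. The plane of $S_r$ is identified with $\{x_1=0\}$. For $M>0$ let $\mathcal C_M(\Gamma,r)$ be the set of all $F\in L^p_{loc}(\mathbb R\times S_r;\mathbb M^{3\times3})$ such that, in the sense of distributions on $\mathbb R\times S_r$, $$\mathrm{curl}\,F=-\sum_{m=1}^N b_m\otimes\dot\Gamma_m\,d\mathcal H^1\llcorner\Gamma_m ,$$ and $F=I$ a.e. for $x_1<-M$, $F=H$ a.e. for $x_1>M$. Define $$\gamma_H(\Gamma,r)=\inf\Big\{\int_{(-M,M)\times S_r}W(x,F(x))\,dx \;:\; M>0,\ F\in\mathcal C_M(\Gamma,r)\Big\}\in[0,\infty].$$ Then $$\gamma_H(\varnothing,1)>\limsup_{r\to+\infty}\ \inf_{\Gamma\neq\varnothing}\frac{\gamma_H(\Gamma,r)}{r^3},$$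 where the infimum is over all non-empty dislocation systems $\Gamma$ in $S_r$. -/

import Mathlib

open Set Filter Topology MeasureTheory
open scoped ENNReal NNReal ContDiff

noncomputable section

namespace Nanowire

/-- Points of `ℝ³`; the coordinates `x 0, x 1, x 2` are the ones usually called `x₁, x₂, x₃`. -/
abbrev Pt : Type := Fin 3 → ℝ

abbrev Mat : Type := Matrix (Fin 3) (Fin 3) ℝ

/-- The open disk `S_r` of radius `r` in `ℝ²`. -/
def disk (r : ℝ) : Set (Fin 2 → ℝ) := {y | y 0 ^ 2 + y 1 ^ 2 < r ^ 2}

/-- The circle `∂S_r`. -/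
def circle (r : ℝ) : Set (Fin 2 → ℝ) := {y | y 0 ^ 2 + y 1 ^ 2 = r ^ 2}

/-- The infinite cylinder `ℝ × S_r`. -/
def cylinder (r : ℝ) : Set Pt := {x | x 1 ^ 2 + x 2 ^ 2 < r ^ 2}

/-- The bounded cylinder `(-M, M) × S_r`. -/
def slab (M r : ℝ) : Set Pt := {x | -M < x 0 ∧ x 0 < M ∧ x 1 ^ 2 + x 2 ^ 2 < r ^ 2}

/-- The interface point `(0, y)`. -/
def onInterface (y : Fin 2 → ℝ) : Pt := ![0, y 0, y 1]

/-! ### The energy density -/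

/-- The Euclidean (Frobenius) norm of a matrix. -/
def frobNorm (A : Mat) : ℝ := √(∑ i, ∑ j, A i j ^ 2)

/-- The distance of `A` from the well `SO(3) H`. -/
def distWell (H A : Mat) : ℝ :=
  ⨅ R : Matrix.specialOrthogonalGroup (Fin 3) ℝ, frobNorm (A - (R : Mat) * H)

/-- `W` is an admissible energy density with well `SO(3) H` and growth exponent `p`, with
constants `C₁` and `C₂` in the growth condition. -/
structure IsEnergyDensity (p C₁ C₂ : ℝ) (H : Mat) (W : Mat → ℝ) : Prop where
  continuous : Continuous W
  frame_indifferent : ∀ R ∈ Matrix.specialOrthogonalGroup (Fin 3) ℝ, ∀ A : Mat, W (R * A) = W A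
  lower_bound : ∀ A : Mat, C₁ * min (distWell H A ^ 2) (frobNorm A ^ p + 1) ≤ W A
  upper_bound : ∀ A : Mat, W A ≤ C₂ * min (distWell H A ^ 2) (frobNorm A ^ p + 1)

/-- The density of the heterostructure: `W₁` on the left of the interface, `W₂` on the right. -/
def density (W₁ W₂ : Mat → ℝ) (x : Pt) (A : Mat) : ℝ := if x 0 < 0 then W₁ A else W₂ A

/-! ### Dislocations -/

/-- `c`, restricted to `[0, 1]`, parametrizes a simple Lipschitz curve that is relatively closed
in `S_r`: either a closed loop in `S_r`, or an arc in `S_r` whose endpoints lie on `∂S_r` (the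
curve is then `c '' (0, 1)`). -/
structure IsDislocationLine (r : ℝ) (c : ℝ → Fin 2 → ℝ) : Prop where
  lipschitz : ∃ K : ℝ≥0, LipschitzOnWith K c (Icc 0 1)
  simple : InjOn c (Ico 0 1)
  mem_disk : ∀ t ∈ Ioo (0 : ℝ) 1, c t ∈ disk r
  closed : (c 0 = c 1 ∧ c 0 ∈ disk r) ∨ (c 0 ∈ circle r ∧ c 1 ∈ circle r)

/-- A finite system of dislocations in the interface `{0} × S_r`. Each line carries a Burgers
vector of length one, and two different lines meet in at most finitely many points. -/
structure DislocationSystem (r : ℝ) where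
  num : ℕ
  line : Fin num → ℝ → Fin 2 → ℝ
  burgers : Fin num → Fin 3 → ℝ
  isLine : ∀ m, IsDislocationLine r (line m)
  burgers_unit : ∀ m, ∑ i, burgers m i ^ 2 = 1
  finite_inter : ∀ m n, m ≠ n → (line m '' Icc 0 1 ∩ line n '' Icc 0 1).Finite

/-- The system without dislocations. -/
def DislocationSystem.empty (r : ℝ) : DislocationSystem r where
  num := 0
  line := Fin.elim0
  burgers := Fin.elim0
  isLine := fun m => m.elim0
  burgers_unit := fun m => m.elim0
  finite_inter := fun m => m.elim0

/-- The partial derivative `∂_k φ_j` at `x`. -/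
def pderiv (φ : Pt → Pt) (k j : Fin 3) (x : Pt) : ℝ := fderiv ℝ φ x (Pi.single k 1) j

/-- The curl of a smooth vector field on `ℝ³`. -/
def curl (φ : Pt → Pt) (x : Pt) : Pt :=
  ![pderiv φ 1 2 x - pderiv φ 2 1 x,
    pderiv φ 2 0 x - pderiv φ 0 2 x,
    pderiv φ 0 1 x - pderiv φ 1 0 x]

/-- `∫_Γ φ · Γ̇ dℋ¹` for the curve `Γ` in the interface that is parametrized by `c`. -/
def lineIntegral (c : ℝ → Fin 2 → ℝ) (φ : Pt → Pt) : ℝ :=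
  ∫ t in (0 : ℝ)..1, ∑ j, φ (onInterface (c t)) j * onInterface (deriv c t) j

/-- `φ` is a smooth vector field with compact support in `ℝ × S_r`. -/
structure IsTestField (r : ℝ) (φ : Pt → Pt) : Prop where
  smooth : ContDiff ℝ ∞ φ
  compact : HasCompactSupport φ
  support : tsupport φ ⊆ cylinder r

/-- `F ∈ L^p_loc(ℝ × S_r; M^{3×3})`. -/
def LpLoc (p r : ℝ) (F : Pt → Mat) : Prop :=
  ∀ K : Set Pt, IsCompact K → K ⊆ cylinder r →
    ∀ i j, MemLp (fun x => F x i j) (ENNReal.ofReal p) (volume.restrict K)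

/-- `curl F = - ∑ₘ bₘ ⊗ Γ̇ₘ ℋ¹⌞Γₘ` in the sense of distributions on `ℝ × S_r`. The curl of a
matrix field is taken row by row, and `∫ (curl f) · φ = ∫ f · curl φ` for smooth `f`. -/
def HasDislocationCurl (r : ℝ) (D : DislocationSystem r) (F : Pt → Mat) : Prop :=
  ∀ φ : Pt → Pt, IsTestField r φ → ∀ i : Fin 3,
    ∫ x, ∑ j, F x i j * curl φ x j = -∑ m, D.burgers m i * lineIntegral (D.line m) φ

/-- The class `𝒞_M(P, Q)` of fields that are compatible with the dislocations `D` and make the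
transition from `P` to `Q` inside `(-M, M) × S_r`. -/
structure IsTransition (p r : ℝ) (D : DislocationSystem r) (P Q : Mat) (M : ℝ)
    (F : Pt → Mat) : Prop where
  lpLoc : LpLoc p r F
  curl_eq : HasDislocationCurl r D F
  left : ∀ᵐ x, x ∈ cylinder r → x 0 < -M → F x = P
  right : ∀ᵐ x, x ∈ cylinder r → M < x 0 → F x = Q

/-- The minimal cost of a transition from `P` to `Q` in a wire of radius `r` with the
dislocations `D`. -/
def transitionCost (p : ℝ) (W₁ W₂ : Mat → ℝ) (P Q : Mat) (r : ℝ) (D : DislocationSystem r) :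
    ℝ≥0∞ :=
  ⨅ (M : ℝ) (_ : 0 < M) (F : Pt → Mat) (_ : IsTransition p r D P Q M F),
    ∫⁻ x in slab M r, ENNReal.ofReal (density W₁ W₂ x (F x))

end Nanowire

end

/-!
The limit superior is `0`, while the cost without dislocations is positive.

**Cost with dislocations.** For each tangential direction `j` with `ζ j ≠ 1`, put parallel
dislocations at distance `1 / |ζ j - 1|` into the interface (`misfitSystem`). A row of a field
with this curl is, after a quarter turn, a planar flow with point sources: it equals `1` to the
left of the interface, and each source spreads the mass `± 1` linearly over a cell of the size of
the spacing, until the flow is uniform with density `ζ j` at distance `1` (`longitudinal`,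
`transversal`). The curl follows by integrating a test function along the flow lines
(`integral_flow`). The core of each dislocation behaves like `1 / t` in two dimensions, so its
`p`-energy is finite because `p < 2`; as there are `O(r)` dislocations of length `O(r)`, even the
crude estimate `(∑ aᵢ)ᵖ ≤ nᵖ⁻¹ ∑ aᵢᵖ` bounds the energy by `C rᵖ⁺¹`, which is small compared with
`r³` (`exists_transitionCost_misfitSystem_le`).

**Cost without dislocations.** Otherwise there would be curl-free fields of arbitrarily small
energy, hence gradients `L¹`-close to `SO(3)` on the left and to `SO(3) diag ζ` on the right
(`exists_gradient_approx`). Incompatibility means that the wells prescribe different lengths for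
some tangential direction `k`. A rigidity estimate (`exists_gradient_translation_le`) shows that
the gradient hardly changes along segments on one side, so that a segment in direction `k` is
stretched by the factor which the well prescribes, `1` on the left and `ζ k` on the right
(`le_setIntegral_euc_increment`). Two parallel segments close to the interface contradict the
triangle inequality (`exists_incompatible_wells`).

The rigidity estimate is qualitative and rests on a Bochner-type identity in place of a
quantitative theorem. On the well, `ζ j ^ (-2) Fᵢⱼ = det (diag ζ)⁻¹ cof Fᵢⱼ`, and the rows of the
cofactor matrix of a gradient are divergence-free. Testing the equation for the difference `w` of
a map and its translate by `h` with `w` itself, localized by a cutoff, controls the gradient of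
`w` by `w` and the distance from the well; summing over suitable translations in the coordinate
directions, the leading terms cancel, because `∑ ζ j ^ (-2) |F eⱼ|² = 3` on the well, and the
gradient increment is of order `h³` in square mean instead of `h²`
(`exists_translation_estimate`). Telescoping such short translations gives long ones.
-/

noncomputable section

namespace Nanowire

/-! ### Partial derivatives of scalar functions -/

/-- The `j`-th coordinate vector of `ℝ³`. -/
abbrev axis (j : Fin 3) : Pt := Pi.single j 1

/-- The `j`-th partial derivative of a scalar function on `ℝ³`. -/
def pd (j : Fin 3) (f : Pt → ℝ) (x : Pt) : ℝ := fderiv ℝ f x (axis j)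

lemma contDiff_pd {f : Pt → ℝ} (hf : ContDiff ℝ ∞ f) (j : Fin 3) : ContDiff ℝ ∞ (pd j f) :=
  (hf.fderiv_right (m := ∞) (by simp)).clm_apply contDiff_const

lemma pd_sub {f g : Pt → ℝ} {x : Pt} (j : Fin 3) (hf : DifferentiableAt ℝ f x)
    (hg : DifferentiableAt ℝ g x) : pd j (fun y => f y - g y) x = pd j f x - pd j g x := by
  simp [pd, fderiv_fun_sub hf hg]

lemma pd_mul {f g : Pt → ℝ} {x : Pt} (j : Fin 3) (hf : DifferentiableAt ℝ f x)
    (hg : DifferentiableAt ℝ g x) :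
    pd j (fun y => f y * g y) x = pd j f x * g x + f x * pd j g x := by
  simp [pd, fderiv_fun_mul hf hg]; ring

lemma pd_const_mul {f : Pt → ℝ} {x : Pt} (j : Fin 3) (c : ℝ) (hf : DifferentiableAt ℝ f x) :
    pd j (fun y => c * f y) x = c * pd j f x := by
  simp [pd, fderiv_const_mul hf]

lemma pd_sum {f : Fin 3 → Pt → ℝ} {x : Pt} (j : Fin 3) (hf : ∀ i, DifferentiableAt ℝ (f i) x) :
    pd j (fun y => ∑ i, f i y) x = ∑ i, pd j (f i) x := by
  simp [pd, fderiv_fun_sum (fun i _ => hf i)]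

lemma pd_shift (f : Pt → ℝ) (x z : Pt) (j : Fin 3) :
    pd j (fun y => f (y + z)) x = pd j f (x + z) := by
  simp [pd, fderiv_comp_add_right]

lemma pd_comm {f : Pt → ℝ} (hf : ContDiff ℝ ∞ f) (i j : Fin 3) (x : Pt) :
    pd i (pd j f) x = pd j (pd i f) x := by
  have hd : DifferentiableAt ℝ (fderiv ℝ f) x :=
    (hf.fderiv_right (m := ∞) (by simp)).differentiable (by simp) x
  have hs : IsSymmSndFDerivAt ℝ f x :=
    hf.contDiffAt.isSymmSndFDerivAt (by simp; exact WithTop.coe_le_coe.2 le_top)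
  have key : ∀ a b : Fin 3, pd a (pd b f) x = fderiv ℝ (fderiv ℝ f) x (axis a) (axis b) := by
    intro a b
    unfold pd
    rw [fderiv_clm_apply hd (by fun_prop)]
    simp
  rw [key, key, hs]

lemma integral_pd_eq_zero {f : Pt → ℝ} (hf : ContDiff ℝ 1 f) (hc : HasCompactSupport f)
    (j : Fin 3) : ∫ x, pd j f x = 0 := by
  have hcont : Continuous (pd j f) := (hf.continuous_fderiv (by simp)).clm_apply continuous_const
  have hpc : HasCompactSupport (pd j f) := hc.fderiv_apply (𝕜 := ℝ) (axis j)
  have h := integral_mul_fderiv_eq_neg_fderiv_mul_of_integrable (𝕜 := ℝ)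
    (μ := (volume : Measure Pt)) (f := fun _ : Pt => (1 : ℝ)) (g := f) (v := axis j)
    (by simp) (by simp only [one_mul]; exact hcont.integrable_of_hasCompactSupport hpc)
    (by simpa using hf.continuous.integrable_of_hasCompactSupport hc)
    (by fun_prop) (fun x _ => hf.differentiable (by simp) x)
  simpa [pd] using h

lemma hasDerivAt_along_axis {f : Pt → ℝ} (hf : Differentiable ℝ f) (x : Pt) (j : Fin 3) (s : ℝ) :
    HasDerivAt (fun s : ℝ => f (x + s • axis j)) (pd j f (x + s • axis j)) s := by
  have h1 : HasDerivAt (fun s : ℝ => x + s • axis j) (axis j) s := by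
    simpa using ((hasDerivAt_id s).smul_const (axis j)).const_add x
  exact (hf _).hasFDerivAt.comp_hasDerivAt s h1

lemma sub_eq_integral_pd {f : Pt → ℝ} (hf : ContDiff ℝ 1 f) (x : Pt) (j : Fin 3) (h : ℝ) :
    f (x + h • axis j) - f x = ∫ s in (0:ℝ)..h, pd j f (x + s • axis j) := by
  have hcont : Continuous (pd j f) := (hf.continuous_fderiv (by simp)).clm_apply continuous_const
  rw [intervalIntegral.integral_eq_sub_of_hasDerivAt
    (fun s _ => hasDerivAt_along_axis (hf.differentiable (by simp)) x j s)]
  · simp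
  · exact Continuous.intervalIntegrable (by fun_prop) _ _

lemma abs_sub_le_of_pd_le {f : Pt → ℝ} (hf : ContDiff ℝ 1 f) {K : ℝ} {j : Fin 3}
    (hK : ∀ x, |pd j f x| ≤ K) (x : Pt) {h : ℝ} (hh : 0 ≤ h) :
    |f (x + h • axis j) - f x| ≤ K * h := by
  rw [sub_eq_integral_pd hf]
  have := intervalIntegral.norm_integral_le_of_norm_le_const (a := 0) (b := h)
    (f := fun s => pd j f (x + s • axis j)) (C := K) (fun s _ => hK _)
  simpa [abs_of_nonneg hh] using this

/-- Minkowski's inequality for a segment of translations: the `L¹` norm of an average is at most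
the largest `L¹` norm. -/
lemma setIntegral_abs_intervalIntegral_le {g : ℝ → Pt → ℝ} (hg : Continuous (Function.uncurry g))
    {Q : Set Pt} (hQ : IsCompact Q) {h M : ℝ} (hh : 0 ≤ h)
    (hM : ∀ s ∈ Ioc 0 h, ∫ x in Q, |g s x| ≤ M) :
    ∫ x in Q, |∫ s in (0:ℝ)..h, g s x| ≤ h * M := by
  have hgc : Continuous fun p : ℝ × Pt => |g p.1 p.2| := hg.abs
  have hint : Integrable (Function.uncurry fun (s : ℝ) (x : Pt) => |g s x|)
      ((volume.restrict (Ioc 0 h)).prod (volume.restrict Q)) := by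
    rw [Measure.prod_restrict]
    have : IntegrableOn (fun p : ℝ × Pt => |g p.1 p.2|) (Icc 0 h ×ˢ Q)
      (volume.prod volume) := hgc.continuousOn.integrableOn_compact (isCompact_Icc.prod hQ)
    exact this.mono_set (prod_mono Ioc_subset_Icc_self le_rfl)
  have hx1 : Continuous fun x => ∫ s in (0:ℝ)..h, |g s x| :=
    intervalIntegral.continuous_parametric_intervalIntegral_of_continuous' (f := fun x s => |g s x|)
      (hgc.comp continuous_swap) 0 h
  have hx2 : Continuous fun x => ∫ s in (0:ℝ)..h, g s x :=
    intervalIntegral.continuous_parametric_intervalIntegral_of_continuous' (f := fun x s => g s x)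
      (hg.comp continuous_swap) 0 h
  calc ∫ x in Q, |∫ s in (0:ℝ)..h, g s x|
      ≤ ∫ x in Q, ∫ s in (0:ℝ)..h, |g s x| := by
        refine setIntegral_mono (hx2.abs.continuousOn.integrableOn_compact hQ)
          (hx1.continuousOn.integrableOn_compact hQ) fun x => ?_
        exact intervalIntegral.abs_integral_le_integral_abs hh
    _ = ∫ s in (0:ℝ)..h, ∫ x in Q, |g s x| := by
        simp only [intervalIntegral.integral_of_le hh]
        exact (integral_integral_swap hint).symm
    _ ≤ h * M := by
        have := intervalIntegral.norm_integral_le_of_norm_le_const (a := 0) (b := h)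
          (f := fun s => ∫ x in Q, |g s x|) (C := M) (fun s hs => by
            rw [uIoc_of_le hh] at hs
            rw [Real.norm_eq_abs, abs_of_nonneg (by positivity)]
            exact hM s hs)
        rw [sub_zero, abs_of_nonneg hh, mul_comm] at this
        exact (le_abs_self _).trans this

/-! ### The cofactor identity and a Bochner-type formula -/

/-- The cofactor matrix, written with cyclic indices. -/
def cof (A : Mat) : Mat :=
  Matrix.of fun i j => A (i + 1) (j + 1) * A (i + 2) (j + 2) - A (i + 1) (j + 2) * A (i + 2) (j + 1)

/-- The Jacobian matrix of the map with components `V i`. -/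
def jac (V : Fin 3 → Pt → ℝ) (x : Pt) : Mat := Matrix.of fun i j => pd j (V i) x

/-- The deviation of `A` from the linear relation `A H⁻² = cof A / det H`, which holds on the well
`SO(3) H`; here `s j` is the `j`-th diagonal entry of `H⁻²` and `c = 1 / det H`. -/
def cofDefect (s : Fin 3 → ℝ) (c : ℝ) (A : Mat) : Mat :=
  Matrix.of fun i j => s j * A i j - c * cof A i j

/-- The squared norm `|A H⁻¹|²`, with `s` the diagonal of `H⁻²`. -/
def wnorm (s : Fin 3 → ℝ) (A : Mat) : ℝ := ∑ i, ∑ j, s j * A i j ^ 2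

lemma contDiff_jac {V : Fin 3 → Pt → ℝ} (hV : ∀ i, ContDiff ℝ ∞ (V i)) (i j : Fin 3) :
    ContDiff ℝ ∞ (fun x => jac V x i j) := contDiff_pd (hV i) j

lemma contDiff_cof {V : Fin 3 → Pt → ℝ} (hV : ∀ i, ContDiff ℝ ∞ (V i)) (i j : Fin 3) :
    ContDiff ℝ ∞ (fun x => cof (jac V x) i j) :=
  ((contDiff_jac hV _ _).mul (contDiff_jac hV _ _)).sub
    ((contDiff_jac hV _ _).mul (contDiff_jac hV _ _))

/-- The rows of the cofactor matrix of a gradient are divergence free. -/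
lemma sum_pd_cof {V : Fin 3 → Pt → ℝ} (hV : ∀ i, ContDiff ℝ ∞ (V i)) (i : Fin 3) (x : Pt) :
    ∑ j, pd j (fun y => cof (jac V y) i j) x = 0 := by
  have hd : ∀ a b, Differentiable ℝ (pd a (V b)) := fun a b =>
    (contDiff_pd (hV b) a).differentiable (by simp)
  have key : ∀ j, pd j (fun y => cof (jac V y) i j) x =
      pd j (pd (j + 1) (V (i + 1))) x * pd (j + 2) (V (i + 2)) x
        + pd (j + 1) (V (i + 1)) x * pd j (pd (j + 2) (V (i + 2))) x
      - (pd j (pd (j + 2) (V (i + 1))) x * pd (j + 1) (V (i + 2)) x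
        + pd (j + 2) (V (i + 1)) x * pd j (pd (j + 1) (V (i + 2))) x) := by
    intro j
    simp only [cof, jac, Matrix.of_apply]
    have hm : ∀ a b a' b', Differentiable ℝ fun y => pd a (V b) y * pd a' (V b') y :=
      fun a b a' b' => (hd a b).mul (hd a' b')
    rw [pd_sub j (hm _ _ _ _ x) (hm _ _ _ _ x),
      pd_mul j (hd _ _ x) (hd _ _ x), pd_mul j (hd _ _ x) (hd _ _ x)]
  simp only [key, Fin.sum_univ_three]
  have h1 : (1 : Fin 3) + 1 = 2 := rfl
  have h2 : (1 : Fin 3) + 2 = 0 := rfl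
  have h3 : (2 : Fin 3) + 1 = 0 := rfl
  have h4 : (2 : Fin 3) + 2 = 1 := rfl
  simp only [h1, h2, h3, h4, zero_add]
  rw [pd_comm (hV (i + 1)) 1 0, pd_comm (hV (i + 2)) 1 0, pd_comm (hV (i + 1)) 2 0,
    pd_comm (hV (i + 2)) 2 0, pd_comm (hV (i + 1)) 2 1, pd_comm (hV (i + 2)) 2 1]
  ring

/-- A Bochner-type identity for a finite difference `w = V (· + z) - V`. -/
lemma integral_wnorm_diff_eq (s : Fin 3 → ℝ) (c : ℝ) {V : Fin 3 → Pt → ℝ}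
    (hV : ∀ i, ContDiff ℝ ∞ (V i)) {η : Pt → ℝ} (hη : ContDiff ℝ ∞ η) (hc : HasCompactSupport η)
    (z : Pt) :
    ∫ x, η x * wnorm s (jac V (x + z) - jac V x) =
      (∫ x, (∑ j, s j * pd j (pd j η) x) * (1 / 2 * ∑ i, (V i (x + z) - V i x) ^ 2)) +
      ∫ x, ∑ i, ∑ j, (η x * (jac V (x + z) i j - jac V x i j) + (V i (x + z) - V i x) * pd j η x) *
        (cofDefect s c (jac V (x + z)) i j - cofDefect s c (jac V x) i j) := by
  set w : Fin 3 → Pt → ℝ := fun i x => V i (x + z) - V i x with hw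
  set q : Fin 3 → Fin 3 → Pt → ℝ := fun i j x => cof (jac V (x + z)) i j - cof (jac V x) i j with hq
  have hsh : ContDiff ℝ ∞ fun x : Pt => x + z := by fun_prop
  have hws : ∀ i, ContDiff ℝ ∞ (w i) := fun i => ((hV i).comp hsh).sub (hV i)
  have hqs : ∀ i j, ContDiff ℝ ∞ (q i j) := fun i j =>
    ((contDiff_cof hV i j).comp hsh).sub (contDiff_cof hV i j)
  have hps : ∀ j, ContDiff ℝ ∞ (pd j η) := fun j => contDiff_pd hη j
  have dη : Differentiable ℝ η := hη.differentiable (by simp)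
  have dw : ∀ i, Differentiable ℝ (w i) := fun i => (hws i).differentiable (by simp)
  have dq : ∀ i j, Differentiable ℝ (q i j) := fun i j => (hqs i j).differentiable (by simp)
  have dp : ∀ j, Differentiable ℝ (pd j η) := fun j => (hps j).differentiable (by simp)
  have hpw : ∀ i j x, pd j (w i) x = jac V (x + z) i j - jac V x i j := by
    intro i j x
    have h1 : Differentiable ℝ (fun x => V i (x + z)) :=
      ((hV i).comp hsh).differentiable (by simp)
    rw [hw, pd_sub j (h1 x) ((hV i).differentiable (by simp) x), pd_shift]
    rfl
  have hdivq : ∀ i x, ∑ j, pd j (q i j) x = 0 := by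
    intro i x
    have : ∀ j, pd j (q i j) x = pd j (fun y => cof (jac V y) i j) (x + z)
        - pd j (fun y => cof (jac V y) i j) x := by
      intro j
      have h1 : Differentiable ℝ (fun x => cof (jac V (x + z)) i j) :=
        ((contDiff_cof hV i j).comp hsh).differentiable (by simp)
      rw [hq, pd_sub j (h1 x) ((contDiff_cof hV i j).differentiable (by simp) x)]
      rw [pd_shift (fun y => cof (jac V y) i j)]
    simp only [this, Finset.sum_sub_distrib, sum_pd_cof hV, sub_zero]
  -- the vector field whose divergence is the difference of the two sides
  set Z : Fin 3 → Pt → ℝ := fun j x =>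
    ∑ i, (c * (η x * (w i x * q i j x)) - (1 / 2 * s j) * (pd j η x * (w i x * w i x))) with hZ
  have hZs : ∀ j, ContDiff ℝ ∞ (Z j) := by
    intro j
    refine ContDiff.sum fun i _ => ?_
    exact (contDiff_const.mul (hη.mul ((hws i).mul (hqs i j)))).sub
      (contDiff_const.mul ((hps j).mul ((hws i).mul (hws i))))
  have hZc : ∀ j, HasCompactSupport (Z j) := by
    intro j
    have hpc : HasCompactSupport (pd j η) := hc.fderiv_apply (𝕜 := ℝ) (axis j)
    refine HasCompactSupport.intro (hc.isCompact.union hpc.isCompact) fun x hx => ?_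
    have h1 : η x = 0 := image_eq_zero_of_notMem_tsupport fun h => hx (Or.inl h)
    have h2 : pd j η x = 0 := image_eq_zero_of_notMem_tsupport fun h => hx (Or.inr h)
    simp [hZ, h1, h2]
  have hpZ : ∀ j x, pd j (Z j) x = ∑ i, (c * (pd j η x * (w i x * q i j x) +
      η x * (pd j (w i) x * q i j x + w i x * pd j (q i j) x)) - (1 / 2 * s j) *
      (pd j (pd j η) x * (w i x * w i x) + pd j η x * (pd j (w i) x * w i x
        + w i x * pd j (w i) x))) := by
    intro j x
    have e1 : ∀ i, Differentiable ℝ fun x => w i x * q i j x := fun i => (dw i).mul (dq i j)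
    have e2 : ∀ i, Differentiable ℝ fun x => w i x * w i x := fun i => (dw i).mul (dw i)
    have e3 : ∀ i, Differentiable ℝ fun x => η x * (w i x * q i j x) := fun i => dη.mul (e1 i)
    have e4 : ∀ i, Differentiable ℝ fun x => pd j η x * (w i x * w i x) := fun i =>
      (dp j).mul (e2 i)
    have e5 : ∀ i, Differentiable ℝ fun x => c * (η x * (w i x * q i j x)) := fun i =>
      (e3 i).const_mul c
    have e6 : ∀ i, Differentiable ℝ fun x => (1 / 2 * s j) * (pd j η x * (w i x * w i x)) :=
      fun i => (e4 i).const_mul _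
    have e7 : ∀ i, Differentiable ℝ fun x => c * (η x * (w i x * q i j x)) -
        (1 / 2 * s j) * (pd j η x * (w i x * w i x)) := fun i => (e5 i).sub (e6 i)
    refine (pd_sum j fun i => e7 i x).trans (Finset.sum_congr rfl fun i _ => ?_)
    rw [pd_sub j (e5 i x) (e6 i x),
      pd_const_mul j c (e3 i x), pd_const_mul j _ (e4 i x), pd_mul j (dη x) (e1 i x),
      pd_mul j (dw i x) (dq i j x), pd_mul j (dp j x) (e2 i x), pd_mul j (dw i x) (dw i x)]
  have hint : ∀ j, Integrable (pd j (Z j)) := fun j =>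
    (contDiff_pd (hZs j) j).continuous.integrable_of_hasCompactSupport
      ((hZc j).fderiv_apply (𝕜 := ℝ) (axis j))
  have hzero : ∫ x, ∑ j, pd j (Z j) x = 0 := by
    rw [integral_finsetSum _ fun j _ => hint j]
    exact Finset.sum_eq_zero fun j _ => integral_pd_eq_zero ((hZs j).of_le (by simp)) (hZc j) j
  have cη := hη.continuous
  have cw : ∀ i, Continuous (w i) := fun i => (hws i).continuous
  have cp : ∀ j, Continuous (pd j η) := fun j => (hps j).continuous
  have cpp : ∀ j, Continuous (pd j (pd j η)) := fun j => (contDiff_pd (hps j) j).continuous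
  have cpw : ∀ i j, Continuous fun x => jac V (x + z) i j - jac V x i j := fun i j =>
    (((contDiff_jac hV i j).comp hsh).sub (contDiff_jac hV i j)).continuous
  have cq : ∀ i j, Continuous (q i j) := fun i j => (hqs i j).continuous
  have hE : ∀ i j x, cofDefect s c (jac V (x + z)) i j - cofDefect s c (jac V x) i j =
      s j * (jac V (x + z) i j - jac V x i j) - c * q i j x := by
    intro i j x; simp only [cofDefect, hq, Matrix.of_apply]; ring
  have hI2 : Integrable fun x => (∑ j, s j * pd j (pd j η) x) * (1 / 2 * ∑ i, w i x ^ 2) := by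
    refine Continuous.integrable_of_hasCompactSupport (by fun_prop) ?_
    refine HasCompactSupport.intro (K := ⋃ j, tsupport (pd j (pd j η)))
      (isCompact_iUnion fun j => ?_) fun x hx => ?_
    · exact (HasCompactSupport.fderiv_apply (𝕜 := ℝ) (hc.fderiv_apply (𝕜 := ℝ) (axis j)) (axis j))
    · simp only [mem_iUnion, not_exists] at hx
      simp [fun j => image_eq_zero_of_notMem_tsupport (hx j)]
  have hI3 : Integrable fun x => ∑ i, ∑ j, (η x * (jac V (x + z) i j - jac V x i j)
      + w i x * pd j η x) *
        (cofDefect s c (jac V (x + z)) i j - cofDefect s c (jac V x) i j) := by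
    simp only [hE]
    refine Continuous.integrable_of_hasCompactSupport (by fun_prop) ?_
    refine HasCompactSupport.intro (K := tsupport η ∪ ⋃ j, tsupport (pd j η))
      (hc.isCompact.union (isCompact_iUnion fun j => ?_)) fun x hx => ?_
    · exact hc.fderiv_apply (𝕜 := ℝ) (axis j)
    · simp only [mem_union, mem_iUnion, not_or, not_exists] at hx
      simp [fun j => image_eq_zero_of_notMem_tsupport (hx.2 j),
        image_eq_zero_of_notMem_tsupport hx.1]
  have hpt : ∀ x, η x * wnorm s (jac V (x + z) - jac V x) =
      ((∑ j, s j * pd j (pd j η) x) * (1 / 2 * ∑ i, w i x ^ 2) +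
      ∑ i, ∑ j, (η x * (jac V (x + z) i j - jac V x i j) + w i x * pd j η x) *
        (cofDefect s c (jac V (x + z)) i j - cofDefect s c (jac V x) i j)) +
      ∑ j, pd j (Z j) x := by
    intro x
    have h0 := hdivq 0 x
    have h1 := hdivq 1 x
    have h2 := hdivq 2 x
    simp only [hE, hpZ, hpw, wnorm, Matrix.sub_apply]
    simp only [Fin.sum_univ_three] at h0 h1 h2 ⊢
    linear_combination (-c * η x) * (w 0 x * h0 + w 1 x * h1 + w 2 x * h2)
  simp only [hpt]
  refine (integral_add (hI2.add hI3) (integrable_finsetSum _ fun j _ => hint j)).trans ?_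
  rw [hzero, add_zero]
  exact integral_add hI2 hI3

/-! ### Translation estimates for smooth maps near a well -/

lemma integrableOn_compact {f : Pt → ℝ} {Q : Set Pt} (hf : Continuous f) (hQ : IsCompact Q) :
    IntegrableOn f Q := hf.continuousOn.integrableOn_compact hQ

lemma setIntegral_shift_le {f : Pt → ℝ} (hf : Continuous f) (h0 : ∀ x, 0 ≤ f x) {A B : Set Pt}
    (hB : IsCompact B) {z : Pt} (hAB : ∀ x ∈ A, x + z ∈ B) :
    ∫ x in A, f (x + z) ≤ ∫ x in B, f x := by
  have h1 := (measurePreserving_add_right (volume : Measure Pt) z).setIntegral_preimage_emb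
    (measurableEmbedding_addRight z) f B
  rw [← h1]
  refine setIntegral_mono_set ?_ (ae_of_all _ fun x => h0 _) (Eventually.of_forall hAB)
  have hc : IsCompact ((fun x => x + z) ⁻¹' B) := (Homeomorph.addRight z).isCompact_preimage.2 hB
  exact (hf.comp (continuous_add_const z)).continuousOn.integrableOn_compact hc

lemma norm_smul_axis {h : ℝ} (hh : 0 ≤ h) (j : Fin 3) : ‖h • axis j‖ = h := by
  rw [norm_smul, Pi.norm_single]; simp [abs_of_nonneg hh]

lemma add_smul_axis_mem {a b h : ℝ} (hh : 0 ≤ h) (hab : a + h ≤ b) (j : Fin 3) {x c : Pt}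
    (hx : x ∈ Metric.closedBall c a) : x + h • axis j ∈ Metric.closedBall c b := by
  rw [mem_closedBall_iff_norm] at hx ⊢
  calc ‖x + h • axis j - c‖ = ‖(x - c) + h • axis j‖ := by congr 1; abel
    _ ≤ ‖x - c‖ + ‖h • axis j‖ := norm_add_le _ _
    _ ≤ b := by rw [norm_smul_axis hh]; linarith

/-- `V` is a smooth map with gradient bounded by `K` that lies, up to an `L¹` error `ε` on the cube
of half-side `r`, on the quadric relations satisfied by the well `SO(3) H`. -/
structure NearWell (s : Fin 3 → ℝ) (c K ε r : ℝ) (V : Fin 3 → Pt → ℝ) : Prop where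
  smooth : ∀ i, ContDiff ℝ ∞ (V i)
  bound : ∀ i j x, |jac V x i j| ≤ K
  defect : ∫ x in Metric.closedBall (0 : Pt) r, ∑ i, ∑ j, |cofDefect s c (jac V x) i j| ≤ ε
  norm : ∫ x in Metric.closedBall (0 : Pt) r, |wnorm s (jac V x) - 3| ≤ ε

section NearWell

variable {s : Fin 3 → ℝ} {c K ε r : ℝ} {V : Fin 3 → Pt → ℝ}

lemma NearWell.abs_diff_le (hV : NearWell s c K ε r V) (i j : Fin 3) (x : Pt) {h : ℝ}
    (hh : 0 ≤ h) : |V i (x + h • axis j) - V i x| ≤ K * h :=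
  abs_sub_le_of_pd_le ((hV.smooth i).of_le (by simp)) (hV.bound i j) x hh

lemma NearWell.continuous_jac (hV : NearWell s c K ε r V) (i j : Fin 3) :
    Continuous fun x => jac V x i j := (contDiff_jac hV.smooth i j).continuous

lemma NearWell.continuous_cofDefect (hV : NearWell s c K ε r V) (i j : Fin 3) :
    Continuous fun x => cofDefect s c (jac V x) i j := by
  have h1 := hV.continuous_jac i j
  have h2 := (contDiff_cof hV.smooth i j).continuous
  simp only [cofDefect, Matrix.of_apply]
  fun_prop

lemma NearWell.continuous_wnorm (hV : NearWell s c K ε r V) :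
    Continuous fun x => wnorm s (jac V x) := by
  have h1 := hV.continuous_jac
  simp only [wnorm]
  fun_prop

lemma NearWell.eps_nonneg (hV : NearWell s c K ε r V) : 0 ≤ ε :=
  le_trans (integral_nonneg fun x => by positivity) hV.defect

lemma NearWell.K_nonneg (hV : NearWell s c K ε r V) : 0 ≤ K :=
  (abs_nonneg _).trans (hV.bound 0 0 0)

/-- The error term in `integral_wnorm_diff_eq` is controlled by the defect. -/
lemma NearWell.integral_error_le (hV : NearWell s c K ε r V) {η : Pt → ℝ}
    (hsupp : tsupport η ⊆ Metric.closedBall 0 (3 * r / 4)) {B : ℝ} (hB : ∀ x, |η x| ≤ B)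
    (hB' : ∀ j x, |pd j η x| ≤ B) (k : Fin 3) {h : ℝ} (hh : 0 ≤ h) (hr : h ≤ r / 4) (h1 : h ≤ 1) :
    ∫ x, ∑ i, ∑ j, (η x * (jac V (x + h • axis k) i j - jac V x i j) +
        (V i (x + h • axis k) - V i x) * pd j η x) *
        (cofDefect s c (jac V (x + h • axis k)) i j - cofDefect s c (jac V x) i j)
      ≤ 6 * K * B * ε := by
  have hK := hV.K_nonneg
  have hB0 : 0 ≤ B := (abs_nonneg _).trans (hB 0)
  set Q := Metric.closedBall (0 : Pt) (3 * r / 4) with hQ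
  have hQc : IsCompact Q := isCompact_closedBall _ _
  set E : Pt → ℝ := fun x => ∑ i, ∑ j, |cofDefect s c (jac V x) i j| with hE
  have hEc : Continuous E := by
    have := hV.continuous_cofDefect
    simp only [hE]; fun_prop
  have hE0 : ∀ x, 0 ≤ E x := fun x => by simp only [hE]; positivity
  have hle : ∀ x, ∑ i, ∑ j, (η x * (jac V (x + h • axis k) i j - jac V x i j) +
        (V i (x + h • axis k) - V i x) * pd j η x) *
        (cofDefect s c (jac V (x + h • axis k)) i j - cofDefect s c (jac V x) i j) ≤
      Q.indicator (fun x => 3 * K * B * (E (x + h • axis k) + E x)) x := by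
    intro x
    by_cases hx : x ∈ Q
    · rw [indicator_of_mem hx]
      simp only [hE, ← Finset.sum_add_distrib, Finset.mul_sum]
      refine Finset.sum_le_sum fun i _ => Finset.sum_le_sum fun j _ => ?_
      refine (le_abs_self _).trans ?_
      rw [abs_mul]
      refine mul_le_mul ?_ (abs_sub _ _) (abs_nonneg _) (by positivity)
      refine (abs_add_le _ _).trans ?_
      rw [abs_mul, abs_mul]
      have e1 : |jac V (x + h • axis k) i j - jac V x i j| ≤ 2 * K := by
        refine (abs_sub _ _).trans ?_
        linarith [hV.bound i j (x + h • axis k), hV.bound i j x]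
      have e2 : |V i (x + h • axis k) - V i x| ≤ K :=
        (hV.abs_diff_le i k x hh).trans (mul_le_of_le_one_right hK h1)
      have e3 := mul_le_mul (hB x) e1 (abs_nonneg _) hB0
      have e4 := mul_le_mul e2 (hB' j x) (abs_nonneg _) hK
      linarith
    · rw [indicator_of_notMem hx]
      have h1 : x ∉ tsupport η := fun h => hx (hsupp h)
      have h2 : η x = 0 := image_eq_zero_of_notMem_tsupport h1
      have h3 : ∀ j, pd j η x = 0 := fun j => by
        simp only [pd]
        rw [image_eq_zero_of_notMem_tsupport (fun h => h1 (tsupport_fderiv_subset ℝ h))]; simp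
      simp [h2, h3]
  have hI1 : IntegrableOn (fun x => E (x + h • axis k)) Q :=
    (hEc.comp (continuous_add_const _)).continuousOn.integrableOn_compact hQc
  have hI2 : IntegrableOn E Q := hEc.continuousOn.integrableOn_compact hQc
  have s1 : ∫ x in Q, E (x + h • axis k) ≤ ε :=
    (setIntegral_shift_le hEc hE0 (isCompact_closedBall 0 r) fun x hx =>
      add_smul_axis_mem hh (by linarith) k hx).trans hV.defect
  have s2 : ∫ x in Q, E x ≤ ε := by
    have := setIntegral_shift_le (z := 0) hEc hE0 (A := Q) (isCompact_closedBall (0 : Pt) r)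
      fun x hx => by rw [add_zero]; exact Metric.closedBall_subset_closedBall (by linarith) hx
    simp only [add_zero] at this
    exact this.trans hV.defect
  by_cases hI : Integrable fun x => ∑ i, ∑ j, (η x * (jac V (x + h • axis k) i j - jac V x i j) +
        (V i (x + h • axis k) - V i x) * pd j η x) *
        (cofDefect s c (jac V (x + h • axis k)) i j - cofDefect s c (jac V x) i j)
  · refine (integral_mono hI ?_ hle).trans ?_
    · exact (integrable_indicator_iff hQc.measurableSet).2 ((hI1.add hI2).const_mul (3 * K * B))
    · rw [integral_indicator hQc.measurableSet, integral_const_mul, integral_add hI1 hI2]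
      calc 3 * K * B * (_ + _) ≤ 3 * K * B * (ε + ε) := by gcongr
        _ = _ := by ring
  · rw [integral_undef hI]
    have := hV.eps_nonneg
    positivity

lemma exists_abs_le_of_compactSupport {f : Pt → ℝ} (hf : Continuous f) (hc : HasCompactSupport f) :
    ∃ B, 0 ≤ B ∧ ∀ x, |f x| ≤ B := by
  obtain ⟨B, hB⟩ := hf.bounded_above_of_compact_support hc
  exact ⟨B, (norm_nonneg _).trans (hB 0), hB⟩

lemma exists_cutoff {a b : ℝ} (ha : 0 < a) (hab : a < b) :
    ∃ η : Pt → ℝ, ContDiff ℝ ∞ η ∧ HasCompactSupport η ∧ tsupport η ⊆ Metric.closedBall 0 b ∧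
      (∀ x, 0 ≤ η x) ∧ ∀ x ∈ Metric.closedBall (0 : Pt) a, η x = 1 := by
  let f : ContDiffBump (0 : Pt) := ⟨a, b, ha, hab⟩
  exact ⟨f, f.contDiff, f.hasCompactSupport, f.tsupport_eq.subset, fun x => f.nonneg,
    fun x hx => f.one_of_mem_closedBall hx⟩

/-- A cutoff together with bounds for its derivatives up to second order. -/
lemma exists_cutoff_bound (s : Fin 3 → ℝ) {a b : ℝ} (ha : 0 < a) (hab : a < b) :
    ∃ η : Pt → ℝ, ContDiff ℝ ∞ η ∧ HasCompactSupport η ∧ tsupport η ⊆ Metric.closedBall 0 b ∧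
      (∀ x, 0 ≤ η x) ∧ (∀ x ∈ Metric.closedBall (0 : Pt) a, η x = 1) ∧
      ∃ B, 0 ≤ B ∧ (∀ x, |η x| ≤ B) ∧ (∀ j x, |pd j η x| ≤ B) ∧
        ∀ x, |∑ j, s j * pd j (pd j η) x| ≤ B := by
  obtain ⟨η, h1, h2, h3, h4, h5⟩ := exists_cutoff ha hab
  refine ⟨η, h1, h2, h3, h4, h5, ?_⟩
  have hp : ∀ j, ContDiff ℝ ∞ (pd j η) := fun j => contDiff_pd h1 j
  have hpc : ∀ j, HasCompactSupport (pd j η) := fun j => h2.fderiv_apply (𝕜 := ℝ) (axis j)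
  have hpp : ∀ j, ContDiff ℝ ∞ (pd j (pd j η)) := fun j => contDiff_pd (hp j) j
  have hppc : ∀ j, HasCompactSupport (pd j (pd j η)) := fun j =>
    (hpc j).fderiv_apply (𝕜 := ℝ) (axis j)
  obtain ⟨B0, n0, b0⟩ := exists_abs_le_of_compactSupport h1.continuous h2
  choose B1 n1 b1 using fun j => exists_abs_le_of_compactSupport (hp j).continuous (hpc j)
  choose B2 n2 b2 using fun j => exists_abs_le_of_compactSupport (hpp j).continuous (hppc j)
  have t1 : ∀ j, B1 j ≤ ∑ j, B1 j := fun j =>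
    Finset.single_le_sum (fun i _ => n1 i) (Finset.mem_univ j)
  have t2 : 0 ≤ ∑ j, |s j| * B2 j := Finset.sum_nonneg fun i _ => mul_nonneg (abs_nonneg _) (n2 i)
  have t3 : 0 ≤ ∑ j, B1 j := Finset.sum_nonneg fun i _ => n1 i
  refine ⟨B0 + ∑ j, B1 j + ∑ j, |s j| * B2 j, by positivity, fun x => ?_, fun j x => ?_,
    fun x => ?_⟩
  · linarith [b0 x]
  · linarith [b1 j x, t1 j]
  · have : |∑ j, s j * pd j (pd j η) x| ≤ ∑ j, |s j| * B2 j := by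
      refine (Finset.abs_sum_le_sum_abs _ _).trans (Finset.sum_le_sum fun j _ => ?_)
      rw [abs_mul]
      exact mul_le_mul_of_nonneg_left (b2 j x) (abs_nonneg _)
    linarith

lemma sq_sum_le_wnorm {m : ℝ} (hm : ∀ j, m ≤ s j) (A : Mat) :
    m * ∑ i, ∑ j, A i j ^ 2 ≤ wnorm s A := by
  rw [wnorm, Finset.mul_sum]
  refine Finset.sum_le_sum fun i _ => ?_
  rw [Finset.mul_sum]
  exact Finset.sum_le_sum fun j _ => mul_le_mul_of_nonneg_right (hm j) (sq_nonneg _)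

/-- Rough bound for the difference quotients of the gradient. -/
lemma exists_integral_wnorm_diff_le (s : Fin 3 → ℝ) (c K r : ℝ) {η : Pt → ℝ} (hη : ContDiff ℝ ∞ η)
    (hc : HasCompactSupport η) (hsupp : tsupport η ⊆ Metric.closedBall 0 (3 * r / 4)) {B : ℝ}
    (hB : ∀ x, |η x| ≤ B) (hB' : ∀ j x, |pd j η x| ≤ B)
    (hB'' : ∀ x, |∑ j, s j * pd j (pd j η) x| ≤ B) :
    ∃ C, 0 ≤ C ∧ ∀ (V : Fin 3 → Pt → ℝ) (ε : ℝ), NearWell s c K ε r V → ∀ (k : Fin 3) (h : ℝ),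
      0 ≤ h → h ≤ r / 4 → h ≤ 1 →
      ∫ x, η x * wnorm s (jac V (x + h • axis k) - jac V x) ≤ C * (h ^ 2 + ε) := by
  have hB0 : 0 ≤ B := (abs_nonneg _).trans (hB 0)
  set Q := Metric.closedBall (0 : Pt) (3 * r / 4) with hQ
  have hQc : IsCompact Q := isCompact_closedBall _ _
  refine ⟨max (B * (3 / 2 * K ^ 2) * volume.real Q) (6 * |K| * B), by positivity, ?_⟩
  intro V ε hV k h hh hr h1
  have hK := hV.K_nonneg
  rw [integral_wnorm_diff_eq s c hV.smooth hη hc]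
  have e1 := hV.integral_error_le hsupp hB hB' k hh hr h1
  have hz : ∀ x ∉ Q, ∀ j, pd j (pd j η) x = 0 := fun x hx j => by
    have h1 : x ∉ tsupport η := fun h => hx (hsupp h)
    have h2 : x ∉ tsupport (pd j η) := fun h =>
      h1 (tsupport_fderiv_apply_subset ℝ (axis j) h)
    exact image_eq_zero_of_notMem_tsupport fun h => h2 (tsupport_fderiv_apply_subset ℝ (axis j) h)
  have e2 : ∫ x, (∑ j, s j * pd j (pd j η) x) *
      (1 / 2 * ∑ i, (V i (x + h • axis k) - V i x) ^ 2) ≤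
      B * (3 / 2 * K ^ 2) * volume.real Q * h ^ 2 := by
    rw [← setIntegral_eq_integral_of_forall_compl_eq_zero (s := Q)
      (fun x hx => by simp [hz x hx])]
    have := norm_setIntegral_le_of_norm_le_const (s := Q) (μ := volume)
      (f := fun x => (∑ j, s j * pd j (pd j η) x) *
        (1 / 2 * ∑ i, (V i (x + h • axis k) - V i x) ^ 2)) (C := B * (3 / 2 * K ^ 2 * h ^ 2))
      hQc.measure_lt_top (fun x _ => by
        rw [Real.norm_eq_abs, abs_mul]
        refine mul_le_mul (hB'' x) ?_ (abs_nonneg _) hB0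
        rw [abs_of_nonneg (by positivity)]
        have : ∑ i, (V i (x + h • axis k) - V i x) ^ 2 ≤ ∑ _i : Fin 3, (K * h) ^ 2 :=
          Finset.sum_le_sum fun i _ => sq_le_sq' (by
            linarith [neg_abs_le (V i (x + h • axis k) - V i x), hV.abs_diff_le i k x hh])
            ((le_abs_self _).trans (hV.abs_diff_le i k x hh))
        simp only [Finset.sum_const, Finset.card_univ, Fintype.card_fin, nsmul_eq_mul] at this
        push_cast at this
        nlinarith [this])
    refine (le_abs_self _).trans (this.trans (le_of_eq ?_))
    ring
  have hε := hV.eps_nonneg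
  rw [mul_add]
  refine add_le_add (e2.trans ?_) (e1.trans ?_)
  · exact mul_le_mul_of_nonneg_right (le_max_left _ _) (sq_nonneg _)
  · rw [abs_of_nonneg hK]
    exact mul_le_mul_of_nonneg_right (le_max_right _ _) hε

lemma NearWell.continuous_diff (hV : NearWell s c K ε r V) (z : Pt) (i j : Fin 3) :
    Continuous fun x => jac V (x + z) i j - jac V x i j :=
  ((hV.continuous_jac i j).comp (continuous_add_const z)).sub (hV.continuous_jac i j)

lemma NearWell.integral_sq_le (hV : NearWell s c K ε r V) {m : ℝ} (hm : ∀ j, m ≤ s j)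
    (hm0 : 0 < m) {η : Pt → ℝ} (hη : Continuous η) (hc : HasCompactSupport η) (h0 : ∀ x, 0 ≤ η x)
    {a : ℝ} (h1 : ∀ x ∈ Metric.closedBall (0 : Pt) a, η x = 1) (z : Pt) :
    ∫ x in Metric.closedBall (0 : Pt) a, ∑ i, ∑ j, (jac V (x + z) i j - jac V x i j) ^ 2 ≤
      (1 / m) * ∫ x, η x * wnorm s (jac V (x + z) - jac V x) := by
  have hd := hV.continuous_diff z
  have hw : Continuous fun x => wnorm s (jac V (x + z) - jac V x) := by
    simp only [wnorm, Matrix.sub_apply]; fun_prop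
  have hw0 : ∀ x, 0 ≤ wnorm s (jac V (x + z) - jac V x) := fun x =>
    le_trans (by positivity) (sq_sum_le_wnorm hm _)
  have hI : Integrable fun x => η x * wnorm s (jac V (x + z) - jac V x) :=
    (hη.mul hw).integrable_of_hasCompactSupport hc.mul_right
  have hQ := isCompact_closedBall (0 : Pt) a
  calc _ ≤ ∫ x in Metric.closedBall (0 : Pt) a,
        (1 / m) * (η x * wnorm s (jac V (x + z) - jac V x)) := by
        refine setIntegral_mono_on ?_ (hI.const_mul _).integrableOn hQ.measurableSet fun x hx => ?_
        · exact integrableOn_compact (by fun_prop) hQ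
        · rw [h1 x hx, one_mul, one_div, ← div_eq_inv_mul, le_div_iff₀ hm0, mul_comm]
          exact sq_sum_le_wnorm hm _
    _ = (1 / m) * ∫ x in Metric.closedBall (0 : Pt) a,
        η x * wnorm s (jac V (x + z) - jac V x) := integral_const_mul _ _
    _ ≤ _ := by
        refine mul_le_mul_of_nonneg_left ?_ (by positivity)
        exact setIntegral_le_integral hI (ae_of_all _ fun x => mul_nonneg (h0 x) (hw0 x))

/-- `L¹` bound for differences of the gradient from an `L²` bound. -/
lemma setIntegral_abs_le_of_sq {Q : Set Pt} (hQ : IsCompact Q) {f : Pt → ℝ} (hf : Continuous f)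
    {M μ : ℝ} (hμ : 0 < μ) (hM : ∫ x in Q, f x ^ 2 ≤ M) :
    ∫ x in Q, |f x| ≤ μ * volume.real Q + M / μ := by
  have hI : IntegrableOn (fun x => f x ^ 2) Q := integrableOn_compact (by fun_prop) hQ
  calc ∫ x in Q, |f x| ≤ ∫ x in Q, (μ + f x ^ 2 / μ) := by
        refine setIntegral_mono_on (integrableOn_compact (by fun_prop) hQ)
          (integrableOn_compact (by fun_prop) hQ) hQ.measurableSet fun x _ => ?_
        have : μ + f x ^ 2 / μ = (μ ^ 2 + f x ^ 2) / μ := by field_simp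
        rw [this, le_div_iff₀ hμ, ← sq_abs (f x)]
        nlinarith [sq_nonneg (μ - |f x|), abs_nonneg (f x)]
    _ = μ * volume.real Q + (∫ x in Q, f x ^ 2) / μ := by
        have hI0 : IntegrableOn (fun _ : Pt => μ) Q := integrableOn_const hQ.measure_lt_top.ne
        refine (integral_add hI0 (hI.div_const μ)).trans ?_
        rw [integral_div, setIntegral_const, smul_eq_mul, mul_comm]
    _ ≤ _ := by gcongr

lemma NearWell.continuous_V (hV : NearWell s c K ε r V) (i : Fin 3) : Continuous (V i) :=
  (hV.smooth i).continuous

/-- The squared increments of `V` agree with those of its linearization to third order in the step,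
up to the error `ε`. -/
lemma exists_integral_sq_increment_le (hs : ∀ j, 0 < s j) (c K : ℝ) (hr : 0 < r) :
    ∃ C, 0 ≤ C ∧ ∀ (V : Fin 3 → Pt → ℝ) (ε : ℝ), NearWell s c K ε r V → ∀ (i k : Fin 3) (h : ℝ),
      0 < h → h ≤ r / 4 → h ≤ 1 →
      ∫ x in Metric.closedBall (0 : Pt) (r / 2),
        |(V i (x + h • axis k) - V i x) ^ 2 - (h * jac V x i k) ^ 2| ≤ C * (h ^ 3 + ε) := by
  obtain ⟨m, hm0, hm⟩ : ∃ m, 0 < m ∧ ∀ j, m ≤ s j :=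
    ⟨min (s 0) (min (s 1) (s 2)), by simp [hs], fun j => by fin_cases j <;> simp⟩
  obtain ⟨η, h1, h2, h3, h4, h5, B, hB0, hB, hB', hB''⟩ :=
    exists_cutoff_bound s (a := r / 2) (b := 3 * r / 4) (by linarith) (by linarith)
  obtain ⟨C2, hC2, H2⟩ := exists_integral_wnorm_diff_le s c K r h1 h2 h3 hB hB' hB''
  set Q := Metric.closedBall (0 : Pt) (r / 2) with hQdef
  have hQ : IsCompact Q := isCompact_closedBall _ _
  set C3 := volume.real Q + 1 / m * C2 with hC3
  have hC3' : 0 ≤ C3 := by positivity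
  refine ⟨2 * |K| * C3, by positivity, fun V ε hV i k h hh hhr hh1 => ?_⟩
  have hK := hV.K_nonneg
  have hε := hV.eps_nonneg
  have L2 : ∀ t ∈ Ioc 0 h, ∫ x in Q, |jac V (x + t • axis k) i k - jac V x i k| ≤
      C3 * (h + ε / h) := by
    intro t ht
    have e1 := (hV.integral_sq_le hm hm0 h1.continuous h2 h4 h5 (t • axis k)).trans
      (mul_le_mul_of_nonneg_left (H2 V ε hV k t ht.1.le (ht.2.trans hhr) (ht.2.trans hh1))
        (by positivity))
    have hd := hV.continuous_diff (t • axis k)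
    have e2 : ∫ x in Q, (jac V (x + t • axis k) i k - jac V x i k) ^ 2 ≤
        1 / m * (C2 * (t ^ 2 + ε)) := by
      refine le_trans (setIntegral_mono_on (integrableOn_compact (by fun_prop) hQ)
        (integrableOn_compact (by fun_prop) hQ) hQ.measurableSet fun x _ => ?_) e1
      have f1 := Finset.single_le_sum (f := fun j => (jac V (x + t • axis k) i j - jac V x i j) ^ 2)
        (fun j _ => sq_nonneg _) (Finset.mem_univ k)
      have f2 := Finset.single_le_sum
        (f := fun i => ∑ j, (jac V (x + t • axis k) i j - jac V x i j) ^ 2)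
        (fun j _ => by positivity) (Finset.mem_univ i)
      exact f1.trans f2
    refine (setIntegral_abs_le_of_sq hQ (hd i k) hh e2).trans ?_
    have e3 : t ^ 2 ≤ h ^ 2 := pow_le_pow_left₀ ht.1.le ht.2 2
    have e4 : 1 / m * (C2 * (t ^ 2 + ε)) / h ≤ 1 / m * C2 * (h + ε / h) := by
      rw [div_le_iff₀ hh]
      have : (h + ε / h) * h = h ^ 2 + ε := by field_simp
      rw [mul_assoc (1 / m * C2), this, mul_assoc]
      gcongr
    have e5 : h * volume.real Q ≤ volume.real Q * (h + ε / h) := by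
      rw [mul_comm]
      have : 0 ≤ ε / h := by positivity
      exact mul_le_mul_of_nonneg_left (by linarith) measureReal_nonneg
    rw [hC3, add_mul]
    exact add_le_add e5 e4
  have L1 : ∫ x in Q, |V i (x + h • axis k) - V i x - h * jac V x i k| ≤
      h * (C3 * (h + ε / h)) := by
    have cj := hV.continuous_jac i k
    have := setIntegral_abs_intervalIntegral_le
      (g := fun t x => jac V (x + t • axis k) i k - jac V x i k) (h := h)
      (by
        have : Continuous fun p : ℝ × Pt => jac V (p.2 + p.1 • axis k) i k :=
          cj.comp (by fun_prop)
        exact this.sub (cj.comp continuous_snd)) hQ hh.le L2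
    refine le_trans (le_of_eq ?_) this
    congr 1; ext x
    rw [sub_eq_integral_pd ((hV.smooth i).of_le (by simp)), intervalIntegral.integral_sub]
    · simp [jac]
    · have : Continuous fun t : ℝ => jac V (x + t • axis k) i k := cj.comp (by fun_prop)
      exact this.intervalIntegrable _ _
    · simp
  have cV := hV.continuous_V i
  have cj := hV.continuous_jac i k
  have cV' : Continuous fun x => V i (x + h • axis k) := cV.comp (by fun_prop)
  calc _ ≤ ∫ x in Q, (2 * K * h) * |V i (x + h • axis k) - V i x - h * jac V x i k| := by
        refine setIntegral_mono_on (integrableOn_compact (by fun_prop) hQ)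
          (integrableOn_compact (by fun_prop) hQ) hQ.measurableSet fun x _ => ?_
        rw [sq_sub_sq, abs_mul]
        refine mul_le_mul_of_nonneg_right ?_ (abs_nonneg _)
        refine (abs_add_le _ _).trans ?_
        rw [abs_mul, abs_of_pos hh]
        have := mul_le_mul_of_nonneg_left (hV.bound i k x) hh.le
        linarith [hV.abs_diff_le i k x hh.le]
    _ = (2 * K * h) * ∫ x in Q, |V i (x + h • axis k) - V i x - h * jac V x i k| :=
        integral_const_mul _ _
    _ ≤ (2 * K * h) * (h * (C3 * (h + ε / h))) := by gcongr
    _ = 2 * K * C3 * (h ^ 3 + ε * h) := by field_simp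
    _ ≤ _ := by
        rw [abs_of_nonneg hK]
        have : ε * h ≤ ε := mul_le_of_le_one_right hε hh1
        gcongr

/-- Translation estimate of third order: near the well, the gradient changes by much less than its
Lipschitz modulus would allow. This is where the constancy of `|A H⁻¹|²` on the well enters. -/
theorem exists_translation_estimate (hs : ∀ j, 0 < s j) (c K : ℝ) (hr : 0 < r) :
    ∃ C, 0 ≤ C ∧ ∃ t₀, 0 < t₀ ∧ ∀ (V : Fin 3 → Pt → ℝ) (ε : ℝ), NearWell s c K ε r V →
      ∀ (k : Fin 3) (h : ℝ), 0 < h → h ≤ t₀ →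
      ∫ x in Metric.closedBall (0 : Pt) (r / 4),
        ∑ i, ∑ j, (jac V (x + h • axis k) i j - jac V x i j) ^ 2 ≤ C * (h ^ 3 + ε) := by
  obtain ⟨m, hm0, hm⟩ : ∃ m, 0 < m ∧ ∀ j, m ≤ s j :=
    ⟨min (s 0) (min (s 1) (s 2)), by simp [hs], fun j => by fin_cases j <;> simp⟩
  obtain ⟨η, h1, h2, h3', h4, h5, B, hB0, hB, hB', hB''⟩ :=
    exists_cutoff_bound s (a := r / 4) (b := r / 2) (by linarith) (by linarith)
  have h3 : tsupport η ⊆ Metric.closedBall 0 (3 * r / 4) :=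
    h3'.trans (Metric.closedBall_subset_closedBall (by linarith))
  obtain ⟨C4, hC4, H4⟩ := exists_integral_sq_increment_le hs c K hr
  -- all steps `h σ_j / σ_k` with `σ_j = √(s j)` are at most `R h`
  obtain ⟨R, hR1, hR, hR'⟩ : ∃ R, 1 ≤ R ∧ (∀ j k, √(s j) / √(s k) ≤ R) ∧ ∀ k, 1 / √(s k) ≤ R := by
    refine ⟨1 + (∑ j, ∑ k, √(s j) / √(s k)) + ∑ k, 1 / √(s k), ?_, fun j k => ?_, fun k => ?_⟩
    · have : 0 ≤ ∑ j, ∑ k, √(s j) / √(s k) := by positivity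
      have : 0 ≤ ∑ k, 1 / √(s k) := by positivity
      linarith
    · have f1 := Finset.single_le_sum (f := fun k => √(s j) / √(s k))
        (fun j _ => by positivity) (Finset.mem_univ k)
      have f2 := Finset.single_le_sum (f := fun j => ∑ k, √(s j) / √(s k))
        (fun j _ => by positivity) (Finset.mem_univ j)
      have : 0 ≤ ∑ k, 1 / √(s k) := by positivity
      linarith
    · have f1 := Finset.single_le_sum (f := fun k => 1 / √(s k))
        (fun j _ => by positivity) (Finset.mem_univ k)
      have : 0 ≤ ∑ j, ∑ k, √(s j) / √(s k) := by positivity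
      linarith
  have hR0 : 0 < R := by linarith
  set C := 1 / m * (1 / 2 * B * R ^ 2 + 9 / 2 * B * C4 * R ^ 3 + 18 * |K| * B) with hC
  refine ⟨C, by positivity, min (r / 4) 1 / R, by positivity, ?_⟩
  intro V ε hV k h hh hht
  have hK := hV.K_nonneg
  have hε := hV.eps_nonneg
  set Q := Metric.closedBall (0 : Pt) (r / 2) with hQdef
  have hQ : IsCompact Q := isCompact_closedBall _ _
  have hRh : R * h ≤ min (r / 4) 1 := by rw [le_div_iff₀ hR0] at hht; linarith
  set t := h / √(s k) with ht
  have hsk : ∀ j, 0 < √(s j) := fun j => Real.sqrt_pos.2 (hs j)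
  have ht0 : 0 < t := div_pos hh (hsk k)
  have htR : t ≤ R * h := by
    rw [ht, div_eq_mul_one_div, mul_comm]
    exact mul_le_mul_of_nonneg_right (hR' k) hh.le
  set d : Fin 3 → ℝ := fun j => t * √(s j) with hd
  have hd0 : ∀ j, 0 < d j := fun j => mul_pos ht0 (hsk j)
  have hdk : d k = h := by simp only [hd, ht]; exact div_mul_cancel₀ h (hsk k).ne'
  have hdR : ∀ j, d j ≤ R * h := fun j => by
    have : d j = √(s j) / √(s k) * h := by simp only [hd, ht]; ring
    rw [this]
    exact mul_le_mul_of_nonneg_right (hR j k) hh.le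
  have hdsq : ∀ j, d j ^ 2 = t ^ 2 * s j := fun j => by
    simp only [hd]; rw [mul_pow, Real.sq_sqrt (hs j).le]
  set L : Pt → ℝ := fun x => ∑ j, s j * pd j (pd j η) x with hL
  have hpp : ∀ j, ContDiff ℝ ∞ (pd j (pd j η)) := fun j => contDiff_pd (contDiff_pd h1 j) j
  have cL : Continuous L := by
    have := fun j => (hpp j).continuous
    simp only [hL]; fun_prop
  have hz : ∀ x ∉ Q, L x = 0 := fun x hx => by
    have h1 : x ∉ tsupport η := fun h => hx (h3' h)
    have h2 : ∀ j, x ∉ tsupport (pd j η) := fun j h =>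
      h1 (tsupport_fderiv_apply_subset ℝ (axis j) h)
    have : ∀ j, pd j (pd j η) x = 0 := fun j =>
      image_eq_zero_of_notMem_tsupport fun h => h2 j (tsupport_fderiv_apply_subset ℝ (axis j) h)
    simp [hL, this]
  have cV := hV.continuous_V
  have cj := hV.continuous_jac
  -- the second-order part of each of the three identities
  have step : ∀ j, ∫ x, L x * (1 / 2 * ∑ i, (V i (x + d j • axis j) - V i x) ^ 2) ≤
      (∫ x in Q, L x * (1 / 2 * ∑ i, (d j * jac V x i j) ^ 2)) +
        3 / 2 * B * C4 * (R ^ 3 * h ^ 3 + ε) := by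
    intro j
    have cV' : ∀ i, Continuous fun x => V i (x + d j • axis j) := fun i =>
      (cV i).comp (by fun_prop)
    rw [← setIntegral_eq_integral_of_forall_compl_eq_zero (s := Q)
      (fun x hx => by simp [hz x hx])]
    rw [← sub_le_iff_le_add', ← integral_sub
      (integrableOn_compact (by fun_prop) hQ)
      (integrableOn_compact (by fun_prop) hQ)]
    calc _ ≤ ∫ x in Q, 1 / 2 * B * ∑ i, |(V i (x + d j • axis j) - V i x) ^ 2
          - (d j * jac V x i j) ^ 2| := by
          refine setIntegral_mono_on (integrableOn_compact (by fun_prop) hQ)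
            (integrableOn_compact (by fun_prop) hQ) hQ.measurableSet fun x _ => ?_
          rw [← mul_sub, ← mul_sub, ← Finset.sum_sub_distrib]
          refine (le_abs_self _).trans ?_
          rw [abs_mul, abs_mul, abs_of_pos (by norm_num : (0 : ℝ) < 1 / 2), mul_comm (1 / 2) B,
            mul_assoc B]
          refine mul_le_mul (hB'' x) ?_ (by positivity) hB0
          exact mul_le_mul_of_nonneg_left (Finset.abs_sum_le_sum_abs _ _) (by norm_num)
      _ = 1 / 2 * B * ∑ i, ∫ x in Q, |(V i (x + d j • axis j) - V i x) ^ 2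
          - (d j * jac V x i j) ^ 2| := by
          rw [integral_const_mul, integral_finsetSum]
          exact fun i _ => integrableOn_compact (by fun_prop) hQ
      _ ≤ 1 / 2 * B * ∑ _i : Fin 3, C4 * (R ^ 3 * h ^ 3 + ε) := by
          refine mul_le_mul_of_nonneg_left (Finset.sum_le_sum fun i _ => ?_) (by positivity)
          have := min_le_left (r / 4) 1
          have := min_le_right (r / 4) 1
          refine (H4 V ε hV i j (d j) (hd0 j) (by linarith [hdR j]) (by linarith [hdR j])).trans ?_
          rw [← mul_pow]
          exact mul_le_mul_of_nonneg_left (by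
            have := pow_le_pow_left₀ (hd0 j).le (hdR j) 3
            linarith) hC4
      _ = _ := by
          simp only [Finset.sum_const, Finset.card_univ, Fintype.card_fin, nsmul_eq_mul]
          push_cast; ring
  have hsum : ∑ j, ∫ x in Q, L x * (1 / 2 * ∑ i, (d j * jac V x i j) ^ 2) ≤
      1 / 2 * B * t ^ 2 * ε := by
    rw [← integral_finsetSum _ fun j _ => integrableOn_compact (by fun_prop) hQ]
    have cw := hV.continuous_wnorm
    have e0 : ∫ x in Q, L x = 0 := by
      rw [setIntegral_eq_integral_of_forall_compl_eq_zero hz]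
      have hpc : ∀ j, HasCompactSupport (pd j η) := fun j => h2.fderiv_apply (𝕜 := ℝ) (axis j)
      simp only [hL]
      rw [integral_finsetSum _ fun j _ => ((hpp j).continuous.integrable_of_hasCompactSupport
        ((hpc j).fderiv_apply (𝕜 := ℝ) (axis j))).const_mul _]
      refine Finset.sum_eq_zero fun j _ => ?_
      rw [integral_const_mul, integral_pd_eq_zero ((contDiff_pd h1 j).of_le (by simp)) (hpc j),
        mul_zero]
    have e1 : ∀ x, ∑ j, L x * (1 / 2 * ∑ i, (d j * jac V x i j) ^ 2) =
        1 / 2 * t ^ 2 * (L x * (wnorm s (jac V x) - 3)) + (3 / 2 * t ^ 2) * L x := by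
      intro x
      simp only [mul_pow, hdsq, wnorm, Fin.sum_univ_three]
      ring
    simp only [e1]
    rw [integral_add (integrableOn_compact (by fun_prop) hQ)
      (integrableOn_compact (by fun_prop) hQ), integral_const_mul,
      integral_const_mul, e0, mul_zero, add_zero]
    have e2 : ∫ x in Q, L x * (wnorm s (jac V x) - 3) ≤ B * ε := by
      calc _ ≤ ∫ x in Q, B * |wnorm s (jac V x) - 3| := by
            refine setIntegral_mono_on (integrableOn_compact (by fun_prop) hQ)
              (integrableOn_compact (by fun_prop) hQ) hQ.measurableSet
              fun x _ => (le_abs_self _).trans ?_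
            rw [abs_mul]
            exact mul_le_mul_of_nonneg_right (hB'' x) (abs_nonneg _)
        _ = B * ∫ x in Q, |wnorm s (jac V x) - 3| := integral_const_mul _ _
        _ ≤ B * ε := by
            refine mul_le_mul_of_nonneg_left (le_trans ?_ hV.norm) hB0
            refine setIntegral_mono_set (integrableOn_compact (by fun_prop)
              (isCompact_closedBall _ _)) (ae_of_all _ fun x => abs_nonneg _) ?_
            exact (Metric.closedBall_subset_closedBall (by linarith)).eventuallyLE
    calc _ ≤ 1 / 2 * t ^ 2 * (B * ε) := mul_le_mul_of_nonneg_left e2 (by positivity)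
      _ = _ := by ring
  have hle : ∀ j, ∫ x, η x * wnorm s (jac V (x + d j • axis j) - jac V x) ≤
      (∫ x, L x * (1 / 2 * ∑ i, (V i (x + d j • axis j) - V i x) ^ 2)) + 6 * K * B * ε := by
    intro j
    have := min_le_left (r / 4) 1
    have := min_le_right (r / 4) 1
    rw [integral_wnorm_diff_eq s c hV.smooth h1 h2]
    exact add_le_add le_rfl (hV.integral_error_le h3 hB hB' j (hd0 j).le (by linarith [hdR j])
      (by linarith [hdR j]))
  have hnn : ∀ j, 0 ≤ ∫ x, η x * wnorm s (jac V (x + d j • axis j) - jac V x) := fun j =>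
    integral_nonneg fun x => mul_nonneg (h4 x)
      (le_trans (by positivity) (sq_sum_le_wnorm hm _))
  have hfin : ∫ x, η x * wnorm s (jac V (x + h • axis k) - jac V x) ≤
      1 / 2 * B * t ^ 2 * ε + 9 / 2 * B * C4 * (R ^ 3 * h ^ 3 + ε) + 18 * K * B * ε := by
    have f1 := Finset.single_le_sum (f := fun j =>
      ∫ x, η x * wnorm s (jac V (x + d j • axis j) - jac V x)) (fun j _ => hnn j)
      (Finset.mem_univ k)
    simp only [hdk] at f1
    refine f1.trans ?_
    refine (Finset.sum_le_sum fun j _ => (hle j).trans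
      (add_le_add (step j) (le_refl (6 * K * B * ε)))).trans ?_
    rw [Finset.sum_add_distrib, Finset.sum_add_distrib]
    simp only [Finset.sum_const, Finset.card_univ, Fintype.card_fin, nsmul_eq_mul]
    push_cast
    linarith
  refine (hV.integral_sq_le hm hm0 h1.continuous h2 h4 h5 (h • axis k)).trans ?_
  rw [hC, mul_assoc (1 / m)]
  refine mul_le_mul_of_nonneg_left (hfin.trans ?_) (by positivity)
  rw [abs_of_nonneg hK]
  have g1 : t ^ 2 ≤ R ^ 2 := by
    refine pow_le_pow_left₀ ht0.le (htR.trans ?_) 2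
    exact (hRh.trans (min_le_right _ _)).trans hR1
  have g2 : R ^ 3 * h ^ 3 + ε ≤ R ^ 3 * (h ^ 3 + ε) := by
    have : 1 ≤ R ^ 3 := one_le_pow₀ hR1
    nlinarith
  have g3 : ε ≤ h ^ 3 + ε := by linarith [pow_pos hh 3]
  calc _ ≤ 1 / 2 * B * R ^ 2 * (h ^ 3 + ε) + 9 / 2 * B * C4 * (R ^ 3 * (h ^ 3 + ε))
      + 18 * K * B * (h ^ 3 + ε) := by gcongr
    _ = _ := by ring

end NearWell

/-! ### Lipschitz truncation -/

/-- The linear map of `ℝ³` with matrix `A`. -/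
def lin (A : Mat) : Pt →L[ℝ] Pt := LinearMap.toContinuousLinearMap (Matrix.mulVecLin A)

lemma lin_apply (A : Mat) (v : Pt) (i : Fin 3) : lin A v i = ∑ j, A i j * v j := rfl

@[simp] lemma lin_axis (A : Mat) (i j : Fin 3) : lin A (axis j) i = A i j := by
  simp [lin_apply, Pi.single_apply]

lemma norm_lin_le {A : Mat} {M : ℝ} (hM : ∀ i j, |A i j| ≤ M) (v : Pt) :
    ‖lin A v‖ ≤ 3 * M * ‖v‖ := by
  have hM0 : 0 ≤ M := (abs_nonneg _).trans (hM 0 0)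
  rw [pi_norm_le_iff_of_nonneg (by positivity)]
  intro i
  rw [lin_apply, Real.norm_eq_abs]
  calc |∑ j, A i j * v j| ≤ ∑ j, |A i j * v j| := Finset.abs_sum_le_sum_abs _ _
    _ ≤ ∑ _j : Fin 3, M * ‖v‖ := by
        refine Finset.sum_le_sum fun j _ => ?_
        rw [abs_mul]
        exact mul_le_mul (hM i j) (norm_le_pi_norm v j) (abs_nonneg _) hM0
    _ = _ := by simp; ring

lemma continuous_lin {F : Pt → Mat} (hF : Continuous F) (v : Pt) :
    Continuous fun x => lin (F x) v :=
  hF.matrix_mulVec continuous_const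

lemma volume_real_closedBall (x : Pt) {ρ : ℝ} (hρ : 0 ≤ ρ) :
    volume.real (Metric.closedBall x ρ) = (2 * ρ) ^ 3 := by
  rw [Measure.real, Real.volume_pi_closedBall x hρ, ENNReal.toReal_ofReal (by positivity)]
  simp

/-- The weak-type maximal inequality on cubes: outside a set of measure at most `125 ∫ d`, all
averages of `d` over cubes of half-side at most `2 r` are bounded by one. -/
lemma exists_good_set {d : Pt → ℝ} (hd : Continuous d) (h0 : ∀ x, 0 ≤ d x) (r : ℝ) :
    ∃ G, MeasurableSet G ∧ G ⊆ Metric.closedBall (0 : Pt) r ∧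
      volume.real (Metric.closedBall (0 : Pt) r \ G) ≤
        125 * ∫ x in Metric.closedBall (0 : Pt) (3 * r), d x ∧
      ∀ x ∈ G, ∀ ρ, 0 < ρ → ρ ≤ 2 * r → ∫ y in Metric.closedBall x ρ, d y ≤ (2 * ρ) ^ 3 := by
  set Bd : Set Pt := {x | x ∈ Metric.closedBall (0 : Pt) r ∧ ∃ ρ, 0 < ρ ∧ ρ ≤ 2 * r ∧
    (2 * ρ) ^ 3 < ∫ y in Metric.closedBall x ρ, d y} with hBd
  have hI : ∀ (x : Pt) ρ, IntegrableOn d (Metric.closedBall x ρ) := fun x ρ =>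
    integrableOn_compact hd (isCompact_closedBall _ _)
  have hex : ∀ x, ∃ ρ, x ∈ Bd → 0 < ρ ∧ ρ ≤ 2 * r ∧
      (2 * ρ) ^ 3 < ∫ y in Metric.closedBall x ρ, d y := fun x => by
    by_cases hx : x ∈ Bd
    · obtain ⟨ρ, h⟩ := hx.2; exact ⟨ρ, fun _ => h⟩
    · exact ⟨0, fun h => absurd h hx⟩
  choose ρ hρ using hex
  obtain ⟨u, hu, hdisj, hcov⟩ := Vitali.exists_disjoint_subfamily_covering_enlargement_closedBall
    Bd (fun x : Pt => x) ρ (2 * r) (fun a ha => (hρ a ha).2.1) 5 (by norm_num)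
  have hcount : u.Countable := hdisj.countable_of_nonempty_interior fun a ha => by
    have := (hρ a (hu ha)).1
    exact ⟨a, mem_interior_iff_mem_nhds.2 (Metric.closedBall_mem_nhds a this)⟩
  have hvol : volume Bd ≤
      125 * ∫⁻ x in Metric.closedBall (0 : Pt) (3 * r), ENNReal.ofReal (d x) := by
    have h1 : Bd ⊆ ⋃ a ∈ u, Metric.closedBall a (5 * ρ a) := fun x hx => by
      obtain ⟨b, hb, hsub⟩ := hcov x hx
      exact mem_biUnion hb (hsub (Metric.mem_closedBall_self (hρ x hx).1.le))
    have h2 : ∀ a ∈ u, volume (Metric.closedBall a (5 * ρ a)) ≤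
        125 * ∫⁻ x in Metric.closedBall a (ρ a), ENNReal.ofReal (d x) := fun a ha => by
      obtain ⟨p1, _, p3⟩ := hρ a (hu ha)
      rw [Real.volume_pi_closedBall _ (by positivity), ← ofReal_integral_eq_lintegral_ofReal
        (hI _ _) (ae_of_all _ h0), show (125 : ℝ≥0∞) = ENNReal.ofReal 125 by simp,
        ← ENNReal.ofReal_mul (by norm_num)]
      refine ENNReal.ofReal_le_ofReal ?_
      simp only [Fintype.card_fin]
      nlinarith
    calc volume Bd ≤ volume (⋃ a ∈ u, Metric.closedBall a (5 * ρ a)) := measure_mono h1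
      _ ≤ ∑' a : u, volume (Metric.closedBall (a : Pt) (5 * ρ a)) := measure_biUnion_le _ hcount _
      _ ≤ ∑' a : u, 125 * ∫⁻ x in Metric.closedBall (a : Pt) (ρ a), ENNReal.ofReal (d x) :=
          ENNReal.tsum_le_tsum fun a => h2 a a.2
      _ = 125 * ∫⁻ x in ⋃ a ∈ u, Metric.closedBall a (ρ a), ENNReal.ofReal (d x) := by
          rw [ENNReal.tsum_mul_left, lintegral_biUnion hcount
            (fun a _ => Metric.isClosed_closedBall.measurableSet) hdisj]
      _ ≤ _ := by
          gcongr
          refine iUnion₂_subset fun a ha => ?_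
          have := (hρ a (hu ha)).2.1
          refine Metric.closedBall_subset_closedBall' ?_
          have : dist a 0 ≤ r := (hu ha).1
          linarith
  set T := toMeasurable volume Bd with hT
  refine ⟨Metric.closedBall 0 r \ T, Metric.isClosed_closedBall.measurableSet.diff
    (measurableSet_toMeasurable _ _), sdiff_subset, ?_, ?_⟩
  · have h1 : Metric.closedBall (0 : Pt) r \ (Metric.closedBall 0 r \ T) ⊆ T := fun x hx => by
      by_contra h; exact hx.2 ⟨hx.1, h⟩
    have h2 : volume (Metric.closedBall (0 : Pt) r \ (Metric.closedBall 0 r \ T)) ≤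
        125 * ∫⁻ x in Metric.closedBall (0 : Pt) (3 * r), ENNReal.ofReal (d x) :=
      (measure_mono h1).trans ((measure_toMeasurable Bd).le.trans hvol)
    rw [← ofReal_integral_eq_lintegral_ofReal (hI _ _) (ae_of_all _ h0),
      show (125 : ℝ≥0∞) = ENNReal.ofReal 125 by simp, ← ENNReal.ofReal_mul (by norm_num)] at h2
    exact ENNReal.toReal_le_of_le_ofReal
      (mul_nonneg (by norm_num) (integral_nonneg fun x => h0 x)) h2
  · intro x hx ρ' h1 h2
    by_contra h3
    exact hx.2 (subset_toMeasurable _ _ ⟨hx.1, ρ', h1, h2, not_le.1 h3⟩)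

section Truncation

variable {u : Pt → Pt} {F : Pt → Mat} {d : Pt → ℝ} {Λ r : ℝ}

open scoped Pointwise in
/-- The mean oscillation of `u` around a point where all averages of `d` are bounded. -/
lemma setIntegral_norm_sub_le (hF : Continuous F) (hd : Continuous d)
    (hFd : ∀ x i j, |F x i j| ≤ Λ + d x) {x : Pt} {ρ : ℝ} (hρ : 0 < ρ)
    (hu : ∀ y ∈ Metric.closedBall x ρ, HasFDerivAt u (lin (F y)) y)
    (hx : ∀ t, 0 < t → t ≤ ρ → ∫ y in Metric.closedBall x t, d y ≤ (2 * t) ^ 3) :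
    ∫ y in Metric.closedBall (0 : Pt) ρ, ‖u (x + y) - u x‖ ≤
      ρ * (3 * (Λ + 1) * (2 * ρ) ^ 3) := by
  set Q := Metric.closedBall (0 : Pt) ρ with hQd
  have hQ : IsCompact Q := isCompact_closedBall _ _
  set g : Pt → ℝ := fun x => 3 * (Λ + d x) with hg
  have hgc : Continuous g := by fun_prop
  have hg0 : ∀ x, 0 ≤ g x := fun x => by
    have := (abs_nonneg _).trans (hFd x 0 0)
    simp only [hg]; linarith
  have hmem : ∀ y ∈ Q, ∀ t ∈ Icc (0 : ℝ) 1, x + t • y ∈ Metric.closedBall x ρ := by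
    intro y hy t ht
    rw [mem_closedBall_zero_iff] at hy
    rw [mem_closedBall_iff_norm, add_sub_cancel_left, norm_smul, Real.norm_eq_abs,
      abs_of_nonneg ht.1]
    exact (mul_le_of_le_one_left (norm_nonneg y) ht.2).trans hy
  have hpt : ∀ y ∈ Q, ‖u (x + y) - u x‖ ≤ ρ * |∫ t in (0:ℝ)..1, g (x + t • y)| := by
    intro y hy
    have hder : ∀ t ∈ uIcc (0 : ℝ) 1,
        HasDerivAt (fun t : ℝ => u (x + t • y)) (lin (F (x + t • y)) y) t := by
      intro t ht
      rw [uIcc_of_le zero_le_one] at ht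
      have h1 : HasDerivAt (fun s : ℝ => x + s • y) y t := by
        simpa using ((hasDerivAt_id t).smul_const y).const_add x
      exact (hu _ (hmem y hy t ht)).comp_hasDerivAt t h1
    have hc : Continuous fun t : ℝ => lin (F (x + t • y)) y :=
      (continuous_lin hF y).comp (by fun_prop)
    have hft := intervalIntegral.integral_eq_sub_of_hasDerivAt hder (hc.intervalIntegrable _ _)
    simp only [one_smul, zero_smul, add_zero] at hft
    rw [← hft]
    have hy' : ‖y‖ ≤ ρ := mem_closedBall_zero_iff.1 hy
    have hgi : Continuous fun t : ℝ => g (x + t • y) := hgc.comp (by fun_prop)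
    calc _ ≤ ∫ t in (0:ℝ)..1, ρ * g (x + t • y) := by
          refine intervalIntegral.norm_integral_le_of_norm_le zero_le_one
            (ae_of_all _ fun t _ => ?_) ((hgi.const_mul ρ).intervalIntegrable _ _)
          refine (norm_lin_le (fun i j => hFd (x + t • y) i j) y).trans ?_
          rw [mul_comm]
          exact mul_le_mul_of_nonneg_right hy' (hg0 (x + t • y))
      _ = ρ * ∫ t in (0:ℝ)..1, g (x + t • y) := intervalIntegral.integral_const_mul _ _
      _ ≤ _ := by gcongr; exact le_abs_self _
  have hgc2 : Continuous fun p : ℝ × Pt => g (x + p.1 • p.2) := hgc.comp (by fun_prop)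
  have hslice : ∀ t ∈ Ioc (0 : ℝ) 1, ∫ y in Q, |g (x + t • y)| ≤ 3 * (Λ + 1) * (2 * ρ) ^ 3 := by
    intro t ht
    simp only [fun y => abs_of_nonneg (hg0 (x + t • y))]
    rw [Measure.setIntegral_comp_smul_of_pos volume (fun y => g (x + y)) Q ht.1]
    have hsm : t • Q = Metric.closedBall 0 (t * ρ) := by
      rw [hQd, smul_closedBall _ _ hρ.le, smul_zero, Real.norm_of_nonneg ht.1.le]
    have htr : ∫ y in Metric.closedBall (0 : Pt) (t * ρ), g (x + y) =
        ∫ y in Metric.closedBall x (t * ρ), g y := by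
      have h1 := (measurePreserving_add_left (volume : Measure Pt) x).setIntegral_preimage_emb
        (measurableEmbedding_addLeft x) g (Metric.closedBall x (t * ρ))
      rw [← h1]
      congr 2
      ext y; simp
    have htρ : 0 < t * ρ := mul_pos ht.1 hρ
    have hv : ∫ y in Metric.closedBall x (t * ρ), g y ≤ 3 * (Λ + 1) * (2 * (t * ρ)) ^ 3 := by
      have hId : IntegrableOn d (Metric.closedBall x (t * ρ)) :=
        integrableOn_compact hd (isCompact_closedBall _ _)
      have hIc : IntegrableOn (fun _ => Λ) (Metric.closedBall x (t * ρ)) :=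
        integrableOn_const (isCompact_closedBall _ _).measure_lt_top.ne
      have e := hx (t * ρ) htρ (mul_le_of_le_one_left hρ.le ht.2)
      have : ∫ y in Metric.closedBall x (t * ρ), g y =
          3 * ((2 * (t * ρ)) ^ 3 * Λ + ∫ y in Metric.closedBall x (t * ρ), d y) := by
        simp only [hg]
        rw [integral_const_mul, integral_add hIc hId, setIntegral_const,
          volume_real_closedBall x htρ.le, smul_eq_mul]
      rw [this]
      nlinarith
    rw [hsm, htr, smul_eq_mul, show Module.finrank ℝ Pt = 3 by simp,
      inv_mul_le_iff₀ (pow_pos ht.1 3)]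
    refine hv.trans (le_of_eq ?_)
    ring
  have hx2 : Continuous fun y => ∫ t in (0:ℝ)..1, g (x + t • y) :=
    intervalIntegral.continuous_parametric_intervalIntegral_of_continuous'
      (f := fun y t => g (x + t • y)) (hgc2.comp continuous_swap) 0 1
  have huc : ContinuousOn (fun y => ‖u (x + y) - u x‖) Q := by
    have h1 : ContinuousOn u (Metric.closedBall x ρ) := fun y hy =>
      (hu y hy).continuousAt.continuousWithinAt
    have h2 : ContinuousOn (fun y => u (x + y)) Q :=
      h1.comp (by fun_prop) fun y hy => by simpa using hmem y hy 1 (by simp)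
    exact (h2.sub continuousOn_const).norm
  calc _ ≤ ∫ y in Q, ρ * |∫ t in (0:ℝ)..1, g (x + t • y)| :=
        setIntegral_mono_on (huc.integrableOn_compact hQ)
          (integrableOn_compact (by fun_prop) hQ) hQ.measurableSet hpt
    _ = ρ * ∫ y in Q, |∫ t in (0:ℝ)..1, g (x + t • y)| := integral_const_mul _ _
    _ ≤ _ := by
        have := setIntegral_abs_intervalIntegral_le (g := fun t y => g (x + t • y)) hgc2 hQ
          zero_le_one hslice
        rw [one_mul] at this
        gcongr

/-- Lipschitz truncation: a map whose gradient is bounded by `Λ + d` agrees with a map of Lipschitz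
constant `48 (Λ + 1)` outside a set of measure at most `125 ∫ d`. -/
theorem exists_lipschitz_truncation (hF : Continuous F) (hd : Continuous d) (h0 : ∀ x, 0 ≤ d x)
    (hFd : ∀ x i j, |F x i j| ≤ Λ + d x) (hΛ : 0 ≤ Λ) (hr : 0 < r)
    (hu : ∀ x ∈ Metric.closedBall (0 : Pt) (3 * r), HasFDerivAt u (lin (F x)) x) :
    ∃ v : Pt → Pt, LipschitzWith (Real.toNNReal (48 * (Λ + 1))) v ∧ ∃ G, MeasurableSet G ∧
      G ⊆ Metric.closedBall (0 : Pt) r ∧ volume.real (Metric.closedBall (0 : Pt) r \ G) ≤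
        125 * ∫ x in Metric.closedBall (0 : Pt) (3 * r), d x ∧
      ∀ᵐ x ∂volume.restrict G, fderiv ℝ v x = lin (F x) := by
  obtain ⟨G, hGm, hGr, hGv, hG⟩ := exists_good_set hd h0 r
  have hball : ∀ x ∈ G, ∀ ρ ≤ 2 * r,
      Metric.closedBall x ρ ⊆ Metric.closedBall (0 : Pt) (3 * r) := by
    intro x hx ρ hρ
    have : dist x 0 ≤ r := hGr hx
    exact Metric.closedBall_subset_closedBall' (by linarith)
  have hucont : ContinuousOn u (Metric.closedBall (0 : Pt) (3 * r)) := fun y hy =>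
    (hu y hy).continuousAt.continuousWithinAt
  have hlip : LipschitzOnWith (Real.toNNReal (48 * (Λ + 1))) u G := by
    refine LipschitzOnWith.of_dist_le_mul fun x hx y hy => ?_
    rw [Real.coe_toNNReal _ (by positivity)]
    rcases eq_or_ne x y with rfl | hxy
    · simp
    set ρ := dist x y with hρd
    have hρ : 0 < ρ := dist_pos.2 hxy
    have hρ2 : ρ ≤ 2 * r := by
      have h1 : dist x 0 ≤ r := hGr hx
      have h2 : dist y 0 ≤ r := hGr hy
      have := dist_triangle_right x y 0
      linarith
    -- compare both values with the values of `u` on the cube around the midpoint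
    set m := midpoint ℝ x y with hm
    have hmx : dist m x = ρ / 2 := by
      rw [hm, dist_midpoint_left, hρd]; norm_num; ring
    have hmy : dist m y = ρ / 2 := by
      rw [hm, dist_midpoint_right, hρd]; norm_num; ring
    set Qm := Metric.closedBall m (ρ / 2) with hQm
    have key : ∀ z ∈ G, dist m z = ρ / 2 → ∫ w in Qm, ‖u w - u z‖ ≤
        ρ * (3 * (Λ + 1) * (2 * ρ) ^ 3) := by
      intro z hz hzm
      have e1 := setIntegral_norm_sub_le hF hd hFd hρ
        (fun w hw => hu w (hball z hz ρ hρ2 hw)) (fun t ht ht' => hG z hz t ht (ht'.trans hρ2))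
      have e2 : ∫ w in Metric.closedBall (0 : Pt) ρ, ‖u (z + w) - u z‖ =
          ∫ w in Metric.closedBall z ρ, ‖u w - u z‖ := by
        have h1 := (measurePreserving_add_left (volume : Measure Pt) z).setIntegral_preimage_emb
          (measurableEmbedding_addLeft z) (fun w => ‖u w - u z‖) (Metric.closedBall z ρ)
        rw [← h1]
        congr 2
        ext w; simp
      refine le_trans ?_ (e2 ▸ e1)
      refine setIntegral_mono_set ?_ (ae_of_all _ fun w => norm_nonneg _) ?_
      · exact (((hucont.mono (hball z hz ρ hρ2)).sub continuousOn_const).norm).integrableOn_compact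
          (isCompact_closedBall _ _)
      · exact (Metric.closedBall_subset_closedBall' (by linarith)).eventuallyLE
    have hQmc : IsCompact Qm := isCompact_closedBall _ _
    have hsub : Qm ⊆ Metric.closedBall (0 : Pt) (3 * r) :=
      (Metric.closedBall_subset_closedBall' (by linarith)).trans (hball x hx ρ hρ2)
    have hIz : ∀ z, IntegrableOn (fun w => ‖u w - u z‖) Qm := fun z =>
      (((hucont.mono hsub).sub continuousOn_const).norm).integrableOn_compact hQmc
    have hmain : ρ ^ 3 * dist (u x) (u y) ≤ 2 * (ρ * (3 * (Λ + 1) * (2 * ρ) ^ 3)) := by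
      calc ρ ^ 3 * dist (u x) (u y) = ∫ _w in Qm, dist (u x) (u y) := by
            rw [setIntegral_const, hQm, volume_real_closedBall m (by linarith), smul_eq_mul]
            congr 1; ring
        _ ≤ ∫ w in Qm, (‖u w - u x‖ + ‖u w - u y‖) := by
            refine setIntegral_mono_on (integrableOn_const hQmc.measure_lt_top.ne)
              ((hIz x).add (hIz y)) hQmc.measurableSet fun w _ => ?_
            rw [← dist_eq_norm, ← dist_eq_norm]
            exact dist_triangle_left _ _ _
        _ = (∫ w in Qm, ‖u w - u x‖) + ∫ w in Qm, ‖u w - u y‖ := integral_add (hIz x) (hIz y)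
        _ ≤ _ := by linarith [key x hx hmx, key y hy hmy]
    have h3 : 0 < ρ ^ 3 := pow_pos hρ 3
    have : ρ ^ 3 * dist (u x) (u y) ≤ ρ ^ 3 * (48 * (Λ + 1) * ρ) := by
      refine hmain.trans (le_of_eq ?_); ring
    exact le_of_mul_le_mul_left this h3
  obtain ⟨v, hv, hvu⟩ := hlip.extend_pi
  refine ⟨v, hv, G, hGm, hGr, hGv, ?_⟩
  set S := G ∩ {x | DifferentiableAt ℝ v x} with hS
  have hSm : MeasurableSet S := hGm.inter (measurableSet_of_differentiableAt ℝ v)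
  have happ : ApproximatesLinearOn (fun x => v x - u x) (0 : Pt →L[ℝ] Pt) S 0 := by
    intro x hx y hy
    simp [← hvu hx.1, ← hvu hy.1]
  have hder := happ.norm_fderiv_sub_le volume hSm (fun x => fderiv ℝ v x - lin (F x))
    (fun x hx => (hx.2.hasFDerivAt.sub (hu x (Metric.closedBall_subset_closedBall
      (by linarith) (hGr hx.1)))).hasFDerivWithinAt)
  rw [ae_restrict_iff' hSm] at hder
  rw [ae_restrict_iff' hGm]
  filter_upwards [hder, hv.ae_differentiableAt] with x h1 h2 hx
  have := h1 ⟨hx, h2⟩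
  simpa [sub_eq_zero] using this

end Truncation

/-! ### Distance from a well -/

lemma frobNorm_eq_norm (A : Mat) :
    frobNorm A = ‖WithLp.toLp 2 (fun q : Fin 3 × Fin 3 => A q.1 q.2)‖ := by
  simp [frobNorm, EuclideanSpace.norm_eq, Fintype.sum_prod_type]

lemma frobNorm_nonneg (A : Mat) : 0 ≤ frobNorm A := Real.sqrt_nonneg _

lemma frobNorm_add_le (A B : Mat) : frobNorm (A + B) ≤ frobNorm A + frobNorm B := by
  simp only [frobNorm_eq_norm]
  exact norm_add_le (WithLp.toLp 2 fun q : Fin 3 × Fin 3 => A q.1 q.2)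
    (WithLp.toLp 2 fun q : Fin 3 × Fin 3 => B q.1 q.2)

lemma abs_apply_le_frobNorm (A : Mat) (i j : Fin 3) : |A i j| ≤ frobNorm A := by
  rw [frobNorm_eq_norm]
  exact PiLp.norm_apply_le (WithLp.toLp 2 fun q : Fin 3 × Fin 3 => A q.1 q.2) (i, j)

lemma frobNorm_le_sum (A : Mat) : frobNorm A ≤ ∑ i, ∑ j, |A i j| := by
  rw [frobNorm]
  refine Real.sqrt_le_iff.2 ⟨by positivity, ?_⟩
  have h : ∀ q ∈ (Finset.univ : Finset (Fin 3 × Fin 3)), 0 ≤ |A q.1 q.2| := fun q _ => abs_nonneg _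
  have := Finset.sum_sq_le_sq_sum_of_nonneg h
  simpa [Fintype.sum_prod_type] using this

lemma continuous_frobNorm : Continuous frobNorm := by
  unfold frobNorm; fun_prop

lemma bddBelow_distWell (H A : Mat) : BddBelow (range fun
    R : Matrix.specialOrthogonalGroup (Fin 3) ℝ => frobNorm (A - (R : Mat) * H)) :=
  ⟨0, by rintro _ ⟨R, rfl⟩; exact frobNorm_nonneg _⟩

lemma distWell_le (H A : Mat) (R : Matrix.specialOrthogonalGroup (Fin 3) ℝ) :
    distWell H A ≤ frobNorm (A - (R : Mat) * H) := ciInf_le (bddBelow_distWell H A) R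

lemma le_distWell {H A : Mat} {x : ℝ}
    (h : ∀ R : Matrix.specialOrthogonalGroup (Fin 3) ℝ, x ≤ frobNorm (A - (R : Mat) * H)) :
    x ≤ distWell H A := le_ciInf h

lemma distWell_nonneg (H A : Mat) : 0 ≤ distWell H A := le_distWell fun _ => frobNorm_nonneg _

lemma distWell_le_add (H A B : Mat) : distWell H A ≤ distWell H B + frobNorm (A - B) := by
  rw [← sub_le_iff_le_add]
  refine le_distWell fun R => ?_
  have h := frobNorm_add_le (A - B) (B - (R : Mat) * H)
  rw [sub_add_sub_cancel] at h
  linarith [distWell_le H A R]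

lemma frobNorm_sub_comm (A B : Mat) : frobNorm (A - B) = frobNorm (B - A) := by
  simp only [frobNorm, Matrix.sub_apply]
  congr 1
  exact Finset.sum_congr rfl fun i _ => Finset.sum_congr rfl fun j _ => by ring

lemma abs_distWell_sub_le (H A B : Mat) : |distWell H A - distWell H B| ≤ frobNorm (A - B) := by
  rw [abs_le]
  have h1 := distWell_le_add H A B
  have h2 := distWell_le_add H B A
  rw [frobNorm_sub_comm] at h2
  constructor <;> linarith

lemma continuous_distWell (H : Mat) : Continuous (distWell H) := by
  rw [continuous_iff_continuousAt]
  intro A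
  rw [ContinuousAt, tendsto_iff_dist_tendsto_zero]
  have h1 : Tendsto (fun B : Mat => frobNorm (B - A)) (𝓝 A) (𝓝 0) := by
    have : Continuous fun B : Mat => frobNorm (B - A) :=
      continuous_frobNorm.comp (continuous_id.sub continuous_const)
    have := this.tendsto A
    simpa [frobNorm] using this
  exact squeeze_zero (fun _ => dist_nonneg) (fun B => abs_distWell_sub_le H B A) h1

lemma distWell_self (H : Mat) : distWell H H = 0 := by
  refine le_antisymm ((distWell_le H H 1).trans ?_) (distWell_nonneg _ _)
  simp [frobNorm]

section Diagonal

variable {ζ : Fin 3 → ℝ}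

lemma cof_transpose_eq_adjugate (A : Mat) : (cof A).transpose = A.adjugate := by
  rw [Matrix.adjugate_fin_three]
  have h1 : (1 : Fin 3) + 1 = 2 := rfl
  have h2 : (1 : Fin 3) + 2 = 0 := rfl
  have h3 : (2 : Fin 3) + 1 = 0 := rfl
  have h4 : (2 : Fin 3) + 2 = 1 := rfl
  ext i j
  fin_cases i <;> fin_cases j <;> simp [cof, h1, h2, h3, h4] <;> ring

lemma orthogonal_cols {R : Mat} (hR : R ∈ Matrix.specialOrthogonalGroup (Fin 3) ℝ) (k : Fin 3) :
    ∑ i, R i k ^ 2 = 1 := by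
  have h1 := (Matrix.mem_orthogonalGroup_iff' (Fin 3) ℝ).1
    (Matrix.mem_specialOrthogonalGroup_iff.1 hR).1
  have h2 := congrFun (congrFun h1 k) k
  simpa [Matrix.mul_apply, Matrix.star_apply, sq] using h2

lemma cof_eq_self {R : Mat} (hR : R ∈ Matrix.specialOrthogonalGroup (Fin 3) ℝ) : cof R = R := by
  obtain ⟨h1, h2⟩ := Matrix.mem_specialOrthogonalGroup_iff.1 hR
  have h3 : R.transpose * R = 1 := by
    simpa [Matrix.star_eq_conjTranspose] using (Matrix.mem_orthogonalGroup_iff' (Fin 3) ℝ).1 h1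
  have h4 : R * R.adjugate = 1 := by rw [Matrix.mul_adjugate, h2, one_smul]
  have h5 : R.adjugate = R.transpose := by
    calc R.adjugate = R.transpose * R * R.adjugate := by rw [h3, one_mul]
      _ = R.transpose := by rw [mul_assoc, h4, mul_one]
  rw [← cof_transpose_eq_adjugate] at h5
  exact Matrix.transpose_injective h5

lemma abs_apply_le_one {R : Mat} (hR : R ∈ Matrix.specialOrthogonalGroup (Fin 3) ℝ)
    (i k : Fin 3) : |R i k| ≤ 1 := by
  have h := Finset.single_le_sum (f := fun i => R i k ^ 2) (fun i _ => sq_nonneg _)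
    (Finset.mem_univ i)
  rw [orthogonal_cols hR k] at h
  exact (sq_le_one_iff_abs_le_one _).1 h

lemma abs_mul_diagonal_le (hζ : ∀ i, 0 < ζ i) {R : Mat}
    (hR : R ∈ Matrix.specialOrthogonalGroup (Fin 3) ℝ) (i k : Fin 3) :
    |(R * Matrix.diagonal ζ) i k| ≤ ζ k := by
  rw [Matrix.mul_diagonal, abs_mul, abs_of_pos (hζ k)]
  exact mul_le_of_le_one_left (hζ k).le (abs_apply_le_one hR i k)

lemma abs_apply_le_add_distWell (hζ : ∀ i, 0 < ζ i) (A : Mat) (i k : Fin 3) :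
    |A i k| ≤ ζ k + distWell (Matrix.diagonal ζ) A := by
  rw [← sub_le_iff_le_add']
  refine le_distWell fun R => ?_
  have h1 := abs_apply_le_frobNorm (A - (R : Mat) * Matrix.diagonal ζ) i k
  have h2 := abs_mul_diagonal_le hζ R.2 i k
  have h3 := abs_sub_abs_le_abs_sub (A i k) (((R : Mat) * Matrix.diagonal ζ) i k)
  rw [Matrix.sub_apply] at h1
  linarith

/-- The Euclidean norm of a vector of `ℝ³`; the norm of `Pt` itself is the maximum norm. -/
def euc (v : Pt) : ℝ := ‖WithLp.toLp 2 v‖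

lemma euc_eq (v : Pt) : euc v = √(∑ i, v i ^ 2) := by simp [euc, EuclideanSpace.norm_eq]

lemma euc_nonneg (v : Pt) : 0 ≤ euc v := norm_nonneg _

lemma euc_add_le (v w : Pt) : euc (v + w) ≤ euc v + euc w := by
  simpa [euc] using norm_add_le (WithLp.toLp 2 v) (WithLp.toLp 2 w)

lemma euc_smul (a : ℝ) (v : Pt) : euc (a • v) = |a| * euc v := by
  simp [euc, norm_smul]

lemma continuous_euc : Continuous euc := by
  simp only [funext euc_eq]; fun_prop

lemma euc_neg (v : Pt) : euc (-v) = euc v := by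
  simp [euc]

lemma euc_le_sum (v : Pt) : euc v ≤ ∑ i, |v i| := by
  rw [euc_eq]
  refine Real.sqrt_le_iff.2 ⟨by positivity, ?_⟩
  simpa using Finset.sum_sq_le_sq_sum_of_nonneg (s := Finset.univ) (f := fun i => |v i|)
    fun i _ => abs_nonneg _

/-- The Euclidean length of the `k`-th column is Lipschitz, so it is close to `ζ k` near the
well. -/
lemma abs_euc_col_sub_le (hζ : ∀ i, 0 < ζ i) (A : Mat) (k : Fin 3) :
    |euc (fun i => A i k) - ζ k| ≤ distWell (Matrix.diagonal ζ) A := by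
  refine le_distWell fun R => ?_
  set B : Mat := (R : Mat) * Matrix.diagonal ζ with hB
  have h1 : euc (fun i => B i k) = ζ k := by
    rw [euc_eq]
    have : ∑ i, B i k ^ 2 = ζ k ^ 2 := by
      simp only [hB, Matrix.mul_diagonal, mul_pow, ← Finset.sum_mul]
      rw [orthogonal_cols R.2, one_mul]
    rw [this, Real.sqrt_sq (hζ k).le]
  have h2 : euc (fun i => A i k - B i k) ≤ frobNorm (A - B) := by
    rw [euc_eq, frobNorm]
    refine Real.sqrt_le_sqrt (Finset.sum_le_sum fun i _ => ?_)
    exact Finset.single_le_sum (f := fun j => (A - B) i j ^ 2) (fun j _ => sq_nonneg _)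
      (Finset.mem_univ k)
  rw [← h1]
  refine le_trans ?_ h2
  exact abs_norm_sub_norm_le (WithLp.toLp 2 fun i => A i k) (WithLp.toLp 2 fun i => B i k)

lemma cofDefect_well (hζ : ∀ i, 0 < ζ i) {R : Mat}
    (hR : R ∈ Matrix.specialOrthogonalGroup (Fin 3) ℝ) (i j : Fin 3) :
    cofDefect (fun j => (ζ j ^ 2)⁻¹) (ζ 0 * ζ 1 * ζ 2)⁻¹ (R * Matrix.diagonal ζ) i j = 0 := by
  have h := congrFun (congrFun (cof_eq_self hR) i) j
  simp only [cof, Matrix.of_apply] at h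
  have h1 : (1 : Fin 3) + 1 = 2 := rfl
  have h2 : (1 : Fin 3) + 2 = 0 := rfl
  have h3 : (2 : Fin 3) + 1 = 0 := rfl
  have h4 : (2 : Fin 3) + 2 = 1 := rfl
  have z0 := (hζ 0).ne'
  have z1 := (hζ 1).ne'
  have z2 := (hζ 2).ne'
  simp only [cofDefect, cof, Matrix.of_apply, Matrix.mul_diagonal]
  rw [← h]
  fin_cases j <;>
    simp only [Fin.zero_eta, Fin.mk_one, Fin.reduceFinMk, h1, h2, h3, h4, zero_add] <;>
    field_simp <;> ring

lemma wnorm_well (hζ : ∀ i, 0 < ζ i) {R : Mat}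
    (hR : R ∈ Matrix.specialOrthogonalGroup (Fin 3) ℝ) :
    wnorm (fun j => (ζ j ^ 2)⁻¹) (R * Matrix.diagonal ζ) = 3 := by
  simp only [wnorm, Matrix.mul_diagonal]
  rw [Finset.sum_comm]
  have : ∀ j, ∑ i, (ζ j ^ 2)⁻¹ * (R i j * ζ j) ^ 2 = 1 := fun j => by
    rw [← orthogonal_cols hR j]
    refine Finset.sum_congr rfl fun i _ => ?_
    have := (hζ j).ne'
    field_simp
  simp [this]

lemma abs_mul_sub_mul_le {a b a' b' K δ : ℝ} (ha : |a| ≤ K) (hb' : |b'| ≤ K)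
    (h1 : |a - a'| ≤ δ) (h2 : |b - b'| ≤ δ) : |a * b - a' * b'| ≤ 2 * K * δ := by
  have hK : 0 ≤ K := (abs_nonneg _).trans ha
  have : a * b - a' * b' = a * (b - b') + (a - a') * b' := by ring
  rw [this]
  refine (abs_add_le _ _).trans ?_
  rw [abs_mul, abs_mul]
  have e1 := mul_le_mul ha h2 (abs_nonneg _) hK
  have e2 := mul_le_mul h1 hb' (abs_nonneg _) ((abs_nonneg _).trans h1)
  linarith

/-- On bounded sets of matrices the defects are controlled by the distance from the well. -/
lemma exists_defect_le (hζ : ∀ i, 0 < ζ i) {K : ℝ} (hK : ∀ i, ζ i ≤ K) :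
    ∃ C, 0 ≤ C ∧ ∀ A : Mat, (∀ i j, |A i j| ≤ K) →
      ∑ i, ∑ j, |cofDefect (fun j => (ζ j ^ 2)⁻¹) (ζ 0 * ζ 1 * ζ 2)⁻¹ A i j| ≤
        C * distWell (Matrix.diagonal ζ) A ∧
      |wnorm (fun j => (ζ j ^ 2)⁻¹) A - 3| ≤ C * distWell (Matrix.diagonal ζ) A := by
  set s : Fin 3 → ℝ := fun j => (ζ j ^ 2)⁻¹ with hs
  set c := (ζ 0 * ζ 1 * ζ 2)⁻¹ with hc
  have hs0 : ∀ j, 0 ≤ s j := fun j => by positivity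
  have hc0 : 0 ≤ c := by have := hζ 0; have := hζ 1; have := hζ 2; positivity
  have hK0 : 0 < K := (hζ 0).trans_le (hK 0)
  set C1 := ∑ _i : Fin 3, ∑ j, (s j + c * (4 * K)) with hC1
  set C2 := ∑ _i : Fin 3, ∑ j, s j * (2 * K) with hC2
  have hC1' : 0 ≤ C1 := Finset.sum_nonneg fun i _ => Finset.sum_nonneg fun j _ => by
    have := hs0 j; positivity
  have hC2' : 0 ≤ C2 := Finset.sum_nonneg fun i _ => Finset.sum_nonneg fun j _ => by
    have := hs0 j; positivity
  have key : ∀ A : Mat, (∀ i j, |A i j| ≤ K) →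
      ∀ R : Matrix.specialOrthogonalGroup (Fin 3) ℝ,
      ∑ i, ∑ j, |cofDefect s c A i j| ≤ C1 * frobNorm (A - (R : Mat) * Matrix.diagonal ζ) ∧
      |wnorm s A - 3| ≤ C2 * frobNorm (A - (R : Mat) * Matrix.diagonal ζ) := by
    intro A hA R
    set B : Mat := (R : Mat) * Matrix.diagonal ζ with hB
    set δ := frobNorm (A - B) with hδ
    have hd : ∀ i j, |A i j - B i j| ≤ δ := fun i j => abs_apply_le_frobNorm (A - B) i j
    have hBK : ∀ i j, |B i j| ≤ K := fun i j => (abs_mul_diagonal_le hζ R.2 i j).trans (hK j)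
    constructor
    · rw [hC1, Finset.sum_mul]
      refine Finset.sum_le_sum fun i _ => ?_
      rw [Finset.sum_mul]
      refine Finset.sum_le_sum fun j _ => ?_
      have e0 : cofDefect s c B i j = 0 := cofDefect_well hζ R.2 i j
      have e1 : cofDefect s c A i j = s j * (A i j - B i j) - c * (cof A i j - cof B i j) := by
        rw [← sub_zero (cofDefect s c A i j), ← e0]
        simp only [cofDefect, Matrix.of_apply]; ring
      have e2 : |cof A i j - cof B i j| ≤ 4 * K * δ := by
        simp only [cof, Matrix.of_apply]
        have f1 := abs_mul_sub_mul_le (hA (i + 1) (j + 1)) (hBK (i + 2) (j + 2))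
          (hd (i + 1) (j + 1)) (hd (i + 2) (j + 2))
        have f2 := abs_mul_sub_mul_le (hA (i + 1) (j + 2)) (hBK (i + 2) (j + 1))
          (hd (i + 1) (j + 2)) (hd (i + 2) (j + 1))
        rw [sub_sub_sub_comm]
        refine (abs_sub _ _).trans ?_
        linarith
      rw [e1]
      refine (abs_sub _ _).trans ?_
      rw [abs_mul, abs_mul, abs_of_nonneg (hs0 j), abs_of_nonneg hc0]
      have := mul_le_mul_of_nonneg_left (hd i j) (hs0 j)
      have := mul_le_mul_of_nonneg_left e2 hc0
      linarith
    · have e0 : wnorm s B = 3 := wnorm_well hζ R.2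
      rw [← e0, wnorm, wnorm, ← Finset.sum_sub_distrib, hC2, Finset.sum_mul]
      refine (Finset.abs_sum_le_sum_abs _ _).trans (Finset.sum_le_sum fun i _ => ?_)
      rw [← Finset.sum_sub_distrib, Finset.sum_mul]
      refine (Finset.abs_sum_le_sum_abs _ _).trans (Finset.sum_le_sum fun j _ => ?_)
      rw [← mul_sub, abs_mul, abs_of_nonneg (hs0 j), sq, sq, mul_assoc]
      exact mul_le_mul_of_nonneg_left (abs_mul_sub_mul_le (hA i j) (hBK i j) (hd i j) (hd i j))
        (hs0 j)
  -- pass to the infimum over the rotations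
  have inf : ∀ {A : Mat} {x C : ℝ}, 0 ≤ C → (∀ R : Matrix.specialOrthogonalGroup (Fin 3) ℝ,
      x ≤ C * frobNorm (A - (R : Mat) * Matrix.diagonal ζ)) →
      x ≤ C * distWell (Matrix.diagonal ζ) A := by
    intro A x C hC h
    rcases hC.eq_or_lt with rfl | hC
    · simpa using h 1
    · rw [← div_le_iff₀' hC]
      exact le_distWell fun R => (div_le_iff₀' hC).2 (h R)
  refine ⟨max C1 C2, hC1'.trans (le_max_left _ _), fun A hA => ⟨?_, ?_⟩⟩
  · exact (inf hC1' fun R => (key A hA R).1).trans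
      (mul_le_mul_of_nonneg_right (le_max_left _ _) (distWell_nonneg _ _))
  · exact (inf hC2' fun R => (key A hA R).2).trans
      (mul_le_mul_of_nonneg_right (le_max_right _ _) (distWell_nonneg _ _))

end Diagonal

/-! ### Mollification -/

/-- Mollification of a scalar function on `ℝ³` with the normalized bump `φ`. -/
def moll (φ : ContDiffBump (0 : Pt)) (f : Pt → ℝ) : Pt → ℝ :=
  convolution (φ.normed volume) f (ContinuousLinearMap.lsmul ℝ ℝ) volume

lemma moll_apply (φ : ContDiffBump (0 : Pt)) (f : Pt → ℝ) (x : Pt) :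
    moll φ f x = ∫ y, φ.normed volume y * f (x - y) := rfl

lemma contDiff_moll (φ : ContDiffBump (0 : Pt)) {f : Pt → ℝ} (hf : LocallyIntegrable f) :
    ContDiff ℝ ∞ (moll φ f) :=
  φ.hasCompactSupport_normed.contDiff_convolution_left _ φ.contDiff_normed hf

lemma integrable_normed (φ : ContDiffBump (0 : Pt)) :
    Integrable (φ.normed (volume : Measure Pt)) :=
  φ.continuous_normed.integrable_of_hasCompactSupport φ.hasCompactSupport_normed

lemma integrable_moll (φ : ContDiffBump (0 : Pt)) {f : Pt → ℝ} (hf : Integrable f) :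
    Integrable (moll φ f) := (integrable_normed φ).integrable_convolution _ hf

/-- Mollification is a contraction in `L¹`. -/
lemma integral_abs_moll_le (φ : ContDiffBump (0 : Pt)) {f : Pt → ℝ} (hf : Integrable f) :
    ∫ x, |moll φ f x| ≤ ∫ x, |f x| := by
  have h1 : ∀ x, |moll φ f x| ≤ moll φ (fun x => |f x|) x := fun x => by
    rw [moll_apply, moll_apply]
    refine (abs_integral_le_integral_abs).trans (le_of_eq ?_)
    congr 1; ext y
    rw [abs_mul, abs_of_nonneg (φ.nonneg_normed y)]
  calc ∫ x, |moll φ f x| ≤ ∫ x, moll φ (fun x => |f x|) x :=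
        integral_mono (integrable_moll φ hf).abs (integrable_moll φ hf.abs) h1
    _ = ∫ x, |f x| := by
        unfold moll
        rw [integral_convolution _ (integrable_normed φ) hf.abs, φ.integral_normed]
        simp

lemma moll_sub (φ : ContDiffBump (0 : Pt)) {f g : Pt → ℝ} (hf : LocallyIntegrable f)
    (hg : LocallyIntegrable g) (x : Pt) :
    moll φ (fun x => f x - g x) x = moll φ f x - moll φ g x := by
  have h : ∀ {f : Pt → ℝ}, LocallyIntegrable f →
      Integrable fun y => φ.normed volume y * f (x - y) := fun hf =>
    φ.hasCompactSupport_normed.convolutionExists_left (ContinuousLinearMap.lsmul ℝ ℝ)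
      φ.continuous_normed hf x
  rw [moll_apply, moll_apply, moll_apply, ← integral_sub (h hf) (h hg)]
  simp only [mul_sub]

/-- Mollifications converge in `L¹`. -/
lemma exists_setIntegral_moll_sub_le {f : Pt → ℝ} (hf : Integrable f) (R : ℝ) {ε : ℝ}
    (hε : 0 < ε) : ∃ θ, 0 < θ ∧ ∀ φ : ContDiffBump (0 : Pt), φ.rOut < θ →
      ∫ x in Metric.closedBall (0 : Pt) R, |moll φ f x - f x| ≤ ε := by
  obtain ⟨g, hgc, hfg, hgcont, hgi⟩ := hf.exists_hasCompactSupport_integral_sub_le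
    (show 0 < ε / 3 by positivity)
  set Q := Metric.closedBall (0 : Pt) R with hQd
  have hQ : IsCompact Q := isCompact_closedBall _ _
  set m := ε / (3 * (volume.real Q + 1)) with hm
  have hm0 : 0 < m := by have : 0 ≤ volume.real Q := measureReal_nonneg; positivity
  obtain ⟨θ, hθ, hθg⟩ := Metric.uniformContinuous_iff.1
    (hgc.uniformContinuous_of_continuous hgcont) m hm0
  refine ⟨θ, hθ, fun φ hφ => ?_⟩
  have e1 : ∀ x, |moll φ g x - g x| ≤ m := fun x => by
    refine φ.dist_normed_convolution_le (μ := (volume : Measure Pt)) (g := g) (x₀ := x)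
      hgcont.aestronglyMeasurable fun y hy => ?_
    exact (hθg (lt_trans (Metric.mem_ball.1 hy) hφ)).le
  have hfg' : Integrable fun x => f x - g x := hf.sub hgi
  have hI1 : Integrable fun x => |moll φ (fun x => f x - g x) x| := (integrable_moll φ hfg').abs
  have hI2 : Integrable fun x => |f x - g x| := hfg'.abs
  have hc : IntegrableOn (fun _ : Pt => m) Q := integrableOn_const hQ.measure_lt_top.ne
  calc ∫ x in Q, |moll φ f x - f x|
      ≤ ∫ x in Q, ((|moll φ (fun x => f x - g x) x| + |f x - g x|) + m) := by
        refine integral_mono ((integrable_moll φ hf).sub hf).abs.integrableOn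
          ((hI1.add hI2).integrableOn.add hc) fun x => ?_
        have : moll φ f x - f x = moll φ (fun x => f x - g x) x - (f x - g x) +
            (moll φ g x - g x) := by
          rw [moll_sub φ hf.locallyIntegrable hgi.locallyIntegrable]; ring
        simp only [this]
        exact (abs_add_le _ _).trans (add_le_add (abs_sub _ _) (e1 x))
    _ = (∫ x in Q, |moll φ (fun x => f x - g x) x|) + (∫ x in Q, |f x - g x|)
        + volume.real Q * m := by
        have h12 : IntegrableOn (fun x => |moll φ (fun x => f x - g x) x| + |f x - g x|) Q :=
          (hI1.add hI2).integrableOn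
        refine (integral_add h12 hc).trans ?_
        rw [integral_add hI1.integrableOn hI2.integrableOn, setIntegral_const, smul_eq_mul]
    _ ≤ ε / 3 + ε / 3 + ε / 3 := by
        have f1 : ∫ x in Q, |f x - g x| ≤ ε / 3 :=
          (setIntegral_le_integral hI2 (ae_of_all _ fun x => abs_nonneg _)).trans hfg
        have f2 : ∫ x in Q, |moll φ (fun x => f x - g x) x| ≤ ε / 3 :=
          (setIntegral_le_integral hI1 (ae_of_all _ fun x => abs_nonneg _)).trans
            ((integral_abs_moll_le φ hfg').trans hfg)
        have f3 : volume.real Q * m ≤ ε / 3 := by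
          have hv : 0 ≤ volume.real Q := measureReal_nonneg
          rw [hm, mul_div_assoc', div_le_div_iff₀ (by positivity) (by norm_num)]
          nlinarith
        linarith
    _ = ε := by ring

/-- The derivative of a mollified Lipschitz function is the mollified derivative. -/
lemma pd_moll_of_lipschitz (φ : ContDiffBump (0 : Pt)) {f : Pt → ℝ} {K : ℝ≥0}
    (hf : LipschitzWith K f) (j : Fin 3) (x : Pt) :
    pd j (moll φ f) x = moll φ (pd j f) x := by
  have hfc : Continuous f := hf.continuous
  have hsm := contDiff_moll φ hfc.locallyIntegrable
  have h1 := hasDerivAt_along_axis (hsm.differentiable (by simp)) x j 0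
  simp only [zero_smul, add_zero] at h1
  have haxis : ‖axis j‖ = 1 := by simpa using norm_smul_axis zero_le_one j
  have hφc : Continuous (φ.normed (volume : Measure Pt)) := φ.continuous_normed
  have h2 := (hasDerivAt_integral_of_dominated_loc_of_lip (𝕜 := ℝ) (μ := (volume : Measure Pt))
    (F := fun (t : ℝ) (y : Pt) => φ.normed volume y * f (x + t • axis j - y))
    (F' := fun y => φ.normed volume y * pd j f (x - y)) (x₀ := (0 : ℝ)) (s := univ)
    (bound := fun y => φ.normed volume y * K) univ_mem ?_ ?_ ?_ ?_ ?_ ?_).2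
  · exact h1.unique h2
  · refine Eventually.of_forall fun t => Continuous.aestronglyMeasurable ?_
    fun_prop
  · refine Continuous.integrable_of_hasCompactSupport (by fun_prop) ?_
    exact φ.hasCompactSupport_normed.mul_right
  · have hm : Measurable (pd j f) := measurable_fderiv_apply_const ℝ f (axis j)
    exact (hφc.measurable.mul (hm.comp (measurable_const.sub measurable_id))).aestronglyMeasurable
  · refine ae_of_all _ fun y => LipschitzOnWith.of_dist_le_mul fun a _ b _ => ?_
    rw [Real.dist_eq, ← mul_sub, abs_mul, abs_of_nonneg (φ.nonneg_normed y), Real.coe_nnabs,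
      abs_of_nonneg (by have := φ.nonneg_normed (μ := (volume : Measure Pt)) y; positivity :
        0 ≤ φ.normed volume y * (K : ℝ)), mul_assoc]
    refine mul_le_mul_of_nonneg_left ?_ (φ.nonneg_normed y)
    have := hf.dist_le_mul (x + a • axis j - y) (x + b • axis j - y)
    refine this.trans (le_of_eq ?_)
    rw [dist_sub_right, dist_add_left, dist_eq_norm, ← sub_smul, norm_smul, haxis, mul_one]
    rfl
  · exact (integrable_normed φ).mul_const _
  · have hae : ∀ᵐ y, DifferentiableAt ℝ f (x - y) :=
      (Measure.measurePreserving_sub_left (volume : Measure Pt) x).quasiMeasurePreserving.ae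
        hf.ae_differentiableAt
    filter_upwards [hae] with y hy
    have hl : HasDerivAt (fun t : ℝ => x + t • axis j - y) (axis j) 0 := by
      simpa using (((hasDerivAt_id (0 : ℝ)).smul_const (axis j)).const_add x).sub_const y
    have hy' : HasFDerivAt f (fderiv ℝ f (x - y)) (x + (0 : ℝ) • axis j - y) := by
      simpa using hy.hasFDerivAt
    exact (hy'.comp_hasDerivAt (0 : ℝ) hl).const_mul _

lemma abs_pd_le_of_lipschitz {f : Pt → ℝ} {K : ℝ≥0} (hf : LipschitzWith K f) (j : Fin 3) (x : Pt) :
    |pd j f x| ≤ K := by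
  have haxis : ‖axis j‖ = 1 := by simpa using norm_smul_axis zero_le_one j
  have h := (fderiv ℝ f x).le_opNorm (axis j)
  rw [haxis, mul_one] at h
  exact h.trans (norm_fderiv_le_of_lipschitz ℝ hf)

lemma abs_moll_le (φ : ContDiffBump (0 : Pt)) {f : Pt → ℝ} {K : ℝ} (hf : ∀ x, |f x| ≤ K) (x : Pt) :
    |moll φ f x| ≤ K := by
  rw [moll_apply]
  calc |∫ y, φ.normed volume y * f (x - y)| ≤ ∫ y, φ.normed volume y * K := by
        refine (Real.norm_eq_abs _).symm.trans_le (norm_integral_le_of_norm_le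
          ((integrable_normed φ).mul_const K) (ae_of_all _ fun y => ?_))
        rw [Real.norm_eq_abs, abs_mul, abs_of_nonneg (φ.nonneg_normed y)]
        exact mul_le_mul_of_nonneg_left (hf _) (φ.nonneg_normed y)
    _ = K := by rw [integral_mul_const, φ.integral_normed, one_mul]

lemma moll_congr (φ : ContDiffBump (0 : Pt)) {f g : Pt → ℝ} {R : ℝ} {x : Pt}
    (hx : x ∈ Metric.closedBall (0 : Pt) R)
    (hfg : ∀ y ∈ Metric.closedBall (0 : Pt) (R + φ.rOut), f y = g y) : moll φ f x = moll φ g x := by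
  rw [moll_apply, moll_apply]
  congr 1; ext y
  by_cases hy : y ∈ Metric.ball (0 : Pt) φ.rOut
  · rw [hfg]
    rw [mem_closedBall_zero_iff] at hx ⊢
    rw [mem_ball_zero_iff] at hy
    exact (norm_sub_le _ _).trans (add_le_add hx hy.le)
  · have : φ.normed volume y = 0 := by
      rw [← φ.support_normed_eq (μ := (volume : Measure Pt))] at hy
      simpa using hy
    simp [this]

/-- A Lipschitz map can be replaced by a smooth one with the same gradient bound and almost the
same gradient. -/
lemma exists_smooth_approx {v : Pt → Pt} {K : ℝ≥0} (hv : LipschitzWith K v) (r : ℝ) {ε : ℝ}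
    (hε : 0 < ε) : ∃ V : Fin 3 → Pt → ℝ, (∀ i, ContDiff ℝ ∞ (V i)) ∧
      (∀ i j x, |jac V x i j| ≤ K) ∧
      ∀ i j, ∫ x in Metric.closedBall (0 : Pt) r, |jac V x i j - pd j (fun y => v y i) x| ≤ ε := by
  have hvi : ∀ i, LipschitzWith K fun y => v y i := fun i =>
    LipschitzWith.of_dist_le_mul fun x y =>
      (dist_le_pi_dist (v x) (v y) i).trans (hv.dist_le_mul x y)
  set f : Fin 3 → Fin 3 → Pt → ℝ := fun i j =>
    (Metric.closedBall (0 : Pt) (r + 1)).indicator (pd j fun y => v y i) with hf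
  have hfi : ∀ i j, Integrable (f i j) := fun i j => by
    rw [hf, integrable_indicator_iff Metric.isClosed_closedBall.measurableSet]
    refine Measure.integrableOn_of_bounded (M := K) (isCompact_closedBall _ _).measure_lt_top.ne
      (measurable_fderiv_apply_const ℝ _ (axis j)).aestronglyMeasurable
      (ae_of_all _ fun x => abs_pd_le_of_lipschitz (hvi i) j x)
  choose θ hθ hθ' using fun i j => exists_setIntegral_moll_sub_le (hfi i j) r hε
  obtain ⟨t, ht0, ht1, ht⟩ : ∃ t, 0 < t ∧ t < 1 ∧ ∀ i j, t < θ i j := by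
    have h1 : ∀ᶠ t in 𝓝[>] (0 : ℝ), ∀ i j, t < θ i j := by
      simp only [eventually_all]
      exact fun i j => (eventually_lt_nhds (hθ i j)).filter_mono nhdsWithin_le_nhds
    have h2 : ∀ᶠ t in 𝓝[>] (0 : ℝ), t < 1 :=
      (eventually_lt_nhds one_pos).filter_mono nhdsWithin_le_nhds
    obtain ⟨t, h⟩ := (h1.and (h2.and self_mem_nhdsWithin)).exists
    exact ⟨t, h.2.2, h.2.1, h.1⟩
  let φ : ContDiffBump (0 : Pt) := ⟨t / 2, t, by linarith, by linarith⟩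
  have hjac : ∀ i j x, jac (fun i => moll φ fun y => v y i) x i j =
      moll φ (pd j fun y => v y i) x := fun i j x => pd_moll_of_lipschitz φ (hvi i) j x
  refine ⟨fun i => moll φ fun y => v y i, fun i =>
    contDiff_moll φ (hvi i).continuous.locallyIntegrable, fun i j x => ?_, fun i j => ?_⟩
  · rw [hjac]
    exact abs_moll_le φ (fun y => abs_pd_le_of_lipschitz (hvi i) j y) x
  · refine le_trans (le_of_eq ?_) (hθ' i j φ (ht i j))
    refine setIntegral_congr_fun Metric.isClosed_closedBall.measurableSet fun x hx => ?_
    have e1 : f i j x = pd j (fun y => v y i) x := by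
      rw [hf]
      exact indicator_of_mem (Metric.closedBall_subset_closedBall (by linarith) hx) _
    have e2 : moll φ (f i j) x = moll φ (pd j fun y => v y i) x := by
      refine moll_congr φ hx fun y hy => ?_
      rw [hf]
      refine indicator_of_mem (Metric.closedBall_subset_closedBall ?_ hy) _
      change r + t ≤ r + 1
      linarith
    simp only [hjac, e1, e2]

/-! ### Translation estimates for gradients -/

/-- A gradient field that is `L¹`-close to the well is approximated by gradients of smooth maps
with a universal Lipschitz bound. -/
lemma exists_smooth_nearWell {ζ : Fin 3 → ℝ} (hζ : ∀ i, 0 < ζ i) {r : ℝ} (hr : 0 < r) :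
    ∃ K C, 0 ≤ C ∧ ∀ (u : Pt → Pt) (F : Pt → Mat) (δ : ℝ), Continuous F →
      (∀ x ∈ Metric.closedBall (0 : Pt) (3 * r), HasFDerivAt u (lin (F x)) x) →
      ∫ x in Metric.closedBall (0 : Pt) (3 * r), distWell (Matrix.diagonal ζ) (F x) ≤ δ →
      ∀ τ, 0 < τ → ∃ V, NearWell (fun j => (ζ j ^ 2)⁻¹) (ζ 0 * ζ 1 * ζ 2)⁻¹ K (C * (δ + τ)) r V ∧
        ∀ i j, ∫ x in Metric.closedBall (0 : Pt) r, |F x i j - jac V x i j| ≤ C * (δ + τ) := by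
  set Λ := ∑ i, ζ i with hΛ
  have hζΛ : ∀ i, ζ i ≤ Λ := fun i =>
    Finset.single_le_sum (f := ζ) (fun i _ => (hζ i).le) (Finset.mem_univ i)
  have hΛ0 : 0 ≤ Λ := (hζ 0).le.trans (hζΛ 0)
  set K : ℝ := 48 * (Λ + 1) with hK
  have hK0 : 0 ≤ K := by positivity
  have hζK : ∀ i, ζ i ≤ K := fun i => by have := hζΛ i; linarith
  obtain ⟨C1, hC1, H1⟩ := exists_defect_le hζ hζK
  set M := 18 * K with hM
  have hMd : ∀ A : Mat, (∀ i j, |A i j| ≤ K) → distWell (Matrix.diagonal ζ) A ≤ M := by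
    intro A hA
    have h1 := distWell_le (Matrix.diagonal ζ) A 1
    refine h1.trans ((frobNorm_le_sum _).trans ?_)
    have : ∀ i j, |(A - ((1 : Matrix.specialOrthogonalGroup (Fin 3) ℝ) : Mat)
        * Matrix.diagonal ζ) i j| ≤ 2 * K := fun i j => by
      rw [Matrix.sub_apply]
      have e1 := abs_mul_diagonal_le hζ
        (1 : Matrix.specialOrthogonalGroup (Fin 3) ℝ).2 i j
      refine (abs_sub _ _).trans ?_
      linarith [hA i j, hζK j]
    refine (Finset.sum_le_sum fun i _ => Finset.sum_le_sum fun j _ => this i j).trans ?_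
    simp [hM]; linarith
  set C := max (C1 * (1 + 9 + 125 * M)) (2 + (Λ + K) * 125) with hC
  have hC0 : 0 ≤ C := le_trans (by positivity) (le_max_right _ _)
  refine ⟨K, C, hC0, fun u F δ hF hu hδ τ hτ => ?_⟩
  set d : Pt → ℝ := fun x => distWell (Matrix.diagonal ζ) (F x) with hd
  have hdc : Continuous d := (continuous_distWell _).comp hF
  have hd0 : ∀ x, 0 ≤ d x := fun x => distWell_nonneg _ _
  have hFd : ∀ x i j, |F x i j| ≤ Λ + d x := fun x i j =>
    (abs_apply_le_add_distWell hζ (F x) i j).trans (by linarith [hζΛ j])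
  obtain ⟨v, hv, G, hGm, hGr, hGv, hvF⟩ := exists_lipschitz_truncation hF hdc hd0 hFd hΛ0 hr hu
  obtain ⟨V, hV1, hV2, hV3⟩ := exists_smooth_approx hv r hτ
  have hKK : ((Real.toNNReal (48 * (Λ + 1)) : ℝ≥0) : ℝ) = K := Real.coe_toNNReal _ hK0
  simp only [hKK] at hV2
  set Q := Metric.closedBall (0 : Pt) r with hQdef
  have hQ : IsCompact Q := isCompact_closedBall _ _
  have hQm := hQ.measurableSet
  have hδ' : ∫ x in Q, d x ≤ δ := by
    refine le_trans (setIntegral_mono_set (integrableOn_compact hdc (isCompact_closedBall _ _))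
      (ae_of_all _ hd0) ?_) hδ
    exact (Metric.closedBall_subset_closedBall (by linarith)).eventuallyLE
  have hδ0 : 0 ≤ δ := (integral_nonneg hd0).trans hδ'
  have hGδ : volume.real (Q \ G) ≤ 125 * δ := hGv.trans (by linarith)
  -- the gradient of the truncation agrees with `F` on the good set
  have hpd : ∀ᵐ x, x ∈ G → ∀ i j, pd j (fun y => v y i) x = F x i j := by
    have h1 := (ae_restrict_iff' hGm).1 hvF
    filter_upwards [h1, hv.ae_differentiableAt] with x hx hdiff hxG i j
    have h2 : HasFDerivAt (fun y => v y i) ((ContinuousLinearMap.proj i).comp (fderiv ℝ v x)) x :=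
      (hasFDerivAt_pi'.1 hdiff.hasFDerivAt) i
    rw [pd, h2.fderiv, hx hxG]
    simp
  set a : Fin 3 → Fin 3 → Pt → ℝ := fun i j x => |jac V x i j - pd j (fun y => v y i) x| with ha
  have hpdm : ∀ i j, Measurable (pd j fun y => v y i) := fun i j =>
    measurable_fderiv_apply_const ℝ _ (axis j)
  have hcj : ∀ i j, Continuous fun x => jac V x i j := fun i j => (contDiff_jac hV1 i j).continuous
  have hvi : ∀ i, LipschitzWith (Real.toNNReal (48 * (Λ + 1))) fun y => v y i := fun i =>
    LipschitzWith.of_dist_le_mul fun x y =>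
      (dist_le_pi_dist (v x) (v y) i).trans (hv.dist_le_mul x y)
  have haI : ∀ i j, IntegrableOn (a i j) Q := fun i j => by
    refine Measure.integrableOn_of_bounded (M := K + K) hQ.measure_lt_top.ne
      ((hcj i j).measurable.sub (hpdm i j)).norm.aestronglyMeasurable (ae_of_all _ fun x => ?_)
    have e2 := abs_pd_le_of_lipschitz (hvi i) j x
    rw [hKK] at e2
    rw [ha, Real.norm_eq_abs, abs_abs]
    exact (abs_sub _ _).trans (add_le_add (hV2 i j x) e2)
  have hind : ∀ c : ℝ, IntegrableOn ((Q \ G).indicator fun _ => c) Q := fun c =>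
    (integrableOn_const hQ.measure_lt_top.ne).indicator (hQm.diff hGm)
  have hindv : ∀ c : ℝ, 0 ≤ c → ∫ x in Q, (Q \ G).indicator (fun _ => c) x ≤ c * (125 * δ) := by
    intro c hc
    rw [setIntegral_indicator (hQm.diff hGm), inter_eq_self_of_subset_right sdiff_subset,
      setIntegral_const, smul_eq_mul, mul_comm]
    exact mul_le_mul_of_nonneg_left hGδ hc
  have hdI : IntegrableOn d Q := integrableOn_compact hdc hQ
  have hsumI : IntegrableOn (fun x => ∑ i, ∑ j, a i j x) Q :=
    integrable_finsetSum _ fun i _ => integrable_finsetSum _ fun j _ => haI i j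
  have hsum : ∫ x in Q, ∑ i, ∑ j, a i j x ≤ 9 * τ := by
    rw [integral_finsetSum _ fun i _ => integrable_finsetSum _ fun j _ => haI i j]
    refine (Finset.sum_le_sum (g := fun _ => 3 * τ) fun i _ => ?_).trans (by simp; linarith)
    rw [integral_finsetSum _ fun j _ => haI i j]
    exact (Finset.sum_le_sum (g := fun _ => τ) fun j _ => hV3 i j).trans (by simp)
  have hdV : Continuous fun x => distWell (Matrix.diagonal ζ) (jac V x) :=
    (continuous_distWell _).comp (continuous_matrix hcj)
  have hdist : ∫ x in Q, distWell (Matrix.diagonal ζ) (jac V x) ≤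
      (1 + 9 + 125 * M) * (δ + τ) := by
    calc _ ≤ ∫ x in Q, ((d x + ∑ i, ∑ j, a i j x) + (Q \ G).indicator (fun _ => M) x) := by
          refine setIntegral_mono_on_ae (integrableOn_compact hdV hQ)
            ((hdI.add hsumI).add (hind M)) hQm ?_
          filter_upwards [hpd] with x hx hxQ
          have hs0 : 0 ≤ ∑ i, ∑ j, a i j x := by simp only [ha]; positivity
          by_cases hxG : x ∈ G
          · rw [indicator_of_notMem (fun h => h.2 hxG), add_zero]
            refine (distWell_le_add _ _ (F x)).trans (add_le_add le_rfl ?_)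
            refine (frobNorm_le_sum _).trans (le_of_eq ?_)
            simp only [ha, hx hxG, Matrix.sub_apply]
          · rw [indicator_of_mem (show x ∈ Q \ G from ⟨hxQ, hxG⟩)]
            have := hMd (jac V x) fun i j => hV2 i j x
            linarith [hd0 x]
      _ = (∫ x in Q, d x) + (∫ x in Q, ∑ i, ∑ j, a i j x)
          + ∫ x in Q, (Q \ G).indicator (fun _ => M) x := by
          have h12 : IntegrableOn (fun x => d x + ∑ i, ∑ j, a i j x) Q := hdI.add hsumI
          refine (integral_add h12 (hind M)).trans ?_
          rw [integral_add hdI hsumI]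
      _ ≤ δ + 9 * τ + M * (125 * δ) := by
          have := hindv M (by positivity)
          linarith
      _ ≤ _ := by
          have : 0 ≤ M := by positivity
          nlinarith [mul_nonneg this hτ.le]
  have hδτ : 0 ≤ δ + τ := by linarith
  refine ⟨V, ⟨hV1, hV2, ?_, ?_⟩, fun i j => ?_⟩
  · refine le_trans (setIntegral_mono_on ?_ ((integrableOn_compact hdV hQ).const_mul C1) hQm
      fun x _ => (H1 (jac V x) fun i j => hV2 i j x).1) ?_
    · have hcc := fun i j => (contDiff_cof hV1 i j).continuous
      refine integrableOn_compact ?_ hQ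
      simp only [cofDefect, Matrix.of_apply]
      fun_prop
    · rw [integral_const_mul]
      refine (mul_le_mul_of_nonneg_left hdist hC1).trans ?_
      rw [← mul_assoc]
      exact mul_le_mul_of_nonneg_right (le_max_left _ _) hδτ
  · refine le_trans (setIntegral_mono_on ?_ ((integrableOn_compact hdV hQ).const_mul C1) hQm
      fun x _ => (H1 (jac V x) fun i j => hV2 i j x).2) ?_
    · refine integrableOn_compact ?_ hQ
      simp only [wnorm]
      fun_prop
    · rw [integral_const_mul]
      refine (mul_le_mul_of_nonneg_left hdist hC1).trans ?_
      rw [← mul_assoc]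
      exact mul_le_mul_of_nonneg_right (le_max_left _ _) hδτ
  · have hFc : Continuous fun x => F x i j := hF.matrix_elem i j
    have hcij := hcj i j
    calc _ ≤ ∫ x in Q, ((d x + a i j x) + (Q \ G).indicator (fun _ => Λ + K) x) := by
          refine setIntegral_mono_on_ae (integrableOn_compact (by fun_prop) hQ)
            ((hdI.add (haI i j)).add (hind _)) hQm ?_
          filter_upwards [hpd] with x hx hxQ
          have hs0 : 0 ≤ a i j x := abs_nonneg _
          by_cases hxG : x ∈ G
          · rw [indicator_of_notMem (fun h => h.2 hxG), add_zero, abs_sub_comm]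
            simp only [ha, hx hxG]
            linarith [hd0 x]
          · rw [indicator_of_mem (show x ∈ Q \ G from ⟨hxQ, hxG⟩)]
            have e1 := abs_sub (F x i j) (jac V x i j)
            linarith [hFd x i j, hV2 i j x]
      _ = (∫ x in Q, d x) + (∫ x in Q, a i j x)
          + ∫ x in Q, (Q \ G).indicator (fun _ => Λ + K) x := by
          have h12 : IntegrableOn (fun x => d x + a i j x) Q := hdI.add (haI i j)
          refine (integral_add h12 (hind _)).trans ?_
          rw [integral_add hdI (haI i j)]
      _ ≤ δ + τ + (Λ + K) * (125 * δ) := by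
          have := hindv (Λ + K) (by positivity)
          linarith [hV3 i j]
      _ ≤ (2 + (Λ + K) * 125) * (δ + τ) := by
          have : 0 ≤ Λ + K := by positivity
          nlinarith [mul_nonneg this hτ.le]
      _ ≤ _ := mul_le_mul_of_nonneg_right (le_max_right _ _) hδτ

/-- Interior rigidity for small translations: if the gradient field `F` is `L¹`-close to the well,
then `F` changes little under a translation by `h` along an axis. -/
theorem exists_gradient_translation_estimate {ζ : Fin 3 → ℝ} (hζ : ∀ i, 0 < ζ i) {r : ℝ}
    (hr : 0 < r) : ∃ C, 0 ≤ C ∧ ∃ t₀, 0 < t₀ ∧ ∀ (u : Pt → Pt) (F : Pt → Mat) (δ : ℝ),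
      Continuous F →
      (∀ x ∈ Metric.closedBall (0 : Pt) (3 * r), HasFDerivAt u (lin (F x)) x) →
      ∫ x in Metric.closedBall (0 : Pt) (3 * r), distWell (Matrix.diagonal ζ) (F x) ≤ δ →
      ∀ (k : Fin 3) (h μ : ℝ), 0 < h → h ≤ t₀ → 0 < μ → ∀ i j,
      ∫ x in Metric.closedBall (0 : Pt) (r / 4), |F (x + h • axis k) i j - F x i j| ≤
        C * (μ + (h ^ 3 + δ) / μ + (h ^ 3 + δ)) := by
  obtain ⟨K, C1, hC1, H1⟩ := exists_smooth_nearWell hζ hr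
  obtain ⟨C2, hC2, t₀, ht₀, H2⟩ := exists_translation_estimate
    (s := fun j => (ζ j ^ 2)⁻¹) (fun j => by have := hζ j; positivity) (ζ 0 * ζ 1 * ζ 2)⁻¹ K hr
  set Q := Metric.closedBall (0 : Pt) (r / 4) with hQdef
  have hQ : IsCompact Q := isCompact_closedBall _ _
  set C := volume.real Q + C2 * (1 + C1) + 2 * C1 with hC
  refine ⟨C, by positivity, min t₀ (3 * r / 4), by positivity, ?_⟩
  intro u F δ hF hu hδ k h μ hh hht hμ i j
  have hδ0 : 0 ≤ δ := le_trans (integral_nonneg fun x => distWell_nonneg _ _) hδ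
  obtain ⟨V, hV, hFV⟩ := H1 u F δ hF hu hδ (h ^ 3) (by positivity)
  have e1 := H2 V _ hV k h hh (hht.trans (min_le_left _ _))
  have hd := hV.continuous_diff (h • axis k)
  have e2 : ∫ x in Q, (jac V (x + h • axis k) i j - jac V x i j) ^ 2 ≤
      C2 * (h ^ 3 + C1 * (δ + h ^ 3)) := by
    refine le_trans (setIntegral_mono_on (integrableOn_compact (by fun_prop) hQ)
      (integrableOn_compact (by fun_prop) hQ) hQ.measurableSet fun x _ => ?_) e1
    have f1 := Finset.single_le_sum (f := fun j => (jac V (x + h • axis k) i j - jac V x i j) ^ 2)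
      (fun j _ => sq_nonneg _) (Finset.mem_univ j)
    have f2 := Finset.single_le_sum
      (f := fun i => ∑ j, (jac V (x + h • axis k) i j - jac V x i j) ^ 2)
      (fun j _ => by positivity) (Finset.mem_univ i)
    exact f1.trans f2
  have e3 := setIntegral_abs_le_of_sq hQ (hd i j) hμ e2
  have hFc : Continuous fun x => F x i j := hF.matrix_elem i j
  have hjc := hV.continuous_jac i j
  set b : Pt → ℝ := fun x => |F x i j - jac V x i j| with hb
  have hbc : Continuous b := by fun_prop
  have hr' : h ≤ 3 * r / 4 := hht.trans (min_le_right _ _)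
  have e4 : ∫ x in Q, b (x + h • axis k) ≤ C1 * (δ + h ^ 3) :=
    (setIntegral_shift_le hbc (fun x => abs_nonneg _) (isCompact_closedBall 0 r) fun x hx =>
      add_smul_axis_mem hh.le (by linarith) k hx).trans (hFV i j)
  have e5 : ∫ x in Q, b x ≤ C1 * (δ + h ^ 3) := by
    refine le_trans (setIntegral_mono_set (integrableOn_compact hbc (isCompact_closedBall _ _))
      (ae_of_all _ fun x => abs_nonneg _) ?_) (hFV i j)
    exact (Metric.closedBall_subset_closedBall (by linarith)).eventuallyLE
  have hdij := hd i j
  have hbc' : Continuous fun x => b (x + h • axis k) := hbc.comp (by fun_prop)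
  have hFc' : Continuous fun x => F (x + h • axis k) i j := hFc.comp (by fun_prop)
  calc _ ≤ ∫ x in Q, ((|jac V (x + h • axis k) i j - jac V x i j| + b (x + h • axis k)) + b x) := by
        refine setIntegral_mono_on (integrableOn_compact (by fun_prop) hQ)
          (integrableOn_compact (by fun_prop) hQ) hQ.measurableSet fun x _ => ?_
        have : F (x + h • axis k) i j - F x i j = (jac V (x + h • axis k) i j - jac V x i j) +
          (F (x + h • axis k) i j - jac V (x + h • axis k) i j) - (F x i j - jac V x i j) := by ring
        rw [this]
        exact (abs_sub _ _).trans (add_le_add (abs_add_le _ _) le_rfl)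
    _ = (∫ x in Q, |jac V (x + h • axis k) i j - jac V x i j|) + (∫ x in Q, b (x + h • axis k))
        + ∫ x in Q, b x := by
        rw [integral_add (integrableOn_compact (by fun_prop) hQ) (integrableOn_compact hbc hQ),
          integral_add (integrableOn_compact (by fun_prop) hQ) (integrableOn_compact hbc' hQ)]
    _ ≤ (μ * volume.real Q + C2 * (h ^ 3 + C1 * (δ + h ^ 3)) / μ) + C1 * (δ + h ^ 3)
        + C1 * (δ + h ^ 3) := by gcongr
    _ ≤ _ := by
        have hv : 0 ≤ volume.real Q := measureReal_nonneg
        have g0 : 0 ≤ h ^ 3 + δ := by positivity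
        have g1 : C2 * (h ^ 3 + C1 * (δ + h ^ 3)) / μ ≤ C2 * (1 + C1) * ((h ^ 3 + δ) / μ) := by
          rw [mul_div_assoc', mul_assoc]
          gcongr
          linarith
        have g2 : 0 ≤ (h ^ 3 + δ) / μ := by positivity
        have g3 : 0 ≤ C2 * (1 + C1) := by positivity
        rw [hC]
        nlinarith [mul_nonneg hv g2, mul_nonneg hv g0, mul_nonneg g3 hμ.le, mul_nonneg g3 g0,
          mul_nonneg hC1 g2, mul_nonneg hC1 hμ.le]

lemma setIntegral_closedBall_shift (f : Pt → ℝ) (c z : Pt) (ρ : ℝ) :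
    ∫ x in Metric.closedBall c ρ, f (x + z) = ∫ x in Metric.closedBall (c + z) ρ, f x := by
  have h1 := (measurePreserving_add_right (volume : Measure Pt) z).setIntegral_preimage_emb
    (measurableEmbedding_addRight z) f (Metric.closedBall (c + z) ρ)
  rw [← h1]
  congr 2
  ext x
  simp

/-- Interior rigidity along a segment: if `F` is `L¹`-close to the well around a segment in the
direction of an axis, then `F` is almost invariant under translations along this segment. -/
theorem exists_gradient_translation_le {ζ : Fin 3 → ℝ} (hζ : ∀ i, 0 < ζ i) {r ℓ κ : ℝ}
    (hr : 0 < r) (hℓ : 0 < ℓ) (hκ : 0 < κ) : ∃ δ, 0 < δ ∧ ∀ (u : Pt → Pt) (F : Pt → Mat) (c : Pt)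
      (k : Fin 3), Continuous F →
      (∀ s ∈ Icc 0 ℓ, ∀ x ∈ Metric.closedBall (c + s • axis k) (3 * r),
        HasFDerivAt u (lin (F x)) x) →
      (∀ s ∈ Icc 0 ℓ, ∫ x in Metric.closedBall (c + s • axis k) (3 * r),
        distWell (Matrix.diagonal ζ) (F x) ≤ δ) →
      ∀ s ∈ Ioc 0 ℓ, ∀ i j,
        ∫ x in Metric.closedBall c (r / 4), |F (x + s • axis k) i j - F x i j| ≤ κ := by
  obtain ⟨C, hC, t₀, ht₀, H⟩ := exists_gradient_translation_estimate hζ hr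
  set κ' := κ / (4 * (C + 1)) with hκ'
  have hκ0 : 0 < κ' := by positivity
  -- `n` translations by `s / n`, each of which costs `o(1 / n)`
  obtain ⟨n, hn⟩ := exists_nat_ge (max 1 (max (ℓ / t₀) (max (4 * C * ℓ ^ 3 / (κ' * κ))
    (4 * C * ℓ ^ 3 / κ))))
  simp only [max_le_iff] at hn
  obtain ⟨hn1, hn2, hn3, hn4⟩ := hn
  have hn0 : (0 : ℝ) < n := by linarith
  set δ := κ / (4 * (C + 1) * (n ^ 2 / κ' + n)) with hδ
  have hδ0 : 0 < δ := by positivity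
  refine ⟨δ, hδ0, fun u F c k hF hu hd s hs i j => ?_⟩
  set h := s / n with hh
  have hh0 : 0 < h := div_pos hs.1 hn0
  have hhℓ : h ≤ ℓ / n := by rw [hh]; gcongr; exact hs.2
  have hht : h ≤ t₀ := hhℓ.trans (by rw [div_le_iff₀ ht₀] at hn2; rw [div_le_iff₀ hn0]; linarith)
  have hFij : Continuous fun x => F x i j := hF.matrix_elem i j
  have hstep : ∀ m < n, ∫ x in Metric.closedBall c (r / 4),
      |F (x + ((m + 1 : ℕ) * h) • axis k) i j - F (x + (m * h) • axis k) i j| ≤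
      C * (κ' / n + (h ^ 3 + δ) / (κ' / n) + (h ^ 3 + δ)) := by
    intro m hm
    have hmem : (m : ℝ) * h ∈ Icc 0 ℓ := by
      refine ⟨by positivity, ?_⟩
      have h1 : (m : ℝ) * h ≤ n * h := by gcongr
      have h2 : n * h = s := by rw [hh]; field_simp
      linarith [hs.2]
    set c' := c + (m * h) • axis k with hc'
    have e := H (fun x => u (x + c')) (fun x => F (x + c')) δ (hF.comp (continuous_add_const c'))
      (fun x hx => by
        have h1 := hu _ hmem (x + c') (by
          rw [mem_closedBall_iff_norm]
          simpa [hc'] using hx)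
        exact (hasFDerivAt_comp_add_right c').2 h1)
      (by
        rw [setIntegral_closedBall_shift (fun x => distWell (Matrix.diagonal ζ) (F x)), zero_add]
        exact hd _ hmem) k h (κ' / n) hh0 hht (by positivity) i j
    have e2 := setIntegral_closedBall_shift
      (fun x => |F (x + h • axis k) i j - F x i j|) 0 c' (r / 4)
    have e3 := setIntegral_closedBall_shift
      (fun x => |F (x + h • axis k) i j - F x i j|) c ((m * h) • axis k) (r / 4)
    rw [zero_add] at e2
    rw [← hc', ← e2] at e3
    refine le_trans (le_of_eq ?_) (e3.trans_le (le_trans (le_of_eq ?_) e))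
    · congr 1; ext x
      have : x + ((m + 1 : ℕ) * h) • axis k = x + (m * h) • axis k + h • axis k := by
        rw [add_assoc, ← add_smul]; push_cast; ring_nf
      rw [this]
    · congr 1; ext x
      rw [add_right_comm]
  have hint : ∀ m : ℕ, IntegrableOn (fun x => |F (x + ((m + 1 : ℕ) * h) • axis k) i j
      - F (x + (m * h) • axis k) i j|) (Metric.closedBall c (r / 4)) := fun m => by
    have h1 : ∀ z : Pt, Continuous fun x => F (x + z) i j := fun z => hFij.comp (by fun_prop)
    exact integrableOn_compact ((h1 _).sub (h1 _)).abs (isCompact_closedBall _ _)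
  have hfin : (n : ℝ) * (C * (κ' / n + (h ^ 3 + δ) / (κ' / n) + (h ^ 3 + δ))) ≤ κ := by
    have g1 : C * κ' ≤ κ / 4 := by
      rw [hκ', mul_div_assoc', div_le_div_iff₀ (by positivity) (by norm_num)]
      nlinarith
    have hh3 : h ^ 3 ≤ ℓ ^ 3 / n ^ 3 := by
      rw [← div_pow]; exact pow_le_pow_left₀ hh0.le hhℓ 3
    have g2 : C * (n ^ 2 * h ^ 3 / κ') ≤ κ / 4 := by
      have : C * (n ^ 2 * h ^ 3 / κ') ≤ C * (n ^ 2 * (ℓ ^ 3 / n ^ 3) / κ') := by gcongr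
      refine this.trans ?_
      have e : C * (n ^ 2 * (ℓ ^ 3 / n ^ 3) / κ') = C * ℓ ^ 3 / (n * κ') := by field_simp
      rw [e, div_le_div_iff₀ (by positivity) (by norm_num)]
      rw [div_le_iff₀ (by positivity)] at hn3
      nlinarith
    have g3 : C * (n * h ^ 3) ≤ κ / 4 := by
      have : C * (n * h ^ 3) ≤ C * (n * (ℓ ^ 3 / n ^ 3)) := by gcongr
      refine this.trans ?_
      have e : C * (n * (ℓ ^ 3 / n ^ 3)) = C * ℓ ^ 3 / (n * n) := by field_simp
      rw [e, div_le_div_iff₀ (by positivity) (by norm_num)]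
      rw [div_le_iff₀ hκ] at hn4
      nlinarith [mul_nonneg hn0.le hκ.le]
    have g4 : C * (n ^ 2 * δ / κ' + n * δ) ≤ κ / 4 := by
      have e : C * (n ^ 2 * δ / κ' + n * δ) = C * (δ * (n ^ 2 / κ' + n)) := by ring
      have e2 : δ * (n ^ 2 / κ' + n) = κ / (4 * (C + 1)) := by
        rw [hδ]; field_simp
      rw [e, e2, mul_div_assoc', div_le_div_iff₀ (by positivity) (by norm_num)]
      nlinarith
    have e : (n : ℝ) * (C * (κ' / n + (h ^ 3 + δ) / (κ' / n) + (h ^ 3 + δ))) =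
        C * κ' + C * (n ^ 2 * h ^ 3 / κ') + C * (n * h ^ 3) + C * (n ^ 2 * δ / κ' + n * δ) := by
      field_simp
      ring
    rw [e]; linarith
  calc _ ≤ ∫ x in Metric.closedBall c (r / 4), ∑ m ∈ Finset.range n,
        |F (x + ((m + 1 : ℕ) * h) • axis k) i j - F (x + (m * h) • axis k) i j| := by
        refine setIntegral_mono_on ?_ (integrable_finsetSum _ fun m _ => hint m)
          Metric.isClosed_closedBall.measurableSet fun x _ => ?_
        · have h1 : Continuous fun x => F (x + s • axis k) i j := hFij.comp (by fun_prop)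
          exact integrableOn_compact (h1.sub hFij).abs (isCompact_closedBall _ _)
        · have e := Finset.sum_range_sub (fun m : ℕ => F (x + (m * h) • axis k) i j) n
          have e2 : (n : ℝ) * h = s := by rw [hh]; field_simp
          simp only [e2, Nat.cast_zero, zero_mul, zero_smul, add_zero] at e
          rw [← e]
          exact Finset.abs_sum_le_sum_abs _ _
    _ = ∑ m ∈ Finset.range n, ∫ x in Metric.closedBall c (r / 4),
        |F (x + ((m + 1 : ℕ) * h) • axis k) i j - F (x + (m * h) • axis k) i j| :=
        integral_finsetSum _ fun m _ => hint m
    _ ≤ ∑ _m ∈ Finset.range n, C * (κ' / n + (h ^ 3 + δ) / (κ' / n) + (h ^ 3 + δ)) :=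
        Finset.sum_le_sum fun m hm => hstep m (Finset.mem_range.1 hm)
    _ ≤ κ := by rw [Finset.sum_const, Finset.card_range, nsmul_eq_mul]; exact hfin

section Increments

variable {u : Pt → Pt} {F : Pt → Mat}

lemma hasDerivAt_axis_of_lin {x : Pt} {j : Fin 3} {s : ℝ}
    (hu : HasFDerivAt u (lin (F (x + s • axis j))) (x + s • axis j)) :
    HasDerivAt (fun s : ℝ => u (x + s • axis j)) (fun i => F (x + s • axis j) i j) s := by
  have h1 : HasDerivAt (fun s : ℝ => x + s • axis j) (axis j) s := by
    simpa using ((hasDerivAt_id s).smul_const (axis j)).const_add x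
  have h2 := hu.comp_hasDerivAt s h1
  have h3 : lin (F (x + s • axis j)) (axis j) = fun i => F (x + s • axis j) i j := by
    ext i; simp
  rwa [h3] at h2

lemma continuous_col (hF : Continuous F) (j : Fin 3) : Continuous fun x => fun i => F x i j :=
  continuous_pi fun i => hF.matrix_elem i j

lemma euc_increment_le (hF : Continuous F) {x : Pt} {j : Fin 3} {h : ℝ} (hh : 0 ≤ h)
    (hu : ∀ s ∈ Icc 0 h, HasFDerivAt u (lin (F (x + s • axis j))) (x + s • axis j)) :
    euc (u (x + h • axis j) - u x) ≤
      ∫ s in (0:ℝ)..h, euc (fun i => F (x + s • axis j) i j) := by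
  let e : Pt →L[ℝ] EuclideanSpace ℝ (Fin 3) :=
    (PiLp.continuousLinearEquiv 2 ℝ (fun _ : Fin 3 => ℝ)).symm.toContinuousLinearMap
  have he : ∀ v, ‖e v‖ = euc v := fun v => rfl
  have hder : ∀ s ∈ uIcc 0 h, HasDerivAt (fun s : ℝ => e (u (x + s • axis j)))
      (e fun i => F (x + s • axis j) i j) s := fun s hs => by
    rw [uIcc_of_le hh] at hs
    exact e.hasFDerivAt.comp_hasDerivAt s (hasDerivAt_axis_of_lin (hu s hs))
  have hc : Continuous fun s : ℝ => e fun i => F (x + s • axis j) i j :=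
    e.continuous.comp ((continuous_col hF j).comp
      (f := fun s : ℝ => x + s • axis j) (by fun_prop))
  have hft := intervalIntegral.integral_eq_sub_of_hasDerivAt hder (hc.intervalIntegrable _ _)
  simp only [zero_smul, add_zero, ← map_sub] at hft
  rw [← he, ← hft]
  exact intervalIntegral.norm_integral_le_integral_norm hh

lemma setIntegral_euc_increment_le (hF : Continuous F) {Q : Set Pt} (hQ : IsCompact Q) {j : Fin 3}
    {h M : ℝ} (hh : 0 ≤ h)
    (hu : ∀ x ∈ Q, ∀ s ∈ Icc 0 h, HasFDerivAt u (lin (F (x + s • axis j))) (x + s • axis j))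
    (hM : ∀ s ∈ Ioc 0 h, ∫ x in Q, euc (fun i => F (x + s • axis j) i j) ≤ M) :
    ∫ x in Q, euc (u (x + h • axis j) - u x) ≤ h * M := by
  rcases hh.eq_or_lt with rfl | hh'
  · simp [euc]
  have hcol : Continuous fun q : ℝ × Pt => euc (fun i => F (q.2 + q.1 • axis j) i j) :=
    continuous_euc.comp ((continuous_col hF j).comp
      (f := fun q : ℝ × Pt => q.2 + q.1 • axis j) (by fun_prop))
  have h1 := setIntegral_abs_intervalIntegral_le
    (g := fun s x => euc (fun i => F (x + s • axis j) i j)) hcol hQ hh (M := M) (fun s hs => by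
      simpa only [abs_of_nonneg (euc_nonneg _)] using hM s hs)
  refine le_trans (setIntegral_mono_on ?_ ?_ hQ.measurableSet fun x hx => ?_) h1
  · have hc : ContinuousOn u Q := fun x hx => by
      have := (hu x hx 0 ⟨le_rfl, hh⟩).continuousAt
      rw [zero_smul, add_zero] at this
      exact this.continuousWithinAt
    have hc2 : ContinuousOn (fun x => u (x + h • axis j)) Q := fun x hx => by
      have := (hu x hx h ⟨hh, le_rfl⟩).continuousAt
      have hs : ContinuousAt (fun y : Pt => y + h • axis j) x :=
        (continuous_add_const (h • axis j)).continuousAt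
      exact (ContinuousAt.comp (f := fun y : Pt => y + h • axis j) (g := u) this
        hs).continuousWithinAt
    have hc3 : ContinuousOn (fun x => u (x + h • axis j) - u x) Q := hc2.sub hc
    have hc4 : ContinuousOn (fun x => euc (u (x + h • axis j) - u x)) Q :=
      continuous_euc.comp_continuousOn hc3
    exact hc4.integrableOn_compact hQ
  · have hcol' : Continuous (Function.uncurry fun (x : Pt) (s : ℝ) =>
        euc (fun i => F (x + s • axis j) i j)) :=
      continuous_euc.comp ((continuous_col hF j).comp
        (f := fun q : Pt × ℝ => q.1 + q.2 • axis j) (by fun_prop))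
    have : Continuous fun x => ∫ s in (0:ℝ)..h, euc (fun i => F (x + s • axis j) i j) :=
      intervalIntegral.continuous_parametric_intervalIntegral_of_continuous' hcol' 0 h
    exact integrableOn_compact this.abs hQ
  · exact (euc_increment_le hF hh (hu x hx)).trans (le_abs_self _)

lemma setIntegral_euc_col_le (hF : Continuous F) {ζ : Fin 3 → ℝ} (hζ : ∀ i, 0 < ζ i) (k : Fin 3)
    {Q : Set Pt} (hQ : IsCompact Q) {S : Set Pt} (hSm : MeasurableSet S) (hS : S ⊆ Q) :
    ∫ x in S, euc (fun i => F x i k) ≤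
      ζ k * volume.real S + ∫ x in S, distWell (Matrix.diagonal ζ) (F x) := by
  have hd : IntegrableOn (fun x => distWell (Matrix.diagonal ζ) (F x)) S :=
    (integrableOn_compact ((continuous_distWell _).comp hF) hQ).mono_set hS
  have hc : IntegrableOn (fun _ : Pt => ζ k) S :=
    integrableOn_const ((measure_mono hS).trans_lt hQ.measure_lt_top).ne
  calc _ ≤ ∫ x in S, (ζ k + distWell (Matrix.diagonal ζ) (F x)) := by
        refine setIntegral_mono_on ?_ (hc.add hd) hSm fun x _ => ?_
        · exact (integrableOn_compact (continuous_euc.comp (continuous_col hF k)) hQ).mono_set hS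
        · linarith [(abs_le.1 (abs_euc_col_sub_le hζ (F x) k)).2]
    _ = _ := by rw [integral_add hc hd, setIntegral_const, smul_eq_mul, mul_comm]

lemma le_setIntegral_euc_col (hF : Continuous F) {ζ : Fin 3 → ℝ} (hζ : ∀ i, 0 < ζ i) (k : Fin 3)
    {Q : Set Pt} (hQ : IsCompact Q) :
    ζ k * volume.real Q - ∫ x in Q, distWell (Matrix.diagonal ζ) (F x) ≤
      ∫ x in Q, euc (fun i => F x i k) := by
  have hd : IntegrableOn (fun x => distWell (Matrix.diagonal ζ) (F x)) Q :=
    integrableOn_compact ((continuous_distWell _).comp hF) hQ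
  have hc : IntegrableOn (fun _ : Pt => ζ k) Q := integrableOn_const hQ.measure_lt_top.ne
  calc _ = ∫ x in Q, (ζ k - distWell (Matrix.diagonal ζ) (F x)) := by
        rw [integral_sub hc hd, setIntegral_const, smul_eq_mul, mul_comm]
    _ ≤ _ := by
        refine setIntegral_mono_on (hc.sub hd) ?_ hQ.measurableSet fun x _ => ?_
        · exact integrableOn_compact (continuous_euc.comp (continuous_col hF k)) hQ
        · linarith [(abs_le.1 (abs_euc_col_sub_le hζ (F x) k)).1]

end Increments

/-! ### Incompatibility of two wells across the interface -/

section Coupling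

variable {u : Pt → Pt} {F : Pt → Mat}

/-- If the `k`-th column of `F` hardly changes along a segment and lies near the well, then the
segment is stretched by at least `ζ k`, on average. -/
lemma le_setIntegral_euc_increment {ζ : Fin 3 → ℝ} (hζ : ∀ i, 0 < ζ i) (hF : Continuous F)
    {Q : Set Pt} (hQ : IsCompact Q) {k : Fin 3} {ℓ κ δ : ℝ} (hℓ : 0 ≤ ℓ)
    (hu : ∀ x ∈ Q, ∀ s ∈ Icc 0 ℓ, HasFDerivAt u (lin (F (x + s • axis k))) (x + s • axis k))
    (hT : ∀ s ∈ Ioc 0 ℓ, ∀ i j, ∫ x in Q, |F (x + s • axis k) i j - F x i j| ≤ κ)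
    (hd : ∫ x in Q, distWell (Matrix.diagonal ζ) (F x) ≤ δ) :
    ℓ * (ζ k * volume.real Q - δ - 3 * κ) ≤ ∫ x in Q, euc (u (x + ℓ • axis k) - u x) := by
  have hFij : ∀ i j, Continuous fun x => F x i j := fun i j => hF.matrix_elem i j
  set g : Fin 3 → ℝ → Pt → ℝ := fun i s x => F (x + s • axis k) i k - F x i k with hg
  have hgc : ∀ i, Continuous (Function.uncurry (g i)) := fun i => by
    have h1 : Continuous fun q : ℝ × Pt => F (q.2 + q.1 • axis k) i k :=
      (hFij i k).comp (f := fun q : ℝ × Pt => q.2 + q.1 • axis k) (by fun_prop)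
    exact h1.sub ((hFij i k).comp continuous_snd)
  have hgc' : ∀ i, Continuous (Function.uncurry fun (x : Pt) (s : ℝ) => g i s x) := fun i => by
    have h1 : Continuous fun q : Pt × ℝ => F (q.1 + q.2 • axis k) i k :=
      (hFij i k).comp (f := fun q : Pt × ℝ => q.1 + q.2 • axis k) (by fun_prop)
    exact h1.sub ((hFij i k).comp continuous_fst)
  have hgi : ∀ i, Continuous fun x => ∫ s in (0:ℝ)..ℓ, g i s x := fun i =>
    intervalIntegral.continuous_parametric_intervalIntegral_of_continuous' (hgc' i) 0 ℓ
  have hG : ∀ i, ∫ x in Q, |∫ s in (0:ℝ)..ℓ, g i s x| ≤ ℓ * κ := fun i =>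
    setIntegral_abs_intervalIntegral_le (hgc i) hQ hℓ fun s hs => hT s hs i k
  have hft : ∀ x ∈ Q, ∀ i, u (x + ℓ • axis k) i - u x i - ℓ * F x i k =
      ∫ s in (0:ℝ)..ℓ, g i s x := by
    intro x hx i
    have hder : ∀ s ∈ uIcc 0 ℓ, HasDerivAt (fun s : ℝ => u (x + s • axis k) i)
        (F (x + s • axis k) i k) s := fun s hs => by
      rw [uIcc_of_le hℓ] at hs
      exact hasDerivAt_pi.1 (hasDerivAt_axis_of_lin (hu x hx s hs)) i
    have hc : Continuous fun s : ℝ => F (x + s • axis k) i k :=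
      (hFij i k).comp (f := fun s : ℝ => x + s • axis k) (by fun_prop)
    have e := intervalIntegral.integral_eq_sub_of_hasDerivAt hder (hc.intervalIntegrable _ _)
    simp only [zero_smul, add_zero] at e
    simp only [hg]
    rw [intervalIntegral.integral_sub (hc.intervalIntegrable _ _) (by simp), e]
    simp
  have hcol : Continuous fun x => euc (fun i => F x i k) :=
    continuous_euc.comp (continuous_col hF k)
  have hinc : IntegrableOn (fun x => euc (u (x + ℓ • axis k) - u x)) Q := by
    have e : ∀ x ∈ Q, u (x + ℓ • axis k) - u x =
        fun i => ℓ * F x i k + ∫ s in (0:ℝ)..ℓ, g i s x := fun x hx => by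
      ext i; rw [← hft x hx i]; simp
    have hc : Continuous fun x => euc (fun i => ℓ * F x i k + ∫ s in (0:ℝ)..ℓ, g i s x) :=
      continuous_euc.comp (continuous_pi fun i => (continuous_const.mul (hFij i k)).add (hgi i))
    refine (integrableOn_congr_fun (fun x hx => ?_) hQ.measurableSet).2 (integrableOn_compact hc hQ)
    simp only [e x hx]
  have hsumI : IntegrableOn (fun x => ∑ i, |∫ s in (0:ℝ)..ℓ, g i s x|) Q :=
    integrable_finsetSum _ fun i _ => integrableOn_compact (hgi i).abs hQ
  have hpt : ∀ x ∈ Q, ℓ * euc (fun i => F x i k) ≤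
      euc (u (x + ℓ • axis k) - u x) + ∑ i, |∫ s in (0:ℝ)..ℓ, g i s x| := by
    intro x hx
    have e1 : ℓ • (fun i => F x i k : Pt) = (u (x + ℓ • axis k) - u x) +
        -(fun i => ∫ s in (0:ℝ)..ℓ, g i s x : Pt) := by
      ext i
      simp only [Pi.add_apply, Pi.smul_apply, Pi.neg_apply, Pi.sub_apply, smul_eq_mul,
        ← hft x hx i]
      ring
    have e2 : ℓ * euc (fun i => F x i k) = euc (ℓ • (fun i => F x i k : Pt)) := by
      rw [euc_smul, abs_of_nonneg hℓ]
    rw [e2, e1]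
    refine (euc_add_le _ _).trans (add_le_add le_rfl ?_)
    rw [euc_neg]
    exact euc_le_sum _
  have h1 := le_setIntegral_euc_col hF hζ k hQ
  have h2 : ℓ * ∫ x in Q, euc (fun i => F x i k) ≤
      (∫ x in Q, euc (u (x + ℓ • axis k) - u x)) + 3 * (ℓ * κ) := by
    rw [← integral_const_mul]
    refine (setIntegral_mono_on ((integrableOn_compact hcol hQ).const_mul ℓ) (hinc.add hsumI)
      hQ.measurableSet hpt).trans ?_
    refine (integral_add hinc hsumI).trans_le (add_le_add le_rfl ?_)
    rw [integral_finsetSum _ fun i _ => integrableOn_compact (hgi i).abs hQ]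
    exact (Finset.sum_le_sum fun i _ => hG i).trans (by simp)
  have h3 : ℓ * (ζ k * volume.real Q - δ) ≤ ℓ * ∫ x in Q, euc (fun i => F x i k) :=
    mul_le_mul_of_nonneg_left (by linarith) hℓ
  linarith

set_option maxHeartbeats 1600000 in
/-- A gradient field cannot be `L¹`-close to the well `SO(3) diag ζ` in the left half of a cube and
to `SO(3) diag ζ'` in the right half if the two wells prescribe different lengths for a tangential
direction `k` of the interface. -/
theorem exists_incompatible_wells {ζ ζ' : Fin 3 → ℝ} (hζ : ∀ i, 0 < ζ i) (hζ' : ∀ i, 0 < ζ' i)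
    {k : Fin 3} (hk : k ≠ 0) (hne : ζ k ≠ ζ' k) : ∃ δ, 0 < δ ∧ ∀ (u : Pt → Pt) (F : Pt → Mat),
      Continuous F → (∀ x ∈ Metric.ball (0 : Pt) (1 / 2), HasFDerivAt u (lin (F x)) x) →
      ∫ x in Metric.ball (0 : Pt) (1 / 2) ∩ {x | x 0 < 0}, distWell (Matrix.diagonal ζ) (F x) ≤ δ →
      ∫ x in Metric.ball (0 : Pt) (1 / 2) ∩ {x | 0 ≤ x 0}, distWell (Matrix.diagonal ζ') (F x) ≤ δ →
      False := by
  set g := |ζ k - ζ' k| with hg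
  have hg0 : 0 < g := abs_pos.2 (sub_ne_zero.2 hne)
  set Z := ζ 0 + ζ' 0 with hZ
  have hZ0 : 0 < Z := add_pos (hζ 0) (hζ' 0)
  set ℓ : ℝ := 1 / 4 with hℓ
  -- the distance from the interface is chosen so small that crossing it costs less than the gap `g`
  set τ := min (1 / 8) (g / (64 * Z)) with hτ
  have hτ0 : 0 < τ := by positivity
  have hτ8 : τ ≤ 1 / 8 := min_le_left _ _
  have hτg : τ * Z ≤ g / 64 := by
    have : τ ≤ g / (64 * Z) := min_le_right _ _
    calc τ * Z ≤ g / (64 * Z) * Z := by gcongr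
      _ = g / 64 := by field_simp
  set r := τ / 4 with hr
  have hr0 : 0 < r := by positivity
  set vol : ℝ := (2 * (r / 4)) ^ 3 with hvol
  have hvol0 : 0 < vol := by positivity
  set κ := g * vol / 12 with hκ
  obtain ⟨δ₁, hδ₁, H₁⟩ := exists_gradient_translation_le hζ hr0 (show 0 < ℓ by norm_num)
    (show 0 < κ by positivity)
  obtain ⟨δ₂, hδ₂, H₂⟩ := exists_gradient_translation_le hζ' hr0 (show 0 < ℓ by norm_num)
    (show 0 < κ by positivity)
  refine ⟨min (min δ₁ δ₂) (g * vol / 24), by positivity, fun u F hF hu hL hR => ?_⟩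
  set δ := min (min δ₁ δ₂) (g * vol / 24) with hδ
  have hδ1 : δ ≤ δ₁ := (min_le_left _ _).trans (min_le_left _ _)
  have hδ2 : δ ≤ δ₂ := (min_le_left _ _).trans (min_le_right _ _)
  have hδ3 : δ ≤ g * vol / 24 := min_le_right _ _
  set B := Metric.ball (0 : Pt) (1 / 2) with hB
  have hax0 : axis k 0 = 0 := by simp [hk.symm]
  have hmemB : ∀ {x : Pt}, x ∈ B ↔ ∀ i, |x i| < 1 / 2 := fun {x} => by
    rw [hB, mem_ball_zero_iff, pi_norm_lt_iff (by norm_num)]; rfl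
  -- coordinates of the points of the cubes around `± τ e₀ + s e_k`
  have hcube : ∀ {x : Pt} {a s ρ : ℝ}, x ∈ Metric.closedBall (a • axis 0 + s • axis k) ρ →
      |x 0 - a| ≤ ρ ∧ |x k - s| ≤ ρ ∧ ∀ i, i ≠ 0 → i ≠ k → |x i| ≤ ρ := by
    intro x a s ρ hx
    rw [mem_closedBall_iff_norm] at hx
    have h : ∀ i, |x i - (a * axis 0 i + s * axis k i)| ≤ ρ := fun i =>
      (norm_le_pi_norm (x - (a • axis 0 + s • axis k)) i).trans hx
    refine ⟨?_, ?_, fun i h0 h1 => ?_⟩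
    · have := h 0
      rw [hax0] at this
      simpa using this
    · have := h k
      simpa [hk] using this
    · have := h i
      simpa [h0, h1] using this
  have hin : ∀ {x : Pt} {a s ρ : ℝ}, |a| ≤ τ → s ∈ Icc 0 ℓ → ρ ≤ 3 * r →
      x ∈ Metric.closedBall (a • axis 0 + s • axis k) ρ → x ∈ B := by
    intro x a s ρ ha hs hρ hx
    obtain ⟨h0, h1, h2⟩ := hcube hx
    rw [hmemB]
    intro i
    have hs1 := hs.1
    have hs2 := hs.2
    rw [abs_le] at h0 h1 ha
    rw [abs_lt]
    by_cases hi0 : i = 0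
    · rw [hi0]; constructor <;> linarith [h0.1, h0.2, ha.1, ha.2]
    by_cases hik : i = k
    · rw [hik]; rw [hℓ] at hs2; constructor <;> linarith [h1.1, h1.2]
    have := abs_le.1 (h2 i hi0 hik)
    constructor <;> linarith
  have hdL : IntegrableOn (fun x => distWell (Matrix.diagonal ζ) (F x)) B :=
    (integrableOn_compact ((continuous_distWell _).comp hF)
      (isCompact_closedBall (0 : Pt) (1 / 2))).mono_set Metric.ball_subset_closedBall
  have hdR : IntegrableOn (fun x => distWell (Matrix.diagonal ζ') (F x)) B :=
    (integrableOn_compact ((continuous_distWell _).comp hF)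
      (isCompact_closedBall (0 : Pt) (1 / 2))).mono_set Metric.ball_subset_closedBall
  have hLle : ∀ S ⊆ B ∩ {x | x 0 < 0}, ∫ x in S, distWell (Matrix.diagonal ζ) (F x) ≤ δ :=
    fun S hS => (setIntegral_mono_set (hdL.mono_set inter_subset_left)
      (ae_of_all _ fun x => distWell_nonneg _ _) hS.eventuallyLE).trans hL
  have hRle : ∀ S ⊆ B ∩ {x | 0 ≤ x 0}, ∫ x in S, distWell (Matrix.diagonal ζ') (F x) ≤ δ :=
    fun S hS => (setIntegral_mono_set (hdR.mono_set inter_subset_left)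
      (ae_of_all _ fun x => distWell_nonneg _ _) hS.eventuallyLE).trans hR
  have hsubL : ∀ s ∈ Icc 0 ℓ, ∀ ρ ≤ 3 * r,
      Metric.closedBall ((-τ) • axis 0 + s • axis k) ρ ⊆ B ∩ {x | x 0 < 0} := by
    intro s hs ρ hρ x hx
    refine ⟨hin (by rw [abs_neg, abs_of_pos hτ0]) hs hρ hx, ?_⟩
    have := abs_le.1 (hcube hx).1
    simp only [Set.mem_ofPred_eq]; linarith
  have hsubR : ∀ s ∈ Icc 0 ℓ, ∀ ρ ≤ 3 * r,
      Metric.closedBall (τ • axis 0 + s • axis k) ρ ⊆ B ∩ {x | 0 ≤ x 0} := by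
    intro s hs ρ hρ x hx
    refine ⟨hin (by rw [abs_of_pos hτ0]) hs hρ hx, ?_⟩
    have := abs_le.1 (hcube hx).1
    simp only [Set.mem_ofPred_eq]; linarith
  have h3r : r / 4 ≤ 3 * r := by linarith
  have hshift : ∀ {a s : ℝ} {x : Pt}, x ∈ Metric.closedBall (a • axis 0 : Pt) (r / 4) →
      x + s • axis k ∈ Metric.closedBall (a • axis 0 + s • axis k) (r / 4) := by
    intro a s x hx
    rw [mem_closedBall_iff_norm] at hx ⊢
    rwa [add_sub_add_right_eq_sub]
  have hshift0 : ∀ {a s t : ℝ} {x : Pt}, x ∈ Metric.closedBall (a • axis 0 : Pt) (r / 4) →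
      x + s • axis k + t • axis 0 ∈ Metric.closedBall ((a + t) • axis 0 + s • axis k) (r / 4) := by
    intro a s t x hx
    rw [mem_closedBall_iff_norm] at hx ⊢
    have : x + s • axis k + t • axis 0 - ((a + t) • axis 0 + s • axis k) = x - a • axis 0 := by
      rw [add_smul]; abel
    rwa [this]
  have hcol : ∀ j, Continuous fun x => euc (fun i => F x i j) := fun j =>
    continuous_euc.comp (continuous_col hF j)
  have hvolc : ∀ c : Pt, volume.real (Metric.closedBall c (r / 4)) = vol := fun c =>
    volume_real_closedBall c (by positivity)
  set QL := Metric.closedBall ((-τ) • axis 0 : Pt) (r / 4) with hQL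
  set QR := Metric.closedBall (τ • axis 0 : Pt) (r / 4) with hQR
  have hQLc : IsCompact QL := isCompact_closedBall _ _
  have hQRc : IsCompact QR := isCompact_closedBall _ _
  -- on each side: lower and upper bounds for the stretch in direction `k`
  have zeroI : (0 : ℝ) ∈ Icc 0 ℓ := ⟨le_rfl, by norm_num⟩
  have huL : ∀ x ∈ QL, ∀ s ∈ Icc 0 ℓ,
      HasFDerivAt u (lin (F (x + s • axis k))) (x + s • axis k) := fun x hx s hs =>
    hu _ (hsubL s hs _ h3r (hshift hx)).1
  have huR : ∀ x ∈ QR, ∀ s ∈ Icc 0 ℓ,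
      HasFDerivAt u (lin (F (x + s • axis k))) (x + s • axis k) := fun x hx s hs =>
    hu _ (hsubR s hs _ h3r (hshift hx)).1
  have dL0 : ∫ x in QL, distWell (Matrix.diagonal ζ) (F x) ≤ δ :=
    hLle _ fun x hx => hsubL 0 zeroI _ h3r (by rw [zero_smul, add_zero]; exact hx)
  have dR0 : ∫ x in QR, distWell (Matrix.diagonal ζ') (F x) ≤ δ :=
    hRle _ fun x hx => hsubR 0 zeroI _ h3r (by rw [zero_smul, add_zero]; exact hx)
  have lowL := le_setIntegral_euc_increment hζ hF hQLc (show 0 ≤ ℓ by norm_num) huL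
    (H₁ u F ((-τ) • axis 0) k hF (fun s hs x hx => hu x (hsubL s hs _ le_rfl hx).1)
      (fun s hs => (hLle _ (hsubL s hs _ le_rfl)).trans hδ1)) dL0
  have lowR := le_setIntegral_euc_increment hζ' hF hQRc (show 0 ≤ ℓ by norm_num) huR
    (H₂ u F (τ • axis 0) k hF (fun s hs x hx => hu x (hsubR s hs _ le_rfl hx).1)
      (fun s hs => (hRle _ (hsubR s hs _ le_rfl)).trans hδ2)) dR0
  have upL : ∫ x in QL, euc (u (x + ℓ • axis k) - u x) ≤ ℓ * (ζ k * vol + δ) := by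
    refine setIntegral_euc_increment_le hF hQLc (by norm_num) huL fun s hs => ?_
    have hs' : s ∈ Icc 0 ℓ := Ioc_subset_Icc_self hs
    rw [setIntegral_closedBall_shift (fun x => euc (fun i => F x i k))]
    refine (setIntegral_euc_col_le hF hζ k (isCompact_closedBall _ _)
      Metric.isClosed_closedBall.measurableSet le_rfl).trans ?_
    rw [hvolc]
    exact add_le_add le_rfl (hLle _ (hsubL s hs' _ h3r))
  have upR : ∫ x in QR, euc (u (x + ℓ • axis k) - u x) ≤ ℓ * (ζ' k * vol + δ) := by
    refine setIntegral_euc_increment_le hF hQRc (by norm_num) huR fun s hs => ?_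
    have hs' : s ∈ Icc 0 ℓ := Ioc_subset_Icc_self hs
    rw [setIntegral_closedBall_shift (fun x => euc (fun i => F x i k))]
    refine (setIntegral_euc_col_le hF hζ' k (isCompact_closedBall _ _)
      Metric.isClosed_closedBall.measurableSet le_rfl).trans ?_
    rw [hvolc]
    exact add_le_add le_rfl (hRle _ (hsubR s hs' _ h3r))
  -- crossing the interface
  have hcross : ∀ s ∈ Icc 0 ℓ, ∀ t ∈ Ioc 0 (2 * τ),
      ∫ x in QL, euc (fun i => F (x + s • axis k + t • axis 0) i 0) ≤ Z * vol + 2 * δ := by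
    intro s hs t ht
    have e0 : ∫ x in QL, euc (fun i => F (x + s • axis k + t • axis 0) i 0) =
        ∫ x in Metric.closedBall ((-τ + t) • axis 0 + s • axis k) (r / 4),
          euc (fun i => F x i 0) := by
      have := setIntegral_closedBall_shift (fun x => euc (fun i => F x i 0)) ((-τ) • axis 0)
        (s • axis k + t • axis 0) (r / 4)
      simp only [← add_assoc] at this
      rw [hQL, this, add_smul]
      congr 3; abel
    rw [e0]
    set Q := Metric.closedBall ((-τ + t) • axis 0 + s • axis k) (r / 4) with hQ
    have hQc : IsCompact Q := isCompact_closedBall _ _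
    have hQB : Q ⊆ B := fun x hx =>
      hin (abs_le.2 ⟨by linarith [ht.1], by linarith [ht.2]⟩) hs h3r hx
    have hm : MeasurableSet {x : Pt | x 0 < 0} :=
      measurableSet_lt (measurable_pi_apply 0) measurable_const
    have hm' : MeasurableSet {x : Pt | 0 ≤ x 0} :=
      measurableSet_le measurable_const (measurable_pi_apply 0)
    have e1 := setIntegral_euc_col_le hF hζ 0 hQc (hQc.measurableSet.inter hm) inter_subset_left
    have e2 := setIntegral_euc_col_le hF hζ' 0 hQc (hQc.measurableSet.inter hm') inter_subset_left
    have e3 := hLle (Q ∩ {x | x 0 < 0}) (inter_subset_inter_left _ hQB)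
    have e4 := hRle (Q ∩ {x | 0 ≤ x 0}) (inter_subset_inter_left _ hQB)
    have hI := integrableOn_compact (hcol 0) hQc
    have hun : Q ∩ {x : Pt | x 0 < 0} ∪ Q ∩ {x : Pt | 0 ≤ x 0} = Q := by
      rw [← inter_union_distrib_left]
      refine inter_eq_left.2 fun x _ => ?_
      exact lt_or_ge (x 0) 0
    have hdis : Disjoint (Q ∩ {x : Pt | x 0 < 0}) (Q ∩ {x : Pt | 0 ≤ x 0}) := by
      rw [Set.disjoint_left]
      exact fun x hx hx' => absurd (show x 0 < 0 from hx.2) (not_lt.2 (show 0 ≤ x 0 from hx'.2))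
    have e5 := setIntegral_union hdis (hQc.measurableSet.inter hm')
      (hI.mono_set inter_subset_left) (hI.mono_set inter_subset_left)
    have e6 := measureReal_union (μ := (volume : Measure Pt)) hdis (hQc.measurableSet.inter hm')
      ((measure_mono inter_subset_left).trans_lt hQc.measure_lt_top).ne
      ((measure_mono inter_subset_left).trans_lt hQc.measure_lt_top).ne
    rw [hun] at e5 e6
    rw [hQ, hvolc, ← hQ] at e6
    rw [e5, e6]
    have z0 := hζ 0
    have z1 := hζ' 0
    have m0 : 0 ≤ volume.real (Q ∩ {x : Pt | x 0 < 0}) := measureReal_nonneg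
    have m1 : 0 ≤ volume.real (Q ∩ {x : Pt | 0 ≤ x 0}) := measureReal_nonneg
    nlinarith [mul_nonneg z0.le m1, mul_nonneg z1.le m0]
  have hbr : ∀ s ∈ Icc 0 ℓ,
      ∫ x in QL, euc (u (x + s • axis k + (2 * τ) • axis 0) - u (x + s • axis k)) ≤
      2 * τ * (Z * vol + 2 * δ) := by
    intro s hs
    have e0 := fun f : Pt → ℝ => setIntegral_closedBall_shift f ((-τ) • axis 0) (s • axis k) (r / 4)
    rw [hQL, e0 fun x => euc (u (x + (2 * τ) • axis 0) - u x)]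
    refine setIntegral_euc_increment_le hF (isCompact_closedBall _ _) (by positivity)
      (fun x hx t ht => hu _ ?_) fun t ht => ?_
    · have hx' : x - s • axis k ∈ QL := by
        rw [mem_closedBall_iff_norm] at hx ⊢
        rwa [sub_sub, add_comm (s • axis k)]
      have := hshift0 (s := s) (t := t) hx'
      rw [sub_add_cancel] at this
      exact hin (abs_le.2 ⟨by linarith [ht.1], by linarith [ht.2]⟩) hs h3r this
    · rw [← e0 fun x => euc (fun i => F (x + t • axis 0) i 0)]
      exact hcross s hs t ht
  -- the stretches on the two sides differ by at most the cost of crossing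
  have hcont : ContinuousOn u B := fun x hx => (hu x hx).continuousAt.continuousWithinAt
  have hQLB : ∀ s ∈ Icc 0 ℓ, ∀ t ∈ Icc 0 (2 * τ), ∀ x ∈ QL,
      x + s • axis k + t • axis 0 ∈ B := fun s hs t ht x hx =>
    hin (abs_le.2 ⟨by linarith [ht.1], by linarith [ht.2]⟩) hs h3r (hshift0 hx)
  have huc : ∀ s ∈ Icc 0 ℓ, ∀ t ∈ Icc 0 (2 * τ),
      ContinuousOn (fun x => u (x + s • axis k + t • axis 0)) QL := fun s hs t ht =>
    hcont.comp (f := fun x : Pt => x + s • axis k + t • axis 0) (by fun_prop) (hQLB s hs t ht)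
  have two : 2 * τ ∈ Icc 0 (2 * τ) := ⟨by positivity, le_rfl⟩
  have zer : (0 : ℝ) ∈ Icc 0 (2 * τ) := ⟨le_rfl, by positivity⟩
  have ell : ℓ ∈ Icc 0 ℓ := ⟨by norm_num, le_rfl⟩
  have I1 : IntegrableOn (fun x => euc (u (x + ℓ • axis k) - u x)) QL := by
    have e1 : ContinuousOn (fun x => u (x + ℓ • axis k)) QL := by simpa using huc ℓ ell 0 zer
    have e2 : ContinuousOn (fun x => u x) QL := by simpa using huc 0 zeroI 0 zer
    have e3 : ContinuousOn (fun x => euc (u (x + ℓ • axis k) - u x)) QL :=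
      continuous_euc.comp_continuousOn (e1.sub e2)
    exact e3.integrableOn_compact hQLc
  have I2 : IntegrableOn (fun x => euc (u (x + ℓ • axis k + (2 * τ) • axis 0)
      - u (x + (2 * τ) • axis 0))) QL := by
    have e1 := huc ℓ ell _ two
    have e2 : ContinuousOn (fun x => u (x + (2 * τ) • axis 0)) QL := by
      simpa using huc 0 zeroI _ two
    have e3 : ContinuousOn (fun x => euc (u (x + ℓ • axis k + (2 * τ) • axis 0)
      - u (x + (2 * τ) • axis 0))) QL := continuous_euc.comp_continuousOn (e1.sub e2)
    exact e3.integrableOn_compact hQLc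
  have I3 : ∀ s ∈ Icc 0 ℓ, IntegrableOn (fun x => euc (u (x + s • axis k + (2 * τ) • axis 0)
      - u (x + s • axis k))) QL := fun s hs => by
    have e1 := huc s hs _ two
    have e2 : ContinuousOn (fun x => u (x + s • axis k)) QL := by simpa using huc s hs 0 zer
    have e3 : ContinuousOn (fun x => euc (u (x + s • axis k + (2 * τ) • axis 0)
      - u (x + s • axis k))) QL := continuous_euc.comp_continuousOn (e1.sub e2)
    exact e3.integrableOn_compact hQLc
  have I4 : IntegrableOn (fun x => euc (u (x + (2 * τ) • axis 0) - u x)) QL := by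
    simpa using I3 0 zeroI
  have b1 := hbr ℓ ell
  have b0 := hbr 0 zeroI
  simp only [zero_smul, add_zero] at b0
  have eR : ∫ x in QR, euc (u (x + ℓ • axis k) - u x) =
      ∫ x in QL, euc (u (x + ℓ • axis k + (2 * τ) • axis 0) - u (x + (2 * τ) • axis 0)) := by
    have := setIntegral_closedBall_shift (fun x => euc (u (x + ℓ • axis k) - u x))
      ((-τ) • axis 0) ((2 * τ) • axis 0) (r / 4)
    rw [← add_smul, show -τ + 2 * τ = τ by ring] at this
    rw [hQR, ← this]
    congr 1; ext x
    rw [add_right_comm]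
  have IA : IntegrableOn (fun x => euc (u (x + ℓ • axis k + (2 * τ) • axis 0)
      - u (x + ℓ • axis k)) + euc (u (x + (2 * τ) • axis 0) - u x)) QL := (I3 ℓ ell).add I4
  have hsumA : ∫ x in QL, (euc (u (x + ℓ • axis k + (2 * τ) • axis 0) - u (x + ℓ • axis k)) +
      euc (u (x + (2 * τ) • axis 0) - u x)) ≤ 4 * τ * (Z * vol + 2 * δ) := by
    rw [integral_add (I3 ℓ ell) I4]; linarith
  have hRL : ∫ x in QR, euc (u (x + ℓ • axis k) - u x) ≤
      (∫ x in QL, euc (u (x + ℓ • axis k) - u x)) + 4 * τ * (Z * vol + 2 * δ) := by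
    rw [eR]
    refine (setIntegral_mono_on I2 (I1.add IA) hQLc.measurableSet fun x _ => ?_).trans
      ((integral_add I1 IA).trans_le (add_le_add le_rfl hsumA))
    have e : u (x + ℓ • axis k + (2 * τ) • axis 0) - u (x + (2 * τ) • axis 0) =
        (u (x + ℓ • axis k) - u x) + ((u (x + ℓ • axis k + (2 * τ) • axis 0)
          - u (x + ℓ • axis k)) + -(u (x + (2 * τ) • axis 0) - u x)) := by abel
    rw [e]
    refine (euc_add_le _ _).trans (add_le_add le_rfl ((euc_add_le _ _).trans ?_))
    rw [euc_neg]
  have hLR : ∫ x in QL, euc (u (x + ℓ • axis k) - u x) ≤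
      (∫ x in QR, euc (u (x + ℓ • axis k) - u x)) + 4 * τ * (Z * vol + 2 * δ) := by
    rw [eR]
    refine (setIntegral_mono_on I1 (I2.add IA) hQLc.measurableSet fun x _ => ?_).trans
      ((integral_add I2 IA).trans_le (add_le_add le_rfl hsumA))
    have e : u (x + ℓ • axis k) - u x =
        (u (x + ℓ • axis k + (2 * τ) • axis 0) - u (x + (2 * τ) • axis 0)) +
        (-(u (x + ℓ • axis k + (2 * τ) • axis 0)
          - u (x + ℓ • axis k)) + (u (x + (2 * τ) • axis 0) - u x)) := by abel
    rw [e]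
    refine (euc_add_le _ _).trans (add_le_add le_rfl ((euc_add_le _ _).trans ?_))
    rw [euc_neg]
  rw [hvolc] at lowL lowR
  replace lowL := (show 1 / 4 * (ζ k * vol - δ - 3 * κ) ≤ _ from lowL)
  replace lowR := (show 1 / 4 * (ζ' k * vol - δ - 3 * κ) ≤ _ from lowR)
  replace upL := (show _ ≤ 1 / 4 * (ζ k * vol + δ) from upL)
  replace upR := (show _ ≤ 1 / 4 * (ζ' k * vol + δ) from upR)
  have hgv : 0 < g * vol := mul_pos hg0 hvol0
  have hτv : 4 * τ * (Z * vol + 2 * δ) ≤ g * vol / 16 + δ := by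
    have hδ0 : 0 ≤ δ := by positivity
    have e1 : τ * Z * vol ≤ g / 64 * vol := by gcongr
    have e2 : τ * δ ≤ 1 / 8 * δ := by gcongr
    nlinarith
  rcases abs_cases (ζ k - ζ' k) with ⟨hab, _⟩ | ⟨hab, _⟩
  · rw [← hg] at hab
    have : ζ k * vol = ζ' k * vol + g * vol := by rw [hab]; ring
    linarith
  · rw [← hg] at hab
    have : ζ' k * vol = ζ k * vol + g * vol := by rw [hab]; ring
    linarith

end Coupling

/-! ### Curl-free fields are nearly gradients -/

lemma pd_moll (φ : ContDiffBump (0 : Pt)) {f : Pt → ℝ} (hf : LocallyIntegrable f) (k : Fin 3)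
    (x : Pt) : pd k (moll φ f) x = ∫ y, f y * pd k (φ.normed volume) (x - y) := by
  have hd := φ.hasCompactSupport_normed.hasFDerivAt_convolution_left
    (ContinuousLinearMap.lsmul ℝ ℝ) (μ := (volume : Measure Pt))
    (φ.contDiff_normed (μ := volume) (n := 1)) hf x
  have hex := (φ.hasCompactSupport_normed.fderiv (𝕜 := ℝ)).convolutionExists_left
    ((ContinuousLinearMap.lsmul ℝ ℝ).precompL Pt) (μ := (volume : Measure Pt))
    ((φ.contDiff_normed (μ := volume) (n := 1)).continuous_fderiv (by simp)) hf x
  rw [pd, show moll φ f = convolution (φ.normed volume) f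
    (ContinuousLinearMap.lsmul ℝ ℝ) volume from rfl, hd.fderiv, convolution_def,
    ContinuousLinearMap.integral_apply hex]
  rw [← integral_sub_left_eq_self (fun y => f y * pd k (φ.normed volume) (x - y)) volume x]
  congr 1; ext y
  simp [pd, mul_comm]

lemma pderiv_smul_axis {g : Pt → ℝ} (hg : ContDiff ℝ ∞ g) (l k j : Fin 3) (x : Pt) :
    pderiv (fun y => g y • axis l) k j x = pd k g x * axis l j := by
  have h := ((hg.differentiable (by simp) x).hasFDerivAt.smul_const (axis l)).fderiv
  rw [pderiv, h]
  simp [pd]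

/-- Testing the curl with a scalar function times a coordinate vector. -/
lemma integral_mul_pd_sub_eq_zero {F : Pt → Mat}
    (hF : HasDislocationCurl 1 (DislocationSystem.empty 1) F) {g : Pt → ℝ} (hg : ContDiff ℝ ∞ g)
    (hc : HasCompactSupport g) (hs : tsupport g ⊆ cylinder 1) (i a b : Fin 3) :
    ∫ x, (F x i a * pd b g x - F x i b * pd a g x) = 0 := by
  have key : ∀ l : Fin 3,
      ∫ x, (F x i (l + 1) * pd (l + 2) g x - F x i (l + 2) * pd (l + 1) g x) = 0 := by
    intro l
    have ht : IsTestField 1 (fun y => g y • axis l) :=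
      ⟨hg.smul contDiff_const, hc.smul_right,
        (closure_mono (Function.support_smul_subset_left g _)).trans hs⟩
    have h := hF _ ht i
    rw [show (∑ m, (DislocationSystem.empty 1).burgers m i *
      lineIntegral ((DislocationSystem.empty 1).line m) fun y => g y • axis l) = 0 from
        Finset.sum_eq_zero fun m _ => m.elim0, neg_zero] at h
    rw [← h]
    congr 1; ext x
    have h1 : (1 : Fin 3) + 1 = 2 := rfl
    have h2 : (1 : Fin 3) + 2 = 0 := rfl
    have h3 : (2 : Fin 3) + 1 = 0 := rfl
    have h4 : (2 : Fin 3) + 2 = 1 := rfl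
    fin_cases l <;>
      simp [Fin.sum_univ_three, curl, pderiv_smul_axis hg, h1, h2, h3, h4, sub_eq_add_neg, add_comm]
  have anti : ∀ a b : Fin 3, ∫ x, (F x i a * pd b g x - F x i b * pd a g x) = 0 →
      ∫ x, (F x i b * pd a g x - F x i a * pd b g x) = 0 := by
    intro a b h
    rw [← neg_eq_zero, ← integral_neg, ← h]
    congr 1; ext x; ring
  have self : ∀ a : Fin 3, ∫ x, (F x i a * pd a g x - F x i a * pd a g x) = 0 := by simp
  have k0 := key 0
  have k1 := key 1
  have k2 := key 2
  fin_cases a <;> fin_cases b <;>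
    first
    | exact self _
    | exact k0
    | exact k1
    | exact k2
    | exact anti 1 2 k0
    | exact anti 2 0 k1
    | exact anti 0 1 k2

/-- The `j`-th coordinate as a linear functional. -/
def coord (j : Fin 3) : Pt →L[ℝ] ℝ := ContinuousLinearMap.proj j

@[simp] lemma coord_apply (j : Fin 3) (v : Pt) : coord j v = v j := rfl

/-- A smooth symmetric system of partial derivatives on an open ball has a potential. -/
lemma exists_potential {f : Fin 3 → Pt → ℝ} (hf : ∀ j, ContDiff ℝ ∞ (f j)) {R : ℝ}
    (hsym : ∀ x ∈ Metric.ball (0 : Pt) R, ∀ a b, pd a (f b) x = pd b (f a) x) :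
    ∃ u : Pt → ℝ, ∀ x ∈ Metric.ball (0 : Pt) R,
      HasFDerivAt u (∑ j, f j x • coord j) x := by
  have hω : ∀ x, HasFDerivAt
      (fun x => ∑ j, f j x • coord j)
      (∑ j, (fderiv ℝ (f j) x).smulRight (coord j)) x := fun x =>
    HasFDerivAt.fun_sum fun j _ => by
      have h : HasFDerivAt (f j) (fderiv ℝ (f j) x) x :=
        ((hf j).differentiable (by simp) x).hasFDerivAt
      exact h.smul_const (F := Pt →L[ℝ] ℝ) (coord j)
  refine (convex_ball (0 : Pt) R).exists_forall_hasFDerivAt_of_fderiv_symmetric Metric.isOpen_ball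
    (fun x _ => (hω x).differentiableAt.differentiableWithinAt) fun x hx v w => ?_
  have hexp : ∀ (j : Fin 3) (v : Pt), fderiv ℝ (f j) x v = ∑ k, v k * pd k (f j) x := fun j v => by
    conv_lhs => rw [← Finset.univ_sum_single v]
    rw [map_sum]
    refine Finset.sum_congr rfl fun k _ => ?_
    rw [show (Pi.single k (v k) : Pt) = v k • axis k by
      rw [← Pi.single_smul, smul_eq_mul, mul_one], map_smul]
    rfl
  rw [(hω x).fderiv]
  simp only [FunLike.coe_sum, Finset.sum_apply, ContinuousLinearMap.smulRight_apply,
    FunLike.coe_smul, Pi.smul_apply, coord_apply, smul_eq_mul, hexp,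
    Finset.sum_mul]
  rw [Finset.sum_comm]
  refine Finset.sum_congr rfl fun k _ => Finset.sum_congr rfl fun j _ => ?_
  rw [hsym x hx k j]; ring

/-- The cube on which fields in the wire of radius `1` are mollified lies in the wire. -/
lemma closedBall_subset_cylinder : Metric.closedBall (0 : Pt) (6 / 10) ⊆ cylinder 1 := by
  intro x hx
  rw [mem_closedBall_zero_iff, pi_norm_le_iff_of_nonneg (by norm_num)] at hx
  have h1 := sq_le_sq' (abs_le.1 (hx 1)).1 (abs_le.1 (hx 1)).2
  have h2 := sq_le_sq' (abs_le.1 (hx 2)).1 (abs_le.1 (hx 2)).2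
  simp only [cylinder, Set.mem_ofPred_eq]
  linarith

lemma LpLoc.integrableOn {p r : ℝ} (hp : 1 ≤ p) {F : Pt → Mat} (hF : LpLoc p r F) {K : Set Pt}
    (hK : IsCompact K) (hKr : K ⊆ cylinder r) (i j : Fin 3) :
    IntegrableOn (fun x => F x i j) K := by
  have : IsFiniteMeasure (volume.restrict K) := ⟨by simpa using hK.measure_lt_top⟩
  exact (hF K hK hKr i j).integrable (by simpa using ENNReal.ofReal_le_ofReal hp)

/-- A field without dislocations in the wire is, near the origin, an `L¹` limit of smooth
gradients. -/
theorem exists_gradient_approx {p : ℝ} (hp : 1 ≤ p) {F : Pt → Mat} (hL : LpLoc p 1 F)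
    (hF : HasDislocationCurl 1 (DislocationSystem.empty 1) F) {ε : ℝ} (hε : 0 < ε) :
    ∃ (u : Pt → Pt) (G : Pt → Mat), Continuous G ∧
      (∀ x ∈ Metric.ball (0 : Pt) (1 / 2), HasFDerivAt u (lin (G x)) x) ∧
      ∀ i j, ∫ x in Metric.closedBall (0 : Pt) (1 / 2), |G x i j - F x i j| ≤ ε := by
  set K := Metric.closedBall (0 : Pt) (6 / 10) with hK
  have hKc : IsCompact K := isCompact_closedBall _ _
  set f : Fin 3 → Fin 3 → Pt → ℝ := fun i j => K.indicator fun x => F x i j with hf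
  have hfi : ∀ i j, Integrable (f i j) := fun i j =>
    (hL.integrableOn hp hKc closedBall_subset_cylinder i j).integrable_indicator hKc.measurableSet
  choose θ hθ hθm using fun i j => exists_setIntegral_moll_sub_le (hfi i j) (1 / 2) hε
  obtain ⟨t, ht0, ht1, ht⟩ : ∃ t, 0 < t ∧ t < 1 / 10 ∧ ∀ i j, t < θ i j := by
    have h1 : ∀ᶠ t in 𝓝[>] (0 : ℝ), t < 1 / 10 ∧ ∀ i j, t < θ i j :=
      (eventually_nhdsWithin_of_eventually_nhds (eventually_lt_nhds (by norm_num))).and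
        (eventually_all.2 fun i => eventually_all.2 fun j =>
          eventually_nhdsWithin_of_eventually_nhds (eventually_lt_nhds (hθ i j)))
    obtain ⟨t, ht, h⟩ := (h1.and self_mem_nhdsWithin).exists
    exact ⟨t, h, ht⟩
  let φ : ContDiffBump (0 : Pt) := ⟨t / 2, t, by positivity, by linarith⟩
  have hsm : ∀ i j, ContDiff ℝ ∞ (moll φ (f i j)) := fun i j =>
    contDiff_moll φ (hfi i j).locallyIntegrable
  have hsym : ∀ i, ∀ x ∈ Metric.ball (0 : Pt) (1 / 2), ∀ a b,
      pd a (moll φ (f i b)) x = pd b (moll φ (f i a)) x := by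
    intro i x hx a b
    set g : Pt → ℝ := fun y => φ.normed volume (x - y) with hg
    have hgs : ContDiff ℝ ∞ g := φ.contDiff_normed.comp (contDiff_const.sub contDiff_id)
    have hgpd : ∀ k y, pd k g y = - pd k (φ.normed volume) (x - y) := fun k y => by
      have h1 : HasFDerivAt (fun y : Pt => x - y) (-ContinuousLinearMap.id ℝ Pt) y :=
        (hasFDerivAt_id y).const_sub x
      have h2 := ((φ.contDiff_normed (μ := volume) (n := 1)).differentiable (by simp)
        (x - y)).hasFDerivAt.comp y h1
      rw [pd, show g = φ.normed volume ∘ fun y : Pt => x - y from rfl, h2.fderiv]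
      simp [pd]
    have hgz : ∀ y, y ∉ K → g y = 0 := fun y hy => by
      have : x - y ∉ Function.support (φ.normed (volume : Measure Pt)) := by
        rw [φ.support_normed_eq, mem_ball_zero_iff]
        intro hxy
        apply hy
        rw [mem_ball_zero_iff] at hx
        have e := norm_sub_le x (x - y)
        rw [sub_sub_cancel] at e
        rw [hK, mem_closedBall_zero_iff]
        have : ‖x - y‖ < t := hxy
        linarith
      simpa using this
    have hts : tsupport g ⊆ K :=
      closure_minimal (fun y hy => by_contra fun h => hy (hgz y h)) hKc.isClosed
    have h := integral_mul_pd_sub_eq_zero hF hgs (HasCompactSupport.intro hKc hgz)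
      (hts.trans closedBall_subset_cylinder) i a b
    have hpz : ∀ k y, y ∉ K → pd k g y = 0 := fun k y hy => by
      have : fderiv ℝ g y = 0 := by
        by_contra h0
        exact hy (hts (support_fderiv_subset ℝ h0))
      rw [pd, this]; rfl
    have hI : ∀ a k, Integrable fun y => f i a y * pd k g y := fun a k => by
      have hc : Continuous (pd k g) := (contDiff_pd hgs k).continuous
      obtain ⟨C, hC⟩ := (HasCompactSupport.intro hKc (hpz k)).exists_bound_of_continuous hc
      exact (hfi i a).mul_bdd hc.aestronglyMeasurable (ae_of_all _ hC)
    have e1 : ∀ a k, pd k (moll φ (f i a)) x = -∫ y, f i a y * pd k g y := fun a k => by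
      rw [pd_moll φ (hfi i a).locallyIntegrable, ← integral_neg]
      congr 1; ext y; rw [hgpd]; ring
    have e2 : ∫ y, (F y i a * pd b g y - F y i b * pd a g y) =
        ∫ y, (f i a y * pd b g y - f i b y * pd a g y) := by
      congr 1; ext y
      by_cases hy : y ∈ K
      · simp only [hf, indicator_of_mem hy]
      · simp only [hpz _ y hy, mul_zero]
    rw [e2, integral_sub (hI a b) (hI b a)] at h
    rw [e1, e1]; linarith
  choose u hu using fun i => exists_potential (hsm i) (hsym i)
  refine ⟨fun x i => u i x, fun x => Matrix.of fun i j => moll φ (f i j) x,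
    continuous_matrix fun i j => (hsm i j).continuous, fun x hx => ?_, fun i j => ?_⟩
  · rw [hasFDerivAt_pi']
    intro i
    refine (hu i x hx).congr_fderiv (ContinuousLinearMap.ext fun v => ?_)
    change _ = lin (Matrix.of fun i j => moll φ (f i j) x) v i
    simp [lin_apply]
  · refine le_of_eq_of_le ?_ (hθm i j φ (ht i j))
    refine setIntegral_congr_fun Metric.isClosed_closedBall.measurableSet fun x hx => ?_
    have hxK : x ∈ K := Metric.closedBall_subset_closedBall (by norm_num) hx
    simp only [hf, indicator_of_mem hxK, Matrix.of_apply]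

/-! ### The cost of a transition without dislocations -/

/-- Up to a small constant, the growth function of the energy controls the distance linearly. -/
lemma distWell_le_of_growth {p : ℝ} (hp : 1 ≤ p) (H : Mat) {α : ℝ} (hα : 0 < α) (A : Mat) :
    distWell H A ≤
      α + (α⁻¹ + 1 + frobNorm H) * min (distWell H A ^ 2) (frobNorm A ^ p + 1) := by
  set t := distWell H A with ht
  have ht0 : 0 ≤ t := distWell_nonneg _ _
  set a := frobNorm A with ha
  have ha0 : 0 ≤ a := frobNorm_nonneg _
  have hK : 0 ≤ frobNorm H := frobNorm_nonneg _
  have hta : t ≤ a + frobNorm H := by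
    have h := distWell_le_add H A H
    rw [distWell_self, zero_add] at h
    have h2 := frobNorm_add_le A (-H)
    have h3 : frobNorm (-H) = frobNorm H := by simp [frobNorm]
    rw [← sub_eq_add_neg, h3] at h2
    exact h.trans h2
  have hα' : 0 < α⁻¹ := by positivity
  have hap0 : 0 ≤ a ^ p := Real.rpow_nonneg ha0 p
  rcases min_choice (t ^ 2) (a ^ p + 1) with h | h <;> rw [h]
  · have h1 : t ≤ α + α⁻¹ * t ^ 2 := by
      have h2 : 0 ≤ α⁻¹ * (t - α) ^ 2 := by positivity
      have h3 : α⁻¹ * (t - α) ^ 2 = α⁻¹ * t ^ 2 - 2 * t + α := by field_simp; ring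
      linarith
    have h2 : 0 ≤ (1 + frobNorm H) * t ^ 2 := by positivity
    linarith
  · have hap : a ≤ a ^ p + 1 := by
      rcases le_total a 1 with h1 | h1
      · linarith
      · have := Real.rpow_le_rpow_of_exponent_le h1 hp
        rw [Real.rpow_one] at this
        linarith
    have h1 : 0 ≤ α⁻¹ * (a ^ p + 1) := by positivity
    have h2 : 0 ≤ frobNorm H * a ^ p := by positivity
    nlinarith

lemma measurableSet_slab (M r : ℝ) : MeasurableSet (slab M r) := by
  have h0 : Measurable fun x : Pt => x 0 := measurable_pi_apply 0
  have h1 : Measurable fun x : Pt => x 1 ^ 2 + x 2 ^ 2 := by fun_prop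
  exact (measurableSet_lt measurable_const h0).inter
    ((measurableSet_lt h0 measurable_const).inter (measurableSet_lt h1 measurable_const))

lemma aemeasurable_distWell {μ : Measure Pt} {F : Pt → Mat}
    (hF : ∀ i j, AEMeasurable (fun x => F x i j) μ) (H : Mat) :
    AEMeasurable (fun x => distWell H (F x)) μ := by
  have h1 : AEMeasurable (fun x i j => F x i j) μ :=
    aemeasurable_pi_iff.2 fun i => aemeasurable_pi_iff.2 fun j => hF i j
  have hc : Continuous fun A : Fin 3 → Fin 3 → ℝ => distWell H (Matrix.of A) :=
    continuous_distWell H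
  exact hc.measurable.comp_aemeasurable h1

lemma distWell_le_sum (H A : Mat) : distWell H A ≤ ∑ i, ∑ j, |A i j - H i j| := by
  have h := distWell_le_add H A H
  rw [distWell_self, zero_add] at h
  exact h.trans (frobNorm_le_sum _)

/-- A field of small energy is `L¹`-close to the well on each part `S` of the wire in which the
density grows away from the well `SO(3) H` and `H` is the boundary value. -/
lemma setIntegral_distWell_le {p C₁ : ℝ} (hp : 1 ≤ p) (hC₁ : 0 < C₁) {H : Mat} {f : Pt → ℝ}
    {F : Pt → Mat} {S T : Set Pt} (hS : MeasurableSet S) (hT : MeasurableSet T)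
    (hF : ∀ i j, AEMeasurable (fun x => F x i j) (volume.restrict S))
    (hf : ∀ x ∈ S, C₁ * min (distWell H (F x) ^ 2) (frobNorm (F x) ^ p + 1) ≤ f x)
    (hout : ∀ᵐ x, x ∈ S → x ∉ T → F x = H) {α δ : ℝ} (hα : 0 < α) (hδ : 0 ≤ δ)
    (hS1 : volume S ≤ 1)
    (hE : ∫⁻ x in T, ENNReal.ofReal (f x) ≤ ENNReal.ofReal δ) :
    ∫ x in S, distWell H (F x) ≤ α + (α⁻¹ + 1 + frobNorm H) / C₁ * δ := by
  set C := (α⁻¹ + 1 + frobNorm H) / C₁ with hC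
  have hK : 0 ≤ frobNorm H := frobNorm_nonneg _
  have hC0 : 0 ≤ C := by positivity
  rw [integral_eq_lintegral_of_nonneg_ae (ae_of_all _ fun x => distWell_nonneg _ _)
    (aemeasurable_distWell hF H).aestronglyMeasurable]
  refine ENNReal.toReal_le_of_le_ofReal (by positivity) ?_
  have hpt : ∀ᵐ x ∂volume.restrict S, ENNReal.ofReal (distWell H (F x)) ≤
      ENNReal.ofReal α + ENNReal.ofReal C * T.indicator (fun x => ENNReal.ofReal (f x)) x := by
    rw [ae_restrict_iff' hS]
    filter_upwards [hout] with x hx hxS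
    by_cases hxT : x ∈ T
    · rw [indicator_of_mem hxT, ← ENNReal.ofReal_mul hC0, ← ENNReal.ofReal_add hα.le]
      · refine ENNReal.ofReal_le_ofReal ((distWell_le_of_growth hp H hα (F x)).trans ?_)
        refine add_le_add le_rfl ?_
        calc _ = C * (C₁ * min (distWell H (F x) ^ 2) (frobNorm (F x) ^ p + 1)) := by
              rw [hC]; field_simp
          _ ≤ C * f x := mul_le_mul_of_nonneg_left (hf x hxS) hC0
      · refine mul_nonneg hC0 (le_trans ?_ (hf x hxS))
        have : 0 ≤ frobNorm (F x) ^ p := Real.rpow_nonneg (frobNorm_nonneg _) _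
        positivity
    · rw [hx hxS hxT, distWell_self, ENNReal.ofReal_zero]
      exact zero_le
  refine (lintegral_mono_ae hpt).trans ?_
  rw [lintegral_add_left measurable_const, lintegral_const_mul' _ _ ENNReal.ofReal_ne_top,
    ENNReal.ofReal_add hα.le (by positivity), ENNReal.ofReal_mul hC0]
  refine add_le_add ?_ (mul_le_mul_right ?_ _)
  · rw [lintegral_const, Measure.restrict_apply_univ]
    exact mul_le_of_le_one_right zero_le hS1
  · refine (lintegral_mono' Measure.restrict_le_self le_rfl).trans ?_
    rwa [lintegral_indicator hT]

/-- Without dislocations, the transition between two wells that prescribe different lengths for a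
tangential direction of the interface has positive cost. -/
theorem exists_le_transitionCost_empty {p C₁ C₂ : ℝ} (hp : 1 ≤ p) (hC₁ : 0 < C₁) {ζ : Fin 3 → ℝ}
    (hζ : ∀ i, 0 < ζ i) {W₁ W₂ : Mat → ℝ} (hW₁ : IsEnergyDensity p C₁ C₂ 1 W₁)
    (hW₂ : IsEnergyDensity p C₁ C₂ (Matrix.diagonal ζ) W₂) {k : Fin 3} (hk : k ≠ 0)
    (hne : ζ k ≠ 1) : ∃ δ, 0 < δ ∧ ENNReal.ofReal δ ≤
      transitionCost p W₁ W₂ 1 (Matrix.diagonal ζ) 1 (DislocationSystem.empty 1) := by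
  obtain ⟨δ, hδ, H⟩ := exists_incompatible_wells (ζ := fun _ => 1) (ζ' := ζ)
    (fun _ => one_pos) hζ hk hne.symm
  rw [Matrix.diagonal_one] at H
  set α := δ / 4 with hα
  have hα0 : 0 < α := by positivity
  set K := frobNorm (1 : Mat) + frobNorm (Matrix.diagonal ζ) with hK
  have hK1 : 0 ≤ frobNorm (1 : Mat) := frobNorm_nonneg _
  have hK2 : 0 ≤ frobNorm (Matrix.diagonal ζ) := frobNorm_nonneg _
  set C := (α⁻¹ + 1 + K) / C₁ with hC
  have hC0 : 0 < C := by positivity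
  refine ⟨δ / (4 * C), by positivity, ?_⟩
  refine le_iInf fun M => le_iInf fun hM => le_iInf fun F => le_iInf fun hF => ?_
  by_contra hcon
  have hE := (not_le.1 hcon).le
  obtain ⟨u, G, hG, hu, hGF⟩ := exists_gradient_approx hp hF.lpLoc hF.curl_eq
    (show 0 < δ / 18 by positivity)
  set B := Metric.ball (0 : Pt) (1 / 2) with hB
  set B' := Metric.closedBall (0 : Pt) (1 / 2) with hB'
  have hBB' : B ⊆ B' := Metric.ball_subset_closedBall
  have hB'c : IsCompact B' := isCompact_closedBall _ _
  have hB'1 : B' ⊆ cylinder 1 :=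
    (Metric.closedBall_subset_closedBall (by norm_num)).trans closedBall_subset_cylinder
  have hFi : ∀ i j, IntegrableOn (fun x => F x i j) B' := fun i j =>
    hF.lpLoc.integrableOn hp hB'c hB'1 i j
  have hvolB : volume B' ≤ 1 := by
    have h := volume_real_closedBall (0 : Pt) (show (0:ℝ) ≤ 1 / 2 by norm_num)
    rw [Measure.real] at h
    rw [← ENNReal.ofReal_toReal hB'c.measure_lt_top.ne, h]
    norm_num
  have hGi : ∀ i j, IntegrableOn (fun x => |G x i j - F x i j|) B' := fun i j =>
    ((integrableOn_compact (hG.matrix_elem i j) hB'c).sub (hFi i j)).abs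
  -- the mollified field inherits the bound for the distance from the well
  have main : ∀ (P : Mat) (S : Set Pt), frobNorm P ≤ K → MeasurableSet S → S ⊆ B' →
      (∀ x ∈ S, C₁ * min (distWell P (F x) ^ 2) (frobNorm (F x) ^ p + 1) ≤
        density W₁ W₂ x (F x)) →
      (∀ᵐ x, x ∈ S → x ∉ slab M 1 → F x = P) → ∫ x in S, distWell P (G x) ≤ δ := by
    intro P S hPK hS hSB hf hout
    have hFS : ∀ i j, IntegrableOn (fun x => F x i j) S := fun i j => (hFi i j).mono_set hSB
    have hGS : ∀ i j, IntegrableOn (fun x => |G x i j - F x i j|) S := fun i j =>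
      (hGi i j).mono_set hSB
    have hPc : ∀ i j, IntegrableOn (fun _ : Pt => P i j) S := fun i j =>
      (integrableOn_compact continuous_const hB'c).mono_set hSB
    have e1 := setIntegral_distWell_le hp hC₁ hS (measurableSet_slab M 1)
      (fun i j => (hFS i j).aemeasurable) hf hout hα0 (δ := δ / (4 * C)) (by positivity)
      ((measure_mono hSB).trans hvolB) hE
    have e2 : (α⁻¹ + 1 + frobNorm P) / C₁ * (δ / (4 * C)) ≤ δ / 4 := by
      calc _ ≤ C * (δ / (4 * C)) := by
            refine mul_le_mul_of_nonneg_right ?_ (by positivity)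
            rw [hC]; gcongr
        _ = δ / 4 := by field_simp
    have hdF : IntegrableOn (fun x => distWell P (F x)) S := by
      refine Integrable.mono' (g := fun x => ∑ i, ∑ j, |F x i j - P i j|)
        (integrable_finsetSum _ fun i _ => integrable_finsetSum _ fun j _ =>
          ((hFS i j).sub (hPc i j)).abs)
        (aemeasurable_distWell (fun i j => (hFS i j).aemeasurable) P).aestronglyMeasurable
        (ae_of_all _ fun x => ?_)
      rw [Real.norm_eq_abs, abs_of_nonneg (distWell_nonneg _ _)]
      exact distWell_le_sum _ _
    have hsum : IntegrableOn (fun x => ∑ i, ∑ j, |G x i j - F x i j|) S :=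
      integrable_finsetSum _ fun i _ => integrable_finsetSum _ fun j _ => hGS i j
    have hdG : IntegrableOn (fun x => distWell P (G x)) S :=
      (integrableOn_compact ((continuous_distWell P).comp hG) hB'c).mono_set hSB
    have e3 : ∫ x in S, ∑ i, ∑ j, |G x i j - F x i j| ≤ δ / 2 := by
      rw [integral_finsetSum _ fun i _ => integrable_finsetSum _ fun j _ => hGS i j]
      have : ∀ i, ∫ x in S, ∑ j, |G x i j - F x i j| ≤ ∑ _j : Fin 3, δ / 18 := fun i => by
        rw [integral_finsetSum _ fun j _ => hGS i j]
        exact Finset.sum_le_sum fun j _ => (setIntegral_mono_set (hGi i j)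
          (ae_of_all _ fun x => abs_nonneg _) hSB.eventuallyLE).trans (hGF i j)
      refine (Finset.sum_le_sum fun i _ => this i).trans (le_of_eq ?_)
      simp; ring
    have e4 : ∫ x in S, distWell P (G x) ≤
        ∫ x in S, (distWell P (F x) + ∑ i, ∑ j, |G x i j - F x i j|) :=
      integral_mono hdG (hdF.add hsum) fun x =>
        (distWell_le_add P (G x) (F x)).trans (add_le_add le_rfl (frobNorm_le_sum _))
    rw [integral_add hdF hsum] at e4
    linarith
  have h0 : Measurable fun x : Pt => x 0 := measurable_pi_apply 0
  have hnull : ∀ a : ℝ, ∀ᵐ x : Pt, x 0 ≠ a := fun a => by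
    have := Measure.pi_hyperplane (fun _ : Fin 3 => (volume : Measure ℝ)) 0 a
    exact measure_eq_zero_iff_ae_notMem.1 this
  refine H u G hG hu (main 1 _ (by linarith) ?_ (inter_subset_left.trans hBB') ?_ ?_)
    (main _ _ (by linarith) ?_ (inter_subset_left.trans hBB') ?_ ?_)
  · exact Metric.isOpen_ball.measurableSet.inter (measurableSet_lt h0 measurable_const)
  · intro x hx
    rw [density, if_pos (show x 0 < 0 from hx.2)]
    exact hW₁.lower_bound _
  · filter_upwards [hF.left, hnull (-M)] with x hx hxM hxS hxT
    have hx1 : x ∈ cylinder 1 := hB'1 (hBB' hxS.1)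
    have hx0 : x 0 < 0 := hxS.2
    refine hx hx1 (lt_of_le_of_ne ?_ hxM)
    by_contra hlt
    exact hxT ⟨not_le.1 hlt, by linarith, hx1⟩
  · exact Metric.isOpen_ball.measurableSet.inter (measurableSet_le measurable_const h0)
  · intro x hx
    rw [density, if_neg (not_lt.2 (show 0 ≤ x 0 from hx.2))]
    exact hW₂.lower_bound _
  · filter_upwards [hF.right, hnull M] with x hx hxM hxS hxT
    have hx1 : x ∈ cylinder 1 := hB'1 (hBB' hxS.1)
    have hx0 : 0 ≤ x 0 := hxS.2
    refine hx hx1 (lt_of_le_of_ne ?_ hxM.symm)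
    by_contra hlt
    exact hxT ⟨by linarith, not_le.1 hlt, hx1⟩

/-! ### The flow of a single source -/

/-- The point with `0`-th coordinate `t`, `j`-th coordinate `y` and remaining coordinate `s`. -/
def slot (j : Fin 3) (t y s : ℝ) : Pt := fun i => if i = 0 then t else if i = j then y else s

@[simp] lemma slot_zero (j : Fin 3) (t y s : ℝ) : slot j t y s 0 = t := by simp [slot]

lemma slot_self {j : Fin 3} (hj : j ≠ 0) (t y s : ℝ) : slot j t y s j = y := by simp [slot, hj]

lemma slot_other {i j : Fin 3} (hi : i ≠ 0) (hij : i ≠ j) (t y s : ℝ) : slot j t y s i = s := by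
  simp [slot, hi, hij]

lemma exists_equiv_slot {j : Fin 3} (hj : j ≠ 0) : ∃ e : (ℝ × ℝ × ℝ) ≃ᵐ Pt,
    MeasurePreserving e ∧ ∀ q, e q = slot j q.2.1 q.2.2 q.1 := by
  obtain ⟨i, h0, h1⟩ : ∃ i : Fin 3, i.succAbove 0 = 0 ∧ i.succAbove 1 = j := by
    fin_cases j
    · exact absurd rfl hj
    · exact ⟨2, rfl, rfl⟩
    · exact ⟨1, rfl, rfl⟩
  have hi0 : i ≠ 0 := fun h => Fin.succAbove_ne i 0 (h0.trans h.symm)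
  have hij : i ≠ j := fun h => Fin.succAbove_ne i 1 (h1.trans h.symm)
  set e1 := MeasurableEquiv.piFinSuccAbove (fun _ : Fin 3 => ℝ) i
  set e2 := (MeasurableEquiv.refl ℝ).prodCongr (MeasurableEquiv.finTwoArrow (α := ℝ))
  have m1 : MeasurePreserving e1 := volume_preserving_piFinSuccAbove (fun _ : Fin 3 => ℝ) i
  have m2 : MeasurePreserving e2 :=
    (MeasurePreserving.id volume).prod (volume_preserving_finTwoArrow ℝ)
  refine ⟨(e1.trans e2).symm, (m2.comp m1).symm (e1.trans e2), fun q => ?_⟩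
  rw [MeasurableEquiv.symm_apply_eq]
  refine Prod.ext ?_ (Prod.ext ?_ ?_)
  · exact (slot_other hi0 hij _ _ _).symm
  · change q.2.1 = slot j q.2.1 q.2.2 q.1 (i.succAbove 0)
    rw [h0, slot_zero]
  · change q.2.2 = slot j q.2.1 q.2.2 q.1 (i.succAbove 1)
    rw [h1, slot_self hj]

/-- The longitudinal component, in the direction of time `t`, of the flow of a point source: the
mass `L` that is emitted by the origin spreads linearly over a segment of length `L` up to time
`1` and is transported straight on from then on. -/
def spread (L t y : ℝ) : ℝ :=
  if 0 < t ∧ -(L * min t 1 / 2) ≤ y ∧ y < L * min t 1 / 2 then (min t 1)⁻¹ else 0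

/-- The transversal component of the flow whose longitudinal component is `spread`. -/
def slope (L t y : ℝ) : ℝ := if t < 1 then spread L t y * (y / t) else 0

lemma spread_nonneg (L t y : ℝ) : 0 ≤ spread L t y := by
  rw [spread]
  split_ifs with h
  · have := lt_min h.1 one_pos
    positivity
  · exact le_rfl

lemma spread_of_nonpos {L t : ℝ} (ht : t ≤ 0) (y : ℝ) : spread L t y = 0 :=
  if_neg fun h => absurd h.1 (not_lt.2 ht)

lemma slope_of_nonpos {L t : ℝ} (ht : t ≤ 0) (y : ℝ) : slope L t y = 0 := by
  simp [slope, spread_of_nonpos ht]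

lemma abs_slope_le {L : ℝ} (hL : 0 ≤ L) (t y : ℝ) : |slope L t y| ≤ L * spread L t y := by
  have h0 := spread_nonneg L t y
  rw [slope]
  split_ifs with h1
  · by_cases h : 0 < t ∧ -(L * min t 1 / 2) ≤ y ∧ y < L * min t 1 / 2
    · obtain ⟨ht, ha, hb⟩ := h
      rw [min_eq_left h1.le] at ha hb
      rw [abs_mul, abs_of_nonneg h0, mul_comm]
      refine mul_le_mul_of_nonneg_right ?_ h0
      rw [abs_div, abs_of_pos ht, div_le_iff₀ ht]
      have : 0 ≤ L * t := by positivity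
      exact abs_le.2 ⟨by linarith, by linarith⟩
    · simp [spread, h]
  · rw [abs_zero]; positivity

lemma measurable_spread (L : ℝ) : Measurable fun q : ℝ × ℝ => spread L q.1 q.2 := by
  have h1 : Measurable fun q : ℝ × ℝ => L * min q.1 1 / 2 := by fun_prop
  exact Measurable.ite ((measurableSet_lt measurable_const measurable_fst).inter
    ((measurableSet_le h1.neg measurable_snd).inter (measurableSet_lt measurable_snd h1)))
    (measurable_fst.min measurable_const).inv measurable_const

lemma measurable_slope (L : ℝ) : Measurable fun q : ℝ × ℝ => slope L q.1 q.2 :=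
  Measurable.ite (measurableSet_lt measurable_fst measurable_const)
    ((measurable_spread L).mul (measurable_snd.div measurable_fst)) measurable_const

lemma measurable_coord_pair (j : Fin 3) (a : ℝ) : Measurable fun x : Pt => (x 0, x j - a) := by
  fun_prop

lemma lintegral_spread_rpow_le {p : ℝ} (hp : 1 ≤ p) {L : ℝ} (hL : 0 ≤ L) (t : ℝ) :
    ∫⁻ y, ENNReal.ofReal (spread L t y ^ p) ≤
      (Ioi 0).indicator (fun t => ENNReal.ofReal (L * (t ^ (1 - p) + 1))) t := by
  by_cases ht : 0 < t
  · rw [indicator_of_mem (show t ∈ Ioi 0 from ht)]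
    set m := min t 1 with hm
    have hm0 : 0 < m := lt_min ht one_pos
    have e : ∀ y, ENNReal.ofReal (spread L t y ^ p) = (Ico (-(L * m / 2)) (L * m / 2)).indicator
        (fun _ => ENNReal.ofReal (m⁻¹ ^ p)) y := fun y => by
      by_cases hy : y ∈ Ico (-(L * m / 2)) (L * m / 2)
      · rw [indicator_of_mem hy, spread, if_pos ⟨ht, hy.1, hy.2⟩]
      · rw [indicator_of_notMem hy, spread, if_neg fun h => hy h.2,
          Real.zero_rpow (by linarith), ENNReal.ofReal_zero]
    simp only [e]
    rw [lintegral_indicator measurableSet_Ico, setLIntegral_const, Real.volume_Ico,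
      ← ENNReal.ofReal_mul (by positivity)]
    refine ENNReal.ofReal_le_ofReal ?_
    have e2 : m⁻¹ ^ p * (L * m / 2 - -(L * m / 2)) = L * m ^ (1 - p) := by
      rw [Real.rpow_sub hm0, Real.rpow_one, Real.inv_rpow hm0.le]
      field_simp
      ring
    rw [e2]
    refine mul_le_mul_of_nonneg_left ?_ hL
    rcases min_choice t 1 with h | h <;> rw [hm, h]
    · linarith
    · rw [Real.one_rpow]
      linarith [Real.rpow_nonneg ht.le (1 - p)]
  · simp only [spread_of_nonpos (not_lt.1 ht), Real.zero_rpow (show p ≠ 0 by linarith)]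
    simp

lemma lintegral_slab_bound_lt_top {p : ℝ} (hp : p < 2) (L T : ℝ) :
    ∫⁻ t in Ioo 0 T, ENNReal.ofReal (L * (t ^ (1 - p) + 1)) < ⊤ := by
  have h : IntegrableOn (fun t : ℝ => L * (t ^ (1 - p) + 1)) (Ioo 0 T) := by
    rcases le_total 0 T with hT | hT
    · have h1 : IntervalIntegrable (fun t : ℝ => t ^ (1 - p)) volume 0 T :=
        intervalIntegral.intervalIntegrable_rpow' (by linarith)
      have h2 := ((h1.add (intervalIntegrable_const (c := (1 : ℝ)))).const_mul L)
      rw [intervalIntegrable_iff_integrableOn_Ioo_of_le hT] at h2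
      exact h2
    · rw [Ioo_eq_empty (not_lt.2 hT)]; exact integrableOn_empty
  exact h.lintegral_lt_top

/-- The `p`-th power of the flow of a source line is integrable up to the source if `p < 2`, with
an integral proportional to the length of the line. -/
lemma setLIntegral_spread_rpow_le {p : ℝ} (hp : 1 ≤ p) {L : ℝ} (hL : 0 ≤ L) {i j : Fin 3}
    (hi : i ≠ 0) (hj : j ≠ 0) (hij : i ≠ j) (a T ρ : ℝ) :
    ∫⁻ x in {x : Pt | x 0 < T ∧ |x i| ≤ ρ}, ENNReal.ofReal (spread L (x 0) (x j - a) ^ p) ≤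
      ENNReal.ofReal (2 * ρ) * ∫⁻ t in Ioo 0 T, ENNReal.ofReal (L * (t ^ (1 - p) + 1)) := by
  obtain ⟨e, he, heq⟩ := exists_equiv_slot hj
  have hmeas : Measurable fun q : ℝ × ℝ => ENNReal.ofReal (spread L q.1 (q.2 - a) ^ p) :=
    (((measurable_spread L).comp (f := fun q : ℝ × ℝ => (q.1, q.2 - a))
      (by fun_prop)).pow_const p).ennreal_ofReal
  have hS : MeasurableSet {x : Pt | x 0 < T ∧ |x i| ≤ ρ} := by
    have h1 : Measurable fun x : Pt => x 0 := measurable_pi_apply 0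
    have h2 : Measurable fun x : Pt => |x i| := by fun_prop
    exact (measurableSet_lt h1 measurable_const).inter (measurableSet_le h2 measurable_const)
  rw [← he.setLIntegral_comp_preimage_emb e.measurableEmbedding]
  have hpre : e ⁻¹' {x : Pt | x 0 < T ∧ |x i| ≤ ρ} = Icc (-ρ) ρ ×ˢ (Iio T ×ˢ univ) := by
    ext q
    simp only [mem_preimage, heq, Set.mem_ofPred_eq, slot_zero, slot_other hi hij, mem_prod,
      mem_Icc, mem_Iio, mem_univ, and_true, abs_le]
    tauto
  rw [hpre, Measure.volume_eq_prod, ← Measure.prod_restrict, Measure.volume_eq_prod,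
    ← Measure.prod_restrict]
  simp only [heq, slot_zero, slot_self hj]
  have hm2 : Measurable fun q : ℝ × ℝ × ℝ =>
      ENNReal.ofReal (spread L q.2.1 (q.2.2 - a) ^ p) := hmeas.comp measurable_snd
  rw [lintegral_prod _ hm2.aemeasurable]
  simp only
  rw [lintegral_const, Measure.restrict_apply_univ, Real.volume_Icc, mul_comm,
    show ρ - -ρ = 2 * ρ by ring]
  refine mul_le_mul_right ?_ _
  rw [lintegral_prod _ hmeas.aemeasurable]
  simp only [Measure.restrict_univ]
  calc ∫⁻ t in Iio T, ∫⁻ y, ENNReal.ofReal (spread L t (y - a) ^ p)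
      ≤ ∫⁻ t in Iio T, (Ioi 0).indicator (fun t => ENNReal.ofReal (L * (t ^ (1 - p) + 1))) t :=
        lintegral_mono fun t => by
          rw [lintegral_sub_right_eq_self (fun y => ENNReal.ofReal (spread L t y ^ p)) a]
          exact lintegral_spread_rpow_le hp hL t
    _ = ∫⁻ t in Ioo 0 T, ENNReal.ofReal (L * (t ^ (1 - p) + 1)) := by
        rw [lintegral_indicator measurableSet_Ioi, Measure.restrict_restrict measurableSet_Ioi]
        rfl

lemma memLp_spread {p : ℝ} (hp : 1 ≤ p) (hp2 : p < 2) {L : ℝ} (hL : 0 ≤ L) {j : Fin 3}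
    (hj : j ≠ 0) (a : ℝ) {K : Set Pt} (hK : IsCompact K) :
    MemLp (fun x : Pt => spread L (x 0) (x j - a)) (ENNReal.ofReal p) (volume.restrict K) := by
  obtain ⟨i, hi, hij⟩ : ∃ i : Fin 3, i ≠ 0 ∧ i ≠ j := by
    fin_cases j
    · exact absurd rfl hj
    · exact ⟨2, by decide, by decide⟩
    · exact ⟨1, by decide, by decide⟩
  obtain ⟨R, hR⟩ := hK.isBounded.subset_closedBall 0
  have hsub : K ⊆ {x : Pt | x 0 < R + 1 ∧ |x i| ≤ R} := fun x hx => by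
    have h := mem_closedBall_zero_iff.1 (hR hx)
    have h0 := (norm_le_pi_norm x 0).trans h
    exact ⟨by linarith [le_abs_self (x 0), Real.norm_eq_abs (x 0)], (norm_le_pi_norm x i).trans h⟩
  have hp0 : 0 < p := by linarith
  have hm : Measurable fun x : Pt => spread L (x 0) (x j - a) :=
    (measurable_spread L).comp (measurable_coord_pair j a)
  refine ⟨hm.aestronglyMeasurable, ?_⟩
  rw [eLpNorm_lt_top_iff_lintegral_rpow_enorm_lt_top (by simpa using hp0) ENNReal.ofReal_ne_top,
    ENNReal.toReal_ofReal hp0.le]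
  have e : ∀ x : Pt, ‖spread L (x 0) (x j - a)‖ₑ ^ p =
      ENNReal.ofReal (spread L (x 0) (x j - a) ^ p) := fun x => by
    rw [Real.enorm_of_nonneg (spread_nonneg _ _ _), ENNReal.ofReal_rpow_of_nonneg
      (spread_nonneg _ _ _) hp0.le]
  simp only [e]
  refine (lintegral_mono_set hsub).trans_lt
    ((setLIntegral_spread_rpow_le hp hL hi hj hij a _ _).trans_lt ?_)
  exact ENNReal.mul_lt_top ENNReal.ofReal_lt_top (lintegral_slab_bound_lt_top hp2 L _)

lemma memLp_slope {p : ℝ} (hp : 1 ≤ p) (hp2 : p < 2) {L : ℝ} (hL : 0 ≤ L) {j : Fin 3}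
    (hj : j ≠ 0) (a : ℝ) {K : Set Pt} (hK : IsCompact K) :
    MemLp (fun x : Pt => slope L (x 0) (x j - a)) (ENNReal.ofReal p) (volume.restrict K) := by
  refine ((memLp_spread hp hp2 hL hj a hK).const_mul L).mono
    ((measurable_slope L).comp (measurable_coord_pair j a)).aestronglyMeasurable
    (ae_of_all _ fun x => ?_)
  rw [Real.norm_eq_abs, Real.norm_of_nonneg (mul_nonneg hL (spread_nonneg _ _ _))]
  exact abs_slope_le hL _ _

/-! ### The divergence of the flow -/

lemma integral_mul_Ico {L a : ℝ} (ha : 0 ≤ L * a) (f h : ℝ → ℝ)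
    (hf : ∀ y, f y = (Ico (-(L * a / 2)) (L * a / 2)).indicator h y) :
    ∫ y, f y = ∫ y in (-(L * a / 2))..(L * a / 2), h y := by
  rw [funext hf, integral_indicator measurableSet_Ico, integral_Ico_eq_integral_Ioc,
    intervalIntegral.integral_of_le (by linarith)]

/-- The divergence of the flow of a source in the plane: its flow lines start at the origin, are
straight up to time `1`, and run parallel to the first axis afterwards. -/
lemma integral_planar_flow {L : ℝ} (hL : 0 ≤ L) {g A B : ℝ → ℝ → ℝ}
    (hA : Continuous (Function.uncurry A)) (hB : Continuous (Function.uncurry B))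
    (hgA : ∀ y t, HasDerivAt (fun t => g t y) (A t y) t)
    (hgAB : ∀ l t, HasDerivAt (fun t => g t (t * l)) (A t (t * l) + l * B t (t * l)) t)
    {R : ℝ} (hR : 1 ≤ R) (hgR : ∀ t y, R ≤ t → g t y = 0 ∧ A t y = 0)
    (hI : Integrable fun q : ℝ × ℝ =>
      spread L q.1 q.2 * A q.1 q.2 + slope L q.1 q.2 * B q.1 q.2) :
    ∫ q : ℝ × ℝ, (spread L q.1 q.2 * A q.1 q.2 + slope L q.1 q.2 * B q.1 q.2) = -(L * g 0 0) := by
  set inner : ℝ → ℝ := fun t => ∫ y, (spread L t y * A t y + slope L t y * B t y) with hinner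
  have hleft : Integrable inner := hI.integral_prod_left
  set a := -(L / 2) with ha
  set b := L / 2 with hb
  have c1 : Continuous fun q : ℝ × ℝ => A q.1 (q.1 * q.2) + q.2 * B q.1 (q.1 * q.2) := by
    have e1 : Continuous fun q : ℝ × ℝ => A q.1 (q.1 * q.2) :=
      hA.comp (f := fun q : ℝ × ℝ => (q.1, q.1 * q.2)) (by fun_prop)
    have e2 : Continuous fun q : ℝ × ℝ => B q.1 (q.1 * q.2) :=
      hB.comp (f := fun q : ℝ × ℝ => (q.1, q.1 * q.2)) (by fun_prop)
    exact e1.add (continuous_snd.mul e2)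
  have h1 : ∀ t ∈ Ioo (0 : ℝ) 1, inner t = ∫ l in a..b, (A t (t * l) + l * B t (t * l)) := by
    intro t ht
    have hLt : 0 ≤ L * t := mul_nonneg hL ht.1.le
    have e := integral_mul_Ico hLt (fun y => spread L t y * A t y + slope L t y * B t y)
      (fun y => t⁻¹ * (A t y + y / t * B t y)) fun y => by
        rw [slope, if_pos ht.2]
        by_cases hy : y ∈ Ico (-(L * t / 2)) (L * t / 2)
        · rw [indicator_of_mem hy, spread, min_eq_left ht.2.le, if_pos ⟨ht.1, hy.1, hy.2⟩]; ring
        · rw [indicator_of_notMem hy, spread, min_eq_left ht.2.le, if_neg fun h => hy h.2]; ring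
    have e2 := intervalIntegral.integral_comp_mul_left (a := a) (b := b)
      (fun y => A t y + y / t * B t y) ht.1.ne'
    simp only [hinner]
    rw [e, intervalIntegral.integral_const_mul]
    rw [show t * a = -(L * t / 2) by rw [ha]; ring, show t * b = L * t / 2 by rw [hb]; ring,
      smul_eq_mul] at e2
    rw [← e2]
    congr 1; ext l
    rw [mul_div_cancel_left₀ _ ht.1.ne']
  have h2 : ∀ t, 1 ≤ t → inner t = ∫ l in a..b, A t l := by
    intro t ht
    have e := integral_mul_Ico (L := L) (a := 1) (by linarith)
      (fun y => spread L t y * A t y + slope L t y * B t y) (A t) fun y => by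
        rw [slope, if_neg (not_lt.2 ht)]
        by_cases hy : y ∈ Ico (-(L * 1 / 2)) (L * 1 / 2)
        · rw [indicator_of_mem hy, spread, min_eq_right ht, if_pos ⟨by linarith, hy.1, hy.2⟩]; ring
        · rw [indicator_of_notMem hy, spread, min_eq_right ht, if_neg fun h => hy h.2]; ring
    rw [mul_one] at e
    exact e
  have hsupp : Function.support inner ⊆ Ioc 0 R := by
    intro t ht
    by_contra h
    apply ht
    rw [mem_Ioc, not_and_or, not_lt, not_le] at h
    rcases h with h | h
    · simp [hinner, spread_of_nonpos h, slope_of_nonpos h]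
    · rw [h2 t (by linarith)]
      simp [fun l => (hgR t l h.le).2]
  have f1 : ∫ t in (0:ℝ)..1, inner t = ∫ l in a..b, (g 1 l - g 0 0) := by
    calc ∫ t in (0:ℝ)..1, inner t
        = ∫ t in (0:ℝ)..1, ∫ l in a..b, (A t (t * l) + l * B t (t * l)) := by
          simp only [intervalIntegral.integral_of_le zero_le_one, integral_Ioc_eq_integral_Ioo]
          exact setIntegral_congr_fun measurableSet_Ioo h1
      _ = ∫ l in a..b, ∫ t in (0:ℝ)..1, (A t (t * l) + l * B t (t * l)) := by
          refine intervalIntegral_intervalIntegral_swap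
            (F := fun t l => A t (t * l) + l * B t (t * l)) ?_
          exact (c1.continuousOn.integrableOn_compact (isCompact_uIcc.prod isCompact_uIcc)).mono_set
            (prod_mono uIoc_subset_uIcc uIoc_subset_uIcc)
      _ = _ := by
          congr 1; ext l
          have hc : Continuous fun t => A t (t * l) + l * B t (t * l) :=
            c1.comp (f := fun t : ℝ => (t, l)) (by fun_prop)
          rw [intervalIntegral.integral_eq_sub_of_hasDerivAt (fun t _ => hgAB l t)
            (hc.intervalIntegrable _ _), one_mul, zero_mul]
  have f2 : ∫ t in (1:ℝ)..R, inner t = ∫ l in a..b, -g 1 l := by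
    calc ∫ t in (1:ℝ)..R, inner t = ∫ t in (1:ℝ)..R, ∫ l in a..b, A t l := by
          refine intervalIntegral.integral_congr fun t ht => h2 t ?_
          rw [uIcc_of_le hR] at ht
          exact ht.1
      _ = ∫ l in a..b, ∫ t in (1:ℝ)..R, A t l := by
          refine intervalIntegral_intervalIntegral_swap (F := A) ?_
          exact (hA.continuousOn.integrableOn_compact (isCompact_uIcc.prod isCompact_uIcc)).mono_set
            (prod_mono uIoc_subset_uIcc uIoc_subset_uIcc)
      _ = _ := by
          congr 1; ext l
          have hc : Continuous fun t => A t l := hA.comp (f := fun t : ℝ => (t, l)) (by fun_prop)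
          rw [intervalIntegral.integral_eq_sub_of_hasDerivAt (fun t _ => hgA l t)
            (hc.intervalIntegrable _ _), (hgR R l le_rfl).1, zero_sub]
  have hg1 : Continuous fun l => g 1 l := by
    have e : (fun l => g 1 l) = fun l => -∫ t in (1:ℝ)..R, A t l := by
      ext l
      have hc : Continuous fun t => A t l := hA.comp (f := fun t : ℝ => (t, l)) (by fun_prop)
      rw [intervalIntegral.integral_eq_sub_of_hasDerivAt (fun t _ => hgA l t)
        (hc.intervalIntegrable _ _), (hgR R l le_rfl).1]
      ring
    rw [e]
    exact (intervalIntegral.continuous_parametric_intervalIntegral_of_continuous'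
      (f := fun l t => A t l) (hA.comp continuous_swap) 1 R).neg
  have hadd : (∫ l in a..b, (g 1 l - g 0 0)) + ∫ l in a..b, -g 1 l =
      ∫ l in a..b, (g 1 l - g 0 0 + -g 1 l) :=
    (intervalIntegral.integral_add ((hg1.sub continuous_const).intervalIntegrable _ _)
      (hg1.neg.intervalIntegrable _ _)).symm
  rw [Measure.volume_eq_prod, integral_prod _ hI]
  change ∫ t, inner t = _
  rw [← intervalIntegral.integral_eq_integral_of_support_subset hsupp,
    ← intervalIntegral.integral_add_adjacent_intervals (b := 1) hleft.intervalIntegrable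
      hleft.intervalIntegrable, f1, f2,
    hadd]
  simp only [show ∀ l, g 1 l - g 0 0 + -g 1 l = -g 0 0 from fun l => by ring]
  rw [intervalIntegral.integral_const, ha, hb, smul_eq_mul]
  ring

lemma locallyIntegrable_spread {L : ℝ} (hL : 0 ≤ L) {j : Fin 3} (hj : j ≠ 0) (a : ℝ) :
    LocallyIntegrable fun x : Pt => spread L (x 0) (x j - a) :=
  locallyIntegrable_iff.2 fun K hK => by
    have := memLp_spread le_rfl one_lt_two hL hj a hK
    rwa [ENNReal.ofReal_one, memLp_one_iff_integrable] at this

lemma locallyIntegrable_slope {L : ℝ} (hL : 0 ≤ L) {j : Fin 3} (hj : j ≠ 0) (a : ℝ) :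
    LocallyIntegrable fun x : Pt => slope L (x 0) (x j - a) :=
  locallyIntegrable_iff.2 fun K hK => by
    have := memLp_slope le_rfl one_lt_two hL hj a hK
    rwa [ENNReal.ofReal_one, memLp_one_iff_integrable] at this

lemma continuous_slot (j : Fin 3) : Continuous fun q : ℝ × ℝ × ℝ => slot j q.2.1 q.2.2 q.1 :=
  continuous_pi fun i => by
    unfold slot
    split_ifs <;> fun_prop

lemma hasCompactSupport_pd {ψ : Pt → ℝ} (hc : HasCompactSupport ψ) (j : Fin 3) :
    HasCompactSupport (pd j ψ) := hc.fderiv_apply (𝕜 := ℝ) (axis j)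

/-- The divergence of the flow of a source line. -/
theorem integral_flow {L : ℝ} (hL : 0 ≤ L) {j : Fin 3} (hj : j ≠ 0) (a : ℝ) {ψ : Pt → ℝ}
    (hψ : ContDiff ℝ ∞ ψ) (hc : HasCompactSupport ψ) :
    ∫ x : Pt, (spread L (x 0) (x j - a) * pd 0 ψ x + slope L (x 0) (x j - a) * pd j ψ x) =
      -(L * ∫ s, ψ (slot j 0 a s)) := by
  have hcont : ∀ k, Continuous (pd k ψ) := fun k => (contDiff_pd hψ k).continuous
  have hG : Integrable fun x : Pt =>
      spread L (x 0) (x j - a) * pd 0 ψ x + slope L (x 0) (x j - a) * pd j ψ x :=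
    ((locallyIntegrable_spread hL hj a).integrable_smul_right_of_hasCompactSupport (hcont 0)
      (hasCompactSupport_pd hc 0)).add
    ((locallyIntegrable_slope hL hj a).integrable_smul_right_of_hasCompactSupport (hcont j)
      (hasCompactSupport_pd hc j))
  -- coordinates in which the source line is the last axis
  obtain ⟨e, he, heq⟩ := exists_equiv_slot hj
  set τ : ℝ × ℝ × ℝ → Pt := fun q => slot j q.2.1 (q.2.2 + a) q.1 with hτ
  have hτm : MeasurePreserving τ ∧ MeasurableEmbedding τ := by
    have ht : MeasurePreserving (fun x : Pt => x + a • axis j) :=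
      measurePreserving_add_right volume _
    have h2 : τ = (fun x : Pt => x + a • axis j) ∘ e := by
      ext q i
      by_cases h0 : i = 0
      · subst h0; simp [hτ, heq, hj.symm]
      · by_cases h1 : i = j
        · subst h1; simp [hτ, heq, slot, h0]
        · simp [hτ, heq, slot, h0, h1]
    rw [h2]
    exact ⟨ht.comp he, (measurableEmbedding_addRight _).comp e.measurableEmbedding⟩
  have hτc : Continuous τ :=
    (continuous_slot j).comp (f := fun q : ℝ × ℝ × ℝ => (q.1, q.2.1, q.2.2 + a)) (by fun_prop)
  rw [← hτm.1.integral_comp hτm.2]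
  have hG' := (hτm.1.integrable_comp_emb hτm.2).2 hG
  simp only [Function.comp_def, hτ, slot_zero, slot_self hj, add_sub_cancel_right] at hG' ⊢
  rw [Measure.volume_eq_prod, integral_prod _ hG']
  obtain ⟨R₀, hR₀⟩ := hc.isCompact.isBounded.subset_closedBall 0
  set R := max 1 (R₀ + 1) with hR
  have hout : ∀ x : Pt, R ≤ x 0 → x ∉ tsupport ψ := fun x hx h => by
    have h1 := (norm_le_pi_norm x 0).trans (mem_closedBall_zero_iff.1 (hR₀ h))
    have h2 : R₀ + 1 ≤ R := le_max_right _ _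
    linarith [le_abs_self (x 0), Real.norm_eq_abs (x 0)]
  have hfib : ∀ᵐ s : ℝ, ∫ q : ℝ × ℝ, (spread L q.1 q.2 * pd 0 ψ (slot j q.1 (q.2 + a) s) +
      slope L q.1 q.2 * pd j ψ (slot j q.1 (q.2 + a) s)) = -(L * ψ (slot j 0 a s)) := by
    filter_upwards [hG'.prod_right_ae] with s hs
    have hline : ∀ (y l t : ℝ), HasDerivAt (fun t => ψ (slot j t (y + t * l + a) s))
        (pd 0 ψ (slot j t (y + t * l + a) s) + l * pd j ψ (slot j t (y + t * l + a) s)) t := by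
      intro y l t
      have e1 : ∀ t, slot j t (y + t * l + a) s =
          slot j 0 (y + a) s + t • (axis 0 + l • axis j) := fun t => by
        ext i
        by_cases h0 : i = 0
        · subst h0; simp [hj.symm]
        · by_cases h1 : i = j
          · subst h1
            simp [slot, h0]; ring
          · simp [slot, h0, h1]
      have e2 : HasDerivAt (fun t : ℝ => slot j 0 (y + a) s + t • (axis 0 + l • axis j))
          (axis 0 + l • axis j) t := by
        simpa using ((hasDerivAt_id t).smul_const (axis 0 + l • axis j)).const_add
          (slot j 0 (y + a) s)
      have e3 := (hψ.differentiable (by simp)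
        (slot j 0 (y + a) s + t • (axis 0 + l • axis j))).hasFDerivAt.comp_hasDerivAt t e2
      rw [map_add, map_smul, smul_eq_mul] at e3
      simp only [e1]
      exact e3
    have hcs : ∀ k, Continuous (Function.uncurry fun t y => pd k ψ (slot j t (y + a) s)) := fun k =>
      (hcont k).comp (f := fun q : ℝ × ℝ => slot j q.1 (q.2 + a) s)
        ((continuous_slot j).comp (f := fun q : ℝ × ℝ => (s, q.1, q.2 + a)) (by fun_prop))
    have h := integral_planar_flow hL (g := fun t y => ψ (slot j t (y + a) s)) (hcs 0) (hcs j)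
      (fun y t => by simpa using hline y 0 t) (fun l t => by simpa using hline 0 l t)
      (R := R) (le_max_left _ _) (fun t y ht => by
        have hx := hout (slot j t (y + a) s) (by simpa using ht)
        refine ⟨image_eq_zero_of_notMem_tsupport hx, ?_⟩
        rw [pd, image_eq_zero_of_notMem_tsupport fun h => hx (tsupport_fderiv_subset ℝ h)]
        rfl) hs
    simpa using h
  rw [integral_congr_ae hfib, integral_neg, integral_const_mul]

/-- A field that does not depend on the `i`-th coordinate has no distributional derivative in that
direction. -/
lemma integral_mul_pd_eq_zero_of_invariant {f ψ : Pt → ℝ} {i : Fin 3}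
    (hinv : ∀ x (s : ℝ), f (x + s • axis i) = f x) (hf : LocallyIntegrable f)
    (hψ : ContDiff ℝ ∞ ψ) (hc : HasCompactSupport ψ) : ∫ x, f x * pd i ψ x = 0 := by
  have h := integral_bilinear_hasLineDerivAt_right_eq_neg_left_of_integrable
    (μ := (volume : Measure Pt)) (f := f) (f' := fun _ => 0) (g := ψ) (g' := pd i ψ) (v := axis i)
    (B := ContinuousLinearMap.mul ℝ ℝ) (by simp)
    (hf.integrable_smul_right_of_hasCompactSupport (contDiff_pd hψ i).continuous
      (hasCompactSupport_pd hc i))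
    (hf.integrable_smul_right_of_hasCompactSupport hψ.continuous hc)
    (fun x _ => by
      unfold HasLineDerivAt
      simp only [hinv]
      exact hasDerivAt_const _ _)
    (fun x _ => (hψ.differentiable (by simp) x).hasFDerivAt.hasLineDerivAt _)
  simpa using h

/-! ### Systems of parallel dislocations -/

/-- The parametrized segment of half-length `h` in the interface on which the `j`-th coordinate
is `a`. -/
def chord (j : Fin 2) (a h t : ℝ) : Fin 2 → ℝ := fun i => if i = j then a else h * (2 * t - 1)

lemma exists_ne_fin_two (j : Fin 2) : ∃ i, i ≠ j ∧ ∀ f : Fin 2 → ℝ, f 0 + f 1 = f j + f i := by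
  fin_cases j
  · exact ⟨1, by decide, fun f => rfl⟩
  · exact ⟨0, by decide, fun f => add_comm _ _⟩

lemma isDislocationLine_chord (j : Fin 2) {a h r : ℝ} (hh : 0 < h) (hr : a ^ 2 + h ^ 2 = r ^ 2) :
    IsDislocationLine r (chord j a h) := by
  obtain ⟨i, hij, hsum⟩ := exists_ne_fin_two j
  have hsq : ∀ t, chord j a h t 0 ^ 2 + chord j a h t 1 ^ 2 = a ^ 2 + (h * (2 * t - 1)) ^ 2 :=
    fun t => by
      rw [hsum fun k => chord j a h t k ^ 2]
      simp [chord, hij]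
  refine ⟨⟨(2 * h).toNNReal, ?_⟩, ?_, ?_, Or.inr ⟨?_, ?_⟩⟩
  · refine (LipschitzWith.of_dist_le_mul fun s t => ?_).lipschitzOnWith
    rw [Real.coe_toNNReal _ (by positivity), dist_pi_le_iff (by positivity)]
    intro k
    simp only [chord, Real.dist_eq]
    split_ifs
    · rw [sub_self, abs_zero]; positivity
    · rw [show h * (2 * s - 1) - h * (2 * t - 1) = 2 * h * (s - t) by ring, abs_mul,
        abs_of_pos (by positivity : 0 < 2 * h)]
  · intro s _ t _ hst
    have h1 := congrFun hst i
    simp only [chord, if_neg hij] at h1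
    have := mul_left_cancel₀ hh.ne' h1
    linarith
  · intro t ht
    simp only [disk, Set.mem_ofPred_eq]
    rw [hsq, ← hr]
    have h0 : 0 < t := ht.1
    have h1 : t < 1 := ht.2
    have h2 : (h * (2 * t - 1)) ^ 2 = h ^ 2 - 4 * h ^ 2 * (t * (1 - t)) := by ring
    have h3 : 0 < 4 * h ^ 2 * (t * (1 - t)) := by
      have : 0 < 1 - t := by linarith
      positivity
    linarith
  · simp only [circle, Set.mem_ofPred_eq]
    rw [hsq, ← hr]; ring
  · simp only [circle, Set.mem_ofPred_eq]
    rw [hsq, ← hr]; ring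

lemma finite_inter_chord {i j : Fin 2} {a b h k : ℝ} (hne : i = j → a ≠ b) :
    (chord i a h '' Icc 0 1 ∩ chord j b k '' Icc 0 1).Finite := by
  have h1 : ∀ y ∈ chord i a h '' Icc 0 1 ∩ chord j b k '' Icc 0 1, y i = a ∧ y j = b := by
    rintro y ⟨⟨s, _, hs⟩, ⟨t, _, ht⟩⟩
    exact ⟨by rw [← hs]; simp [chord], by rw [← ht]; simp [chord]⟩
  refine Set.Subsingleton.finite fun y hy z hz => ?_
  obtain ⟨y1, y2⟩ := h1 y hy
  obtain ⟨z1, z2⟩ := h1 z hz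
  have hij : i ≠ j := fun hij => hne hij (by rw [← y1, ← y2, hij])
  ext l
  obtain rfl | rfl : l = i ∨ l = j := by omega
  · rw [y1, z1]
  · rw [y2, z2]

/-- A finite family of chords of the disk `S_r`, parallel to the coordinate axes. On the
chord `(j, k) ∈ S` the `j`-th coordinate is `a j k`, and its Burgers vector is `b j`. -/
def chordSystem (r : ℝ) (S : Finset (Fin 2 × ℕ)) (a : Fin 2 → ℕ → ℝ)
    (ha : ∀ j, Function.Injective (a j)) (hS : ∀ q ∈ S, a q.1 q.2 ^ 2 < r ^ 2)
    (b : Fin 2 → Fin 3 → ℝ) (hb : ∀ q ∈ S, ∑ i, b q.1 i ^ 2 = 1) : DislocationSystem r where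
  num := S.card
  line := fun m => chord (S.equivFin.symm m).1.1 (a (S.equivFin.symm m).1.1 (S.equivFin.symm m).1.2)
    √(r ^ 2 - a (S.equivFin.symm m).1.1 (S.equivFin.symm m).1.2 ^ 2)
  burgers := fun m => b (S.equivFin.symm m).1.1
  isLine := fun m => by
    have h := hS _ (S.equivFin.symm m).2
    refine isDislocationLine_chord _ (Real.sqrt_pos.2 (by linarith)) ?_
    rw [Real.sq_sqrt (by linarith)]; ring
  burgers_unit := fun m => hb _ (S.equivFin.symm m).2
  finite_inter := fun m n hmn => by
    refine finite_inter_chord fun hij hab => hmn ?_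
    rw [← hij] at hab
    exact S.equivFin.symm.injective (Subtype.ext (Prod.ext hij (ha _ hab)))

lemma sum_chordSystem {r : ℝ} {S : Finset (Fin 2 × ℕ)} {a : Fin 2 → ℕ → ℝ}
    (ha : ∀ j, Function.Injective (a j)) (hS : ∀ q ∈ S, a q.1 q.2 ^ 2 < r ^ 2)
    {b : Fin 2 → Fin 3 → ℝ} (hb : ∀ q ∈ S, ∑ i, b q.1 i ^ 2 = 1) (φ : Pt → Pt) (i : Fin 3) :
    ∑ m, (chordSystem r S a ha hS b hb).burgers m i *
        lineIntegral ((chordSystem r S a ha hS b hb).line m) φ =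
      ∑ q ∈ S, b q.1 i * lineIntegral (chord q.1 (a q.1 q.2) √(r ^ 2 - a q.1 q.2 ^ 2)) φ := by
  rw [← Finset.sum_coe_sort S]
  exact Equiv.sum_comp S.equivFin.symm fun q : S =>
    b q.1.1 i * lineIntegral (chord q.1.1 (a q.1.1 q.1.2) √(r ^ 2 - a q.1.1 q.1.2 ^ 2)) φ

lemma IsTestField.eq_zero {r : ℝ} {φ : Pt → Pt} (hφ : IsTestField r φ) {x : Pt}
    (hx : x ∉ cylinder r) : φ x = 0 := image_eq_zero_of_notMem_tsupport fun h => hx (hφ.support h)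

lemma slot_succ_mem_cylinder (j : Fin 2) {r a s t : ℝ} :
    slot j.succ t a s ∈ cylinder r ↔ a ^ 2 + s ^ 2 < r ^ 2 := by
  fin_cases j
  · simp [cylinder, slot]
  · simp [cylinder, slot, add_comm]

lemma lineIntegral_chord {r : ℝ} {φ : Pt → Pt} (hφ : IsTestField r φ) (j : Fin 2) {o : Fin 3}
    (ho : o ≠ 0) (hoj : o ≠ j.succ) {a h : ℝ} (hh : 0 < h) (hr : a ^ 2 + h ^ 2 = r ^ 2) :
    lineIntegral (chord j a h) φ = ∫ s, φ (slot j.succ 0 a s) o := by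
  have hpos : ∀ t, onInterface (chord j a h t) = slot j.succ 0 a (h * (2 * t - 1)) := fun t => by
    ext i
    fin_cases i <;> fin_cases j <;> simp [onInterface, chord, slot]
  have hder : ∀ t, deriv (chord j a h) t = fun i => if i = j then 0 else 2 * h := fun t => by
    refine HasDerivAt.deriv (hasDerivAt_pi.2 fun i => ?_)
    simp only [chord]
    split_ifs
    · exact hasDerivAt_const _ _
    · have := (((hasDerivAt_id t).const_mul 2).sub_const 1).const_mul h
      simp only [id, mul_one] at this
      rwa [mul_comm] at this
  have hsum : ∀ t, ∑ i, φ (onInterface (chord j a h t)) i * onInterface (deriv (chord j a h) t) i =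
      2 * h * φ (slot j.succ 0 a (2 * h * t - h)) o := fun t => by
    rw [hder, hpos, show h * (2 * t - 1) = 2 * h * t - h by ring]
    fin_cases j <;> fin_cases o
    all_goals first
      | exact absurd rfl ho
      | exact absurd rfl hoj
      | (simp [Fin.sum_univ_three, onInterface]; ring)
  have hsupp : Function.support (fun s => φ (slot j.succ 0 a s) o) ⊆ Ioc (-h) h := by
    intro s hs
    have h1 : slot j.succ 0 a s ∈ cylinder r := by
      by_contra hx
      exact hs (by simp only [hφ.eq_zero hx, Pi.zero_apply])
    rw [slot_succ_mem_cylinder, ← hr] at h1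
    have h2 := abs_lt_of_sq_lt_sq (show s ^ 2 < h ^ 2 by linarith) hh.le
    exact ⟨(abs_lt.1 h2).1, (abs_lt.1 h2).2.le⟩
  rw [lineIntegral]
  simp only [hsum]
  rw [intervalIntegral.integral_const_mul, ← smul_eq_mul,
    intervalIntegral.smul_integral_comp_mul_sub (fun s => φ (slot j.succ 0 a s) o),
    show 2 * h * 0 - h = -h by ring, show 2 * h * 1 - h = h by ring,
    intervalIntegral.integral_eq_integral_of_support_subset hsupp]

/-! ### The transition with misfit dislocations -/

/-- The distance between neighbouring dislocations that accommodates the misfit `z - 1` between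
the lengths `1` and `z`. Without misfit no dislocations are needed and the value is irrelevant. -/
def gap (z : ℝ) : ℝ := if z = 1 then 1 else |z - 1|⁻¹

lemma gap_pos (z : ℝ) : 0 < gap z := by
  rw [gap]
  split_ifs with h
  · exact one_pos
  · exact inv_pos.2 (abs_pos.2 (sub_ne_zero.2 h))

lemma mul_gap (z : ℝ) : (z - 1) * gap z = Real.sign (z - 1) := by
  rcases lt_trichotomy (z - 1) 0 with h | h | h
  · rw [Real.sign_of_neg h, gap, if_neg (by linarith), abs_of_neg h]
    have := h.ne
    rw [inv_neg, mul_neg, mul_inv_cancel₀ this]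
  · rw [h, Real.sign_zero, zero_mul]
  · rw [Real.sign_of_pos h, gap, if_neg (by linarith), abs_of_pos h]
    field_simp

lemma abs_mul_gap_le (z : ℝ) : |z - 1| * gap z ≤ 1 := by
  rw [← abs_of_pos (gap_pos z), ← abs_mul, mul_gap]
  rcases Real.sign_apply_eq (z - 1) with h | h | h <;> simp [h]

/-- The position of the `k`-th of `2 N + 1` sources with distance `L`, centred at `0`. -/
def source (L : ℝ) (N k : ℕ) : ℝ := ((k : ℝ) - N) * L

lemma source_injective {L : ℝ} (hL : L ≠ 0) (N : ℕ) : Function.Injective (source L N) := by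
  intro k l h
  have h1 := mul_right_cancel₀ hL h
  exact_mod_cast sub_left_injective h1

/-- The diagonal entry of the field: the constant `1`, corrected by the flow from sources of
strength `z - 1`. -/
def longitudinal (z : ℝ) (N : ℕ) (t y : ℝ) : ℝ :=
  1 + (z - 1) * ∑ k ∈ Finset.range (2 * N + 1), spread (gap z) t (y - source (gap z) N k)

/-- The off-diagonal entry of the field that belongs to `longitudinal`. -/
def transversal (z : ℝ) (N : ℕ) (t y : ℝ) : ℝ :=
  -(z - 1) * ∑ k ∈ Finset.range (2 * N + 1), slope (gap z) t (y - source (gap z) N k)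

/-- After unit time the cells around the sources tile the wire. -/
lemma sum_spread {L : ℝ} {N : ℕ} {t y : ℝ} (hL : 0 < L) (ht : 1 ≤ t) (hy : |y| ≤ N * L) :
    ∑ k ∈ Finset.range (2 * N + 1), spread L t (y - source L N k) = 1 := by
  set H : ℕ → ℝ := fun k => if source L N k - L / 2 ≤ y then 1 else 0 with hH
  have hs : ∀ k, source L N (k + 1) = source L N k + L := fun k => by
    simp only [source]; push_cast; ring
  have e : ∀ k, spread L t (y - source L N k) = H k - H (k + 1) := by
    intro k
    simp only [spread, hH, min_eq_right ht, mul_one, inv_one, hs]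
    by_cases h1 : source L N k - L / 2 ≤ y
    · by_cases h2 : source L N k + L - L / 2 ≤ y
      · rw [if_neg (fun h => by linarith [h.2.2]), if_pos h1, if_pos h2, sub_self]
      · rw [if_pos ⟨by linarith, by linarith, by linarith⟩, if_pos h1, if_neg h2, sub_zero]
    · rw [if_neg (fun h => h1 (by linarith [h.2.1])), if_neg h1, if_neg (by linarith), sub_zero]
  have hy' := abs_le.1 hy
  have h0 : H 0 = 1 := if_pos (by simp only [source]; push_cast; linarith)
  have h1 : H (2 * N + 1) = 0 := if_neg (by simp only [source]; push_cast; linarith)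
  rw [Finset.sum_congr rfl fun k _ => e k, Finset.sum_range_sub', h0, h1, sub_zero]

lemma longitudinal_of_nonpos (z : ℝ) (N : ℕ) {t : ℝ} (ht : t ≤ 0) (y : ℝ) :
    longitudinal z N t y = 1 := by
  simp [longitudinal, spread_of_nonpos ht]

lemma transversal_of_nonpos (z : ℝ) (N : ℕ) {t : ℝ} (ht : t ≤ 0) (y : ℝ) :
    transversal z N t y = 0 := by
  simp [transversal, slope_of_nonpos ht]

lemma longitudinal_of_one_le (z : ℝ) {N : ℕ} {t y : ℝ} (ht : 1 ≤ t) (hy : |y| ≤ N * gap z) :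
    longitudinal z N t y = z := by
  rw [longitudinal, sum_spread (gap_pos z) ht hy]; ring

lemma transversal_of_one_le (z : ℝ) (N : ℕ) {t : ℝ} (ht : 1 ≤ t) (y : ℝ) :
    transversal z N t y = 0 := by
  simp [transversal, slope, not_lt.2 ht]

section Flow

variable {p : ℝ} {j : Fin 3} {K : Set Pt}

lemma memLp_const_of_isCompact (hK : IsCompact K) (c : ℝ) (q : ℝ≥0∞) :
    MemLp (fun _ : Pt => c) q (volume.restrict K) := by
  have : IsFiniteMeasure (volume.restrict K) := ⟨by simpa using hK.measure_lt_top⟩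
  exact memLp_const c

lemma memLp_longitudinal (hp : 1 ≤ p) (hp2 : p < 2) (hj : j ≠ 0) (z : ℝ) (N : ℕ)
    (hK : IsCompact K) :
    MemLp (fun x : Pt => longitudinal z N (x 0) (x j)) (ENNReal.ofReal p) (volume.restrict K) :=
  (memLp_const_of_isCompact hK 1 _).add ((memLp_finsetSum _ fun k _ =>
    memLp_spread hp hp2 (gap_pos z).le hj (source (gap z) N k) hK).const_mul (z - 1))

lemma memLp_transversal (hp : 1 ≤ p) (hp2 : p < 2) (hj : j ≠ 0) (z : ℝ) (N : ℕ)
    (hK : IsCompact K) :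
    MemLp (fun x : Pt => transversal z N (x 0) (x j)) (ENNReal.ofReal p) (volume.restrict K) :=
  (memLp_finsetSum _ fun k _ =>
    memLp_slope hp hp2 (gap_pos z).le hj (source (gap z) N k) hK).const_mul (-(z - 1))

lemma locallyIntegrable_longitudinal (hj : j ≠ 0) (z : ℝ) (N : ℕ) :
    LocallyIntegrable fun x : Pt => longitudinal z N (x 0) (x j) :=
  locallyIntegrable_iff.2 fun K hK => by
    have := memLp_longitudinal le_rfl one_lt_two hj z N hK
    rwa [ENNReal.ofReal_one, memLp_one_iff_integrable] at this

lemma locallyIntegrable_transversal (hj : j ≠ 0) (z : ℝ) (N : ℕ) :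
    LocallyIntegrable fun x : Pt => transversal z N (x 0) (x j) :=
  locallyIntegrable_iff.2 fun K hK => by
    have := memLp_transversal le_rfl one_lt_two hj z N hK
    rwa [ENNReal.ofReal_one, memLp_one_iff_integrable] at this

variable {ψ : Pt → ℝ}

lemma integrable_mul_pd {f : Pt → ℝ} (hf : LocallyIntegrable f) (hψ : ContDiff ℝ ∞ ψ)
    (hc : HasCompactSupport ψ) (k : Fin 3) : Integrable fun x => f x * pd k ψ x :=
  hf.integrable_smul_right_of_hasCompactSupport (contDiff_pd hψ k).continuous
    (hasCompactSupport_pd hc k)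

/-- The curl of a row of the field: each source contributes a line of strength `± 1`. -/
lemma integral_row (hj : j ≠ 0) (z : ℝ) (N : ℕ) (hψ : ContDiff ℝ ∞ ψ) (hc : HasCompactSupport ψ) :
    ∫ x : Pt, (longitudinal z N (x 0) (x j) * pd 0 ψ x -
        transversal z N (x 0) (x j) * pd j ψ x) =
      -(Real.sign (z - 1) * ∑ k ∈ Finset.range (2 * N + 1),
        ∫ s, ψ (slot j 0 (source (gap z) N k) s)) := by
  have hL := (gap_pos z).le
  have e : ∀ x : Pt, longitudinal z N (x 0) (x j) * pd 0 ψ x -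
      transversal z N (x 0) (x j) * pd j ψ x = pd 0 ψ x + (z - 1) *
        ∑ k ∈ Finset.range (2 * N + 1),
          (spread (gap z) (x 0) (x j - source (gap z) N k) * pd 0 ψ x +
            slope (gap z) (x 0) (x j - source (gap z) N k) * pd j ψ x) := fun x => by
    rw [longitudinal, transversal, Finset.sum_add_distrib, ← Finset.sum_mul, ← Finset.sum_mul]
    ring
  have hI : ∀ k, Integrable fun x : Pt =>
      spread (gap z) (x 0) (x j - source (gap z) N k) * pd 0 ψ x +
        slope (gap z) (x 0) (x j - source (gap z) N k) * pd j ψ x := fun k =>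
    (integrable_mul_pd (locallyIntegrable_spread hL hj _) hψ hc 0).add
      (integrable_mul_pd (locallyIntegrable_slope hL hj _) hψ hc j)
  have h0 : Integrable (pd 0 ψ) :=
    (contDiff_pd hψ 0).continuous.integrable_of_hasCompactSupport (hasCompactSupport_pd hc 0)
  simp only [e]
  rw [integral_add h0 ((integrable_finsetSum _ fun k _ => hI k).const_mul _),
    integral_pd_eq_zero (hψ.of_le (by simp)) hc, integral_const_mul,
    integral_finsetSum _ fun k _ => hI k, zero_add]
  simp only [integral_flow hL hj _ hψ hc]
  rw [Finset.sum_neg_distrib, ← Finset.mul_sum, mul_neg, ← mul_assoc, mul_gap]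

end Flow

/-- The field that makes the transition from the identity to `diag ζ` by `2 N + 1` dislocations for
each of the two tangential directions of the interface. -/
def misfitField (ζ : Fin 3 → ℝ) (N : ℕ) (x : Pt) : Mat :=
  !![if x 0 < 0 then 1 else ζ 0, 0, 0;
    transversal (ζ 1) N (x 0) (x 1), longitudinal (ζ 1) N (x 0) (x 1), 0;
    transversal (ζ 2) N (x 0) (x 2), 0, longitudinal (ζ 2) N (x 0) (x 2)]

lemma misfitField_of_neg (ζ : Fin 3 → ℝ) (N : ℕ) {x : Pt} (hx : x 0 < 0) :
    misfitField ζ N x = 1 := by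
  ext i j
  fin_cases i <;> fin_cases j <;>
    simp [misfitField, hx, longitudinal_of_nonpos _ _ hx.le, transversal_of_nonpos _ _ hx.le]

lemma abs_le_of_mem_cylinder {r : ℝ} (hr : 0 ≤ r) {x : Pt} (hx : x ∈ cylinder r) {j : Fin 3}
    (hj : j ≠ 0) : |x j| ≤ r := by
  have hx' : x 1 ^ 2 + x 2 ^ 2 < r ^ 2 := hx
  refine abs_le_of_sq_le_sq ?_ hr
  fin_cases j
  · exact absurd rfl hj
  · change x 1 ^ 2 ≤ r ^ 2
    linarith [sq_nonneg (x 2)]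
  · change x 2 ^ 2 ≤ r ^ 2
    linarith [sq_nonneg (x 1)]

lemma misfitField_of_one_lt (ζ : Fin 3 → ℝ) {N : ℕ} {r : ℝ} (hr : 0 ≤ r)
    (hN : ∀ j, r ≤ N * gap (ζ j)) {x : Pt} (hx : x ∈ cylinder r) (hx1 : 1 < x 0) :
    misfitField ζ N x = Matrix.diagonal ζ := by
  have h : ∀ j : Fin 3, j ≠ 0 → |x j| ≤ N * gap (ζ j) := fun j hj =>
    (abs_le_of_mem_cylinder hr hx hj).trans (hN j)
  have h0 : ¬ x 0 < 0 := by linarith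
  ext i j
  fin_cases i <;> fin_cases j <;>
    simp [misfitField, h0, longitudinal_of_one_le _ hx1.le (h 1 (by decide)),
      longitudinal_of_one_le _ hx1.le (h 2 (by decide)), transversal_of_one_le _ _ hx1.le]

lemma locallyIntegrable_step (a b : ℝ) :
    LocallyIntegrable fun x : Pt => if x 0 < 0 then a else b := by
  have hm : Measurable fun x : Pt => if x 0 < 0 then a else b :=
    Measurable.ite (measurableSet_lt (measurable_pi_apply 0) measurable_const)
      measurable_const measurable_const
  refine (locallyIntegrable_const (|a| + |b|)).mono hm.aestronglyMeasurable
    (ae_of_all _ fun x => ?_)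
  rw [Real.norm_eq_abs, Real.norm_of_nonneg (by positivity)]
  split_ifs
  · linarith [abs_nonneg b]
  · linarith [abs_nonneg a]

lemma lpLoc_misfitField {p : ℝ} (hp : 1 ≤ p) (hp2 : p < 2) (ζ : Fin 3 → ℝ) (N : ℕ) (r : ℝ) :
    LpLoc p r (misfitField ζ N) := by
  intro K hK _ i j
  have hzero := memLp_const_of_isCompact hK 0 (ENNReal.ofReal p)
  have hstep : MemLp (fun x : Pt => if x 0 < 0 then 1 else ζ 0) (ENNReal.ofReal p)
      (volume.restrict K) := by
    have hm : Measurable fun x : Pt => if x 0 < 0 then 1 else ζ 0 :=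
      Measurable.ite (measurableSet_lt (measurable_pi_apply 0) measurable_const)
        measurable_const measurable_const
    refine (memLp_const_of_isCompact hK (1 + |ζ 0|) _).mono hm.aestronglyMeasurable
      (ae_of_all _ fun x => ?_)
    rw [Real.norm_eq_abs, Real.norm_of_nonneg (by positivity)]
    split_ifs
    · rw [abs_one]; linarith [abs_nonneg (ζ 0)]
    · linarith
  have h1 : (1 : Fin 3) ≠ 0 := by decide
  have h2 : (2 : Fin 3) ≠ 0 := by decide
  fin_cases i <;> fin_cases j
  · exact hstep
  · exact hzero
  · exact hzero
  · exact memLp_transversal hp hp2 h1 (ζ 1) N hK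
  · exact memLp_longitudinal hp hp2 h1 (ζ 1) N hK
  · exact hzero
  · exact memLp_transversal hp hp2 h2 (ζ 2) N hK
  · exact hzero
  · exact memLp_longitudinal hp hp2 h2 (ζ 2) N hK

/-- The Burgers vectors of the dislocations on which the `(j + 1)`-st coordinate is constant. The
signs differ for the two families because a quarter turn in the interface reverses one axis. -/
def misfitBurgers (ζ : Fin 3 → ℝ) (j : Fin 2) : Fin 3 → ℝ :=
  (if j = 0 then -Real.sign (ζ j.succ - 1) else Real.sign (ζ j.succ - 1)) • axis j.succ

/-- The sources inside the wire. -/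
def misfitIndex (ζ : Fin 3 → ℝ) (N : ℕ) (r : ℝ) : Finset (Fin 2 × ℕ) :=
  (Finset.univ ×ˢ Finset.range (2 * N + 1)).filter fun q =>
    ζ q.1.succ ≠ 1 ∧ source (gap (ζ q.1.succ)) N q.2 ^ 2 < r ^ 2

lemma sum_misfitBurgers_sq {ζ : Fin 3 → ℝ} {j : Fin 2} (h : ζ j.succ ≠ 1) :
    ∑ i, misfitBurgers ζ j i ^ 2 = 1 := by
  have hs : Real.sign (ζ j.succ - 1) ^ 2 = 1 := by
    rcases Real.sign_apply_eq_of_ne_zero _ (sub_ne_zero.2 h) with h | h <;> simp [h]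
  rw [Finset.sum_eq_single j.succ]
  · simp only [misfitBurgers, Pi.smul_apply, Pi.single_eq_same, smul_eq_mul, mul_one]
    split_ifs
    · rw [neg_sq, hs]
    · exact hs
  · intro i _ hi
    simp [misfitBurgers, hi]
  · simp

/-- Two families of equidistant parallel dislocations that accommodate the misfit between the
identity and `diag ζ`. -/
def misfitSystem (ζ : Fin 3 → ℝ) (N : ℕ) (r : ℝ) : DislocationSystem r :=
  chordSystem r (misfitIndex ζ N r) (fun j => source (gap (ζ j.succ)) N)
    (fun j => source_injective (gap_pos (ζ j.succ)).ne' N)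
    (fun _ hq => (Finset.mem_filter.1 hq).2.2) (misfitBurgers ζ)
    (fun _ hq => sum_misfitBurgers_sq (Finset.mem_filter.1 hq).2.1)

lemma misfitSystem_num_pos {ζ : Fin 3 → ℝ} {j : Fin 2} (h : ζ j.succ ≠ 1) (N : ℕ) {r : ℝ}
    (hr : 0 < r) : 0 < (misfitSystem ζ N r).num := by
  change 0 < (misfitIndex ζ N r).card
  refine Finset.card_pos.2 ⟨(j, N), Finset.mem_filter.2 ⟨?_, h, ?_⟩⟩
  · rw [Finset.mem_product, Finset.mem_range]
    exact ⟨Finset.mem_univ _, by omega⟩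
  · simp only [source, sub_self, zero_mul]
    rw [zero_pow two_ne_zero]
    positivity

lemma sum_misfitSystem (ζ : Fin 3 → ℝ) (N : ℕ) {r : ℝ} {φ : Pt → Pt} (hφ : IsTestField r φ)
    {o : Fin 2 → Fin 3} (ho : ∀ j, o j ≠ 0 ∧ o j ≠ j.succ) (i : Fin 3) :
    ∑ m, (misfitSystem ζ N r).burgers m i * lineIntegral ((misfitSystem ζ N r).line m) φ =
      ∑ j : Fin 2, misfitBurgers ζ j i * ∑ k ∈ Finset.range (2 * N + 1),
        ∫ s, φ (slot j.succ 0 (source (gap (ζ j.succ)) N k) s) (o j) := by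
  rw [misfitSystem, sum_chordSystem]
  simp only [Finset.mul_sum]
  rw [← Finset.sum_product', misfitIndex, Finset.sum_filter]
  refine Finset.sum_congr rfl fun q _ => ?_
  split_ifs with h
  · rw [lineIntegral_chord hφ q.1 (ho q.1).1 (ho q.1).2 (Real.sqrt_pos.2 (by linarith [h.2]))]
    rw [Real.sq_sqrt (by linarith [h.2])]; ring
  · rw [not_and_or, not_not] at h
    rcases h with h | h
    · simp [misfitBurgers, h]
    · -- a source outside the disk is not seen by the test field
      have h0 : ∀ s, φ (slot q.1.succ 0 (source (gap (ζ q.1.succ)) N q.2) s) = 0 := fun s =>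
        hφ.eq_zero fun hs => h (by
          rw [slot_succ_mem_cylinder] at hs
          linarith [sq_nonneg s])
      simp [h0]

lemma pderiv_eq_pd {φ : Pt → Pt} (hφ : ContDiff ℝ ∞ φ) (k j : Fin 3) (x : Pt) :
    pderiv φ k j x = pd k (fun y => φ y j) x := by
  have h := hasFDerivAt_pi'.1 (hφ.differentiable (by simp) x).hasFDerivAt j
  rw [pd, h.fderiv]
  rfl

lemma hasDislocationCurl_misfitField (ζ : Fin 3 → ℝ) (N : ℕ) (r : ℝ) :
    HasDislocationCurl r (misfitSystem ζ N r) (misfitField ζ N) := by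
  intro φ hφ i
  have hs : ∀ j, ContDiff ℝ ∞ fun x => φ x j := fun j => contDiff_pi.1 hφ.smooth j
  have hc : ∀ j, HasCompactSupport fun x => φ x j := fun j =>
    hφ.compact.comp_left (g := fun v : Pt => v j) rfl
  have h1 : (1 : Fin 3) ≠ 0 := by decide
  have h2 : (2 : Fin 3) ≠ 0 := by decide
  have hT := fun {j : Fin 3} (hj : j ≠ 0) => locallyIntegrable_transversal hj (ζ j) N
  have hO := fun {j : Fin 3} (hj : j ≠ 0) => locallyIntegrable_longitudinal hj (ζ j) N
  rw [sum_misfitSystem ζ N hφ (o := ![2, 1]) (by decide)]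
  fin_cases i
  · have e : ∀ x, ∑ j, misfitField ζ N x 0 j * curl φ x j =
        (if x 0 < 0 then 1 else ζ 0) * pd 1 (fun y => φ y 2) x -
        (if x 0 < 0 then 1 else ζ 0) * pd 2 (fun y => φ y 1) x := fun x => by
      simp only [Fin.sum_univ_three, misfitField, curl, pderiv_eq_pd hφ.smooth]
      simp
      split_ifs <;> ring
    have hinv : ∀ (i : Fin 3), i ≠ 0 → ∀ (x : Pt) (s : ℝ),
        (if (x + s • axis i) 0 < 0 then 1 else ζ 0) = if x 0 < 0 then 1 else ζ 0 :=
      fun i hi x s => by simp [hi.symm]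
    have hl := locallyIntegrable_step 1 (ζ 0)
    change ∫ x, ∑ j, misfitField ζ N x 0 j * curl φ x j = _
    simp only [e]
    rw [integral_sub (integrable_mul_pd hl (hs 2) (hc 2) 1)
      (integrable_mul_pd hl (hs 1) (hc 1) 2),
      integral_mul_pd_eq_zero_of_invariant (hinv 1 h1) hl (hs 2) (hc 2),
      integral_mul_pd_eq_zero_of_invariant (hinv 2 h2) hl (hs 1) (hc 1)]
    simp [misfitBurgers]
  · have e : ∀ x, ∑ j, misfitField ζ N x 1 j * curl φ x j =
        -(longitudinal (ζ 1) N (x 0) (x 1) * pd 0 (fun y => φ y 2) x -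
          transversal (ζ 1) N (x 0) (x 1) * pd 1 (fun y => φ y 2) x) +
        (longitudinal (ζ 1) N (x 0) (x 1) * pd 2 (fun y => φ y 0) x -
          transversal (ζ 1) N (x 0) (x 1) * pd 2 (fun y => φ y 1) x) := fun x => by
      simp only [Fin.sum_univ_three, misfitField, curl, pderiv_eq_pd hφ.smooth]
      simp
      ring
    change ∫ x, ∑ j, misfitField ζ N x 1 j * curl φ x j = _
    simp only [e]
    rw [integral_add, integral_neg, integral_row h1 _ _ (hs 2) (hc 2), integral_sub,
      integral_mul_pd_eq_zero_of_invariant (by simp) (hO h1) (hs 0) (hc 0),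
      integral_mul_pd_eq_zero_of_invariant (by simp) (hT h1) (hs 1) (hc 1)]
    · simp [misfitBurgers]
    · exact integrable_mul_pd (hO h1) (hs 0) (hc 0) 2
    · exact integrable_mul_pd (hT h1) (hs 1) (hc 1) 2
    · exact ((integrable_mul_pd (hO h1) (hs 2) (hc 2) 0).sub
        (integrable_mul_pd (hT h1) (hs 2) (hc 2) 1)).neg
    · exact (integrable_mul_pd (hO h1) (hs 0) (hc 0) 2).sub
        (integrable_mul_pd (hT h1) (hs 1) (hc 1) 2)
  · have e : ∀ x, ∑ j, misfitField ζ N x 2 j * curl φ x j =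
        (longitudinal (ζ 2) N (x 0) (x 2) * pd 0 (fun y => φ y 1) x -
          transversal (ζ 2) N (x 0) (x 2) * pd 2 (fun y => φ y 1) x) -
        (longitudinal (ζ 2) N (x 0) (x 2) * pd 1 (fun y => φ y 0) x -
          transversal (ζ 2) N (x 0) (x 2) * pd 1 (fun y => φ y 2) x) := fun x => by
      simp only [Fin.sum_univ_three, misfitField, curl, pderiv_eq_pd hφ.smooth]
      simp
      ring
    change ∫ x, ∑ j, misfitField ζ N x 2 j * curl φ x j = _
    simp only [e]
    rw [integral_sub, integral_row h2 _ _ (hs 1) (hc 1), integral_sub,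
      integral_mul_pd_eq_zero_of_invariant (by simp) (hO h2) (hs 0) (hc 0),
      integral_mul_pd_eq_zero_of_invariant (by simp) (hT h2) (hs 2) (hc 2)]
    · simp [misfitBurgers]
    · exact integrable_mul_pd (hO h2) (hs 0) (hc 0) 1
    · exact integrable_mul_pd (hT h2) (hs 2) (hc 2) 1
    · exact (integrable_mul_pd (hO h2) (hs 1) (hc 1) 0).sub
        (integrable_mul_pd (hT h2) (hs 1) (hc 1) 2)
    · exact (integrable_mul_pd (hO h2) (hs 0) (hc 0) 1).sub
        (integrable_mul_pd (hT h2) (hs 2) (hc 2) 1)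

/-- The field is an admissible transition as soon as the sources cover the wire. -/
lemma isTransition_misfitField {p : ℝ} (hp : 1 ≤ p) (hp2 : p < 2) (ζ : Fin 3 → ℝ) {N : ℕ} {r : ℝ}
    (hr : 0 ≤ r) (hN : ∀ j, r ≤ N * gap (ζ j)) :
    IsTransition p r (misfitSystem ζ N r) 1 (Matrix.diagonal ζ) 1 (misfitField ζ N) where
  lpLoc := lpLoc_misfitField hp hp2 ζ N r
  curl_eq := hasDislocationCurl_misfitField ζ N r
  left := ae_of_all _ fun _ _ hx => misfitField_of_neg ζ N (by linarith)
  right := ae_of_all _ fun _ hx hx1 => misfitField_of_one_lt ζ hr hN hx hx1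

/-! ### The energy of the misfit dislocations -/

lemma abs_longitudinal_le (z : ℝ) (N : ℕ) (t y : ℝ) : |longitudinal z N t y| ≤
    1 + |z - 1| * ∑ k ∈ Finset.range (2 * N + 1), spread (gap z) t (y - source (gap z) N k) := by
  rw [longitudinal]
  refine (abs_add_le _ _).trans ?_
  rw [abs_one, abs_mul, abs_of_nonneg (Finset.sum_nonneg fun k _ => spread_nonneg _ _ _)]

lemma abs_transversal_le (z : ℝ) (N : ℕ) (t y : ℝ) : |transversal z N t y| ≤
    ∑ k ∈ Finset.range (2 * N + 1), spread (gap z) t (y - source (gap z) N k) := by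
  rw [transversal, abs_mul, abs_neg]
  calc _ ≤ |z - 1| * ∑ k ∈ Finset.range (2 * N + 1),
        gap z * spread (gap z) t (y - source (gap z) N k) := by
        refine mul_le_mul_of_nonneg_left ?_ (abs_nonneg _)
        exact (Finset.abs_sum_le_sum_abs _ _).trans
          (Finset.sum_le_sum fun k _ => abs_slope_le (gap_pos z).le _ _)
    _ = |z - 1| * gap z * ∑ k ∈ Finset.range (2 * N + 1),
        spread (gap z) t (y - source (gap z) N k) := by rw [← Finset.mul_sum, mul_assoc]
    _ ≤ _ := mul_le_of_le_one_left (Finset.sum_nonneg fun k _ => spread_nonneg _ _ _)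
        (abs_mul_gap_le z)

/-- The flow of the `q.2`-th source of the `q.1`-th family. -/
def sourceFlow (ζ : Fin 3 → ℝ) (N : ℕ) (q : Fin 2 × ℕ) (x : Pt) : ℝ :=
  spread (gap (ζ q.1.succ)) (x 0) (x q.1.succ - source (gap (ζ q.1.succ)) N q.2)

lemma frobNorm_misfitField_le {ζ : Fin 3 → ℝ} (hζ : 0 < ζ 0) (N : ℕ) (x : Pt) :
    frobNorm (misfitField ζ N x) ≤ (4 + ζ 0 + |ζ 1 - 1| + |ζ 2 - 1|) *
      (1 + ∑ q ∈ Finset.univ ×ˢ Finset.range (2 * N + 1), sourceFlow ζ N q x) := by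
  rw [Finset.sum_product, Fin.sum_univ_two]
  set X₁ := ∑ k ∈ Finset.range (2 * N + 1), sourceFlow ζ N (0, k) x with hX₁
  set X₂ := ∑ k ∈ Finset.range (2 * N + 1), sourceFlow ζ N (1, k) x with hX₂
  have h1 : 0 ≤ X₁ := Finset.sum_nonneg fun k _ => spread_nonneg _ _ _
  have h2 : 0 ≤ X₂ := Finset.sum_nonneg fun k _ => spread_nonneg _ _ _
  have l1 : |longitudinal (ζ 1) N (x 0) (x 1)| ≤ 1 + |ζ 1 - 1| * X₁ := abs_longitudinal_le _ _ _ _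
  have l2 : |longitudinal (ζ 2) N (x 0) (x 2)| ≤ 1 + |ζ 2 - 1| * X₂ := abs_longitudinal_le _ _ _ _
  have t1 : |transversal (ζ 1) N (x 0) (x 1)| ≤ X₁ := abs_transversal_le _ _ _ _
  have t2 : |transversal (ζ 2) N (x 0) (x 2)| ≤ X₂ := abs_transversal_le _ _ _ _
  have h0 : |(if x 0 < 0 then 1 else ζ 0 : ℝ)| ≤ 1 + ζ 0 := by
    split_ifs
    · rw [abs_one]; linarith
    · rw [abs_of_pos hζ]; linarith
  refine (frobNorm_le_sum _).trans ?_
  have e : ∑ i, ∑ j, |misfitField ζ N x i j| = |(if x 0 < 0 then 1 else ζ 0 : ℝ)| +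
      (|transversal (ζ 1) N (x 0) (x 1)| + |longitudinal (ζ 1) N (x 0) (x 1)|) +
      (|transversal (ζ 2) N (x 0) (x 2)| + |longitudinal (ζ 2) N (x 0) (x 2)|) := by
    simp [Fin.sum_univ_three, misfitField]
  rw [e]
  have a1 := abs_nonneg (ζ 1 - 1)
  have a2 := abs_nonneg (ζ 2 - 1)
  nlinarith [mul_nonneg a1 h2, mul_nonneg a2 h1, mul_nonneg hζ.le h1, mul_nonneg hζ.le h2]

lemma rpow_le_of_le_mul_one_add_sum {ι : Type*} {p c a : ℝ} (hp : 1 ≤ p) (ha : 0 ≤ a) (hc : 0 ≤ c)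
    {S : Finset ι} {f : ι → ℝ} (hf : ∀ q ∈ S, 0 ≤ f q) (h : a ≤ c * (1 + ∑ q ∈ S, f q)) :
    a ^ p ≤ (2 * c) ^ p * (1 + (S.card : ℝ) ^ (p - 1) * ∑ q ∈ S, f q ^ p) := by
  have hp0 : 0 ≤ p := by linarith
  set X := ∑ q ∈ S, f q with hX
  have hX0 : 0 ≤ X := Finset.sum_nonneg hf
  have hXp : X ^ p ≤ (S.card : ℝ) ^ (p - 1) * ∑ q ∈ S, f q ^ p :=
    Real.rpow_sum_le_const_mul_sum_rpow_of_nonneg S hp hf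
  have h1 : a ^ p ≤ (c * (1 + X)) ^ p := Real.rpow_le_rpow ha h hp0
  have h2 : (c * (1 + X)) ^ p ≤ (2 * c * max 1 X) ^ p := by
    refine Real.rpow_le_rpow (by positivity) ?_ hp0
    have : 1 + X ≤ 2 * max 1 X := by linarith [le_max_left 1 X, le_max_right 1 X]
    calc c * (1 + X) ≤ c * (2 * max 1 X) := mul_le_mul_of_nonneg_left this hc
      _ = _ := by ring
  have h3 : (max 1 X) ^ p ≤ 1 + X ^ p := by
    have h4 : 0 ≤ X ^ p := Real.rpow_nonneg hX0 p
    rcases max_choice 1 X with h | h <;> rw [h]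
    · rw [Real.one_rpow]; linarith
    · linarith
  rw [Real.mul_rpow (x := 2 * c) (y := max 1 X) (by positivity) (by positivity)] at h2
  refine (h1.trans h2).trans (mul_le_mul_of_nonneg_left (by linarith) (by positivity))

lemma slab_subset {r : ℝ} (hr : 0 ≤ r) {i : Fin 3} (hi : i ≠ 0) :
    slab 1 r ⊆ {x : Pt | x 0 < 1 ∧ |x i| ≤ r} := fun _ hx =>
  ⟨hx.2.1, abs_le_of_mem_cylinder hr hx.2.2 hi⟩

lemma volume_slab_le {r : ℝ} (hr : 0 ≤ r) : volume (slab 1 r) ≤ ENNReal.ofReal (8 * r ^ 2) := by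
  have h : slab 1 r ⊆ Icc (![-1, -r, -r] : Pt) ![1, r, r] := by
    intro x hx
    have h1 := abs_le.1 (slab_subset hr (i := 1) (by decide) hx).2
    have h2 := abs_le.1 (slab_subset hr (i := 2) (by decide) hx).2
    refine ⟨fun i => ?_, fun i => ?_⟩
    · fin_cases i
      · exact hx.1.le
      · exact h1.1
      · exact h2.1
    · fin_cases i
      · exact hx.2.1.le
      · exact h1.2
      · exact h2.2
  refine (measure_mono h).trans (le_of_eq ?_)
  rw [Real.volume_Icc_pi, Fin.prod_univ_three, ← ENNReal.ofReal_mul (by norm_num),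
    ← ENNReal.ofReal_mul (by simp; linarith)]
  congr 1
  simp
  ring

/-- The density of the misfit dislocations is bounded, and each of them has a core of finite
energy because `p < 2`. -/
theorem exists_transitionCost_misfitSystem_le {p C₁ C₂ : ℝ} (hp : 1 < p) (hp2 : p < 2)
    (hC₂ : 0 < C₂) {ζ : Fin 3 → ℝ} (hζ : ∀ i, 0 < ζ i) {W₁ W₂ : Mat → ℝ} {H₁ H₂ : Mat}
    (hW₁ : IsEnergyDensity p C₁ C₂ H₁ W₁) (hW₂ : IsEnergyDensity p C₁ C₂ H₂ W₂) :
    ∃ C, ∀ r, 1 ≤ r → ∃ N, transitionCost p W₁ W₂ 1 (Matrix.diagonal ζ) r (misfitSystem ζ N r) ≤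
      ENNReal.ofReal (C * r ^ (p + 1)) := by
  set κ := ∑ j, (gap (ζ j))⁻¹ with hκ
  have hgi : ∀ j, 0 < (gap (ζ j))⁻¹ := fun j => inv_pos.2 (gap_pos _)
  have hκ0 : 0 ≤ κ := Finset.sum_nonneg fun j _ => (hgi j).le
  set c := 4 + ζ 0 + |ζ 1 - 1| + |ζ 2 - 1| with hc
  have hc0 : 0 ≤ c := by have := hζ 0; positivity
  set A := C₂ * ((2 * c) ^ p + 1) with hA
  have hA0 : 0 ≤ A := by positivity
  set I : Fin 2 → ℝ≥0∞ := fun j =>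
    ∫⁻ t in Ioo 0 1, ENNReal.ofReal (gap (ζ j.succ) * (t ^ (1 - p) + 1)) with hI
  have hIfin : ∀ j, I j ≠ ⊤ := fun j => (lintegral_slab_bound_lt_top hp2 _ _).ne
  set J := (I 0 + I 1).toReal with hJ
  have hIJ : ∀ j, I j ≤ ENNReal.ofReal J := fun j => by
    rw [hJ, ENNReal.ofReal_toReal (ENNReal.add_ne_top.2 ⟨hIfin 0, hIfin 1⟩)]
    fin_cases j
    · exact self_le_add_right _ _
    · exact self_le_add_left _ _
  have hJ0 : 0 ≤ J := ENNReal.toReal_nonneg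
  set ν := 4 * κ + 6 with hν
  refine ⟨A * (8 + 2 * ν ^ p * J), fun r hr => ?_⟩
  have hr0 : 0 ≤ r := by linarith
  set N := ⌈r * κ⌉₊ with hN
  have hNle : r * κ ≤ N := Nat.le_ceil _
  have hNlt : (N : ℝ) < r * κ + 1 := Nat.ceil_lt_add_one (by positivity)
  have hcover : ∀ j, r ≤ N * gap (ζ j) := fun j => by
    have h1 : (gap (ζ j))⁻¹ ≤ κ :=
      Finset.single_le_sum (f := fun j => (gap (ζ j))⁻¹) (fun j _ => (hgi j).le) (Finset.mem_univ j)
    have h2 : r * (gap (ζ j))⁻¹ ≤ N := (mul_le_mul_of_nonneg_left h1 hr0).trans hNle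
    rwa [← div_eq_mul_inv, div_le_iff₀ (gap_pos _)] at h2
  refine ⟨N, ?_⟩
  set S : Finset (Fin 2 × ℕ) := Finset.univ ×ˢ Finset.range (2 * N + 1) with hS
  set n : ℝ := (S.card : ℝ) with hn
  have hn0 : 0 ≤ n := Nat.cast_nonneg _
  have hnν : n ≤ ν * r := by
    have : n = 2 * (2 * N + 1) := by
      rw [hn, hS, Finset.card_product, Finset.card_univ, Fintype.card_fin, Finset.card_range]
      push_cast; ring
    rw [this, hν]; nlinarith
  have hq0 : ∀ (q : Fin 2 × ℕ) (x : Pt), 0 ≤ sourceFlow ζ N q x := fun q x => spread_nonneg _ _ _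
  have hpt : ∀ x, ENNReal.ofReal (density W₁ W₂ x (misfitField ζ N x)) ≤ ENNReal.ofReal A *
      (1 + ENNReal.ofReal (n ^ (p - 1)) * ∑ q ∈ S, ENNReal.ofReal (sourceFlow ζ N q x ^ p)) := by
    intro x
    have hsum0 : 0 ≤ n ^ (p - 1) * ∑ q ∈ S, sourceFlow ζ N q x ^ p :=
      mul_nonneg (Real.rpow_nonneg hn0 _)
        (Finset.sum_nonneg fun q _ => Real.rpow_nonneg (hq0 q x) p)
    have h1 := rpow_le_of_le_mul_one_add_sum hp.le (frobNorm_nonneg _) hc0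
      (fun q _ => hq0 q x) (frobNorm_misfitField_le (hζ 0) N x)
    have h2 : density W₁ W₂ x (misfitField ζ N x) ≤
        C₂ * (frobNorm (misfitField ζ N x) ^ p + 1) := by
      rw [density]
      split_ifs
      · exact (hW₁.upper_bound _).trans (mul_le_mul_of_nonneg_left (min_le_right _ _) hC₂.le)
      · exact (hW₂.upper_bound _).trans (mul_le_mul_of_nonneg_left (min_le_right _ _) hC₂.le)
    have h3 : density W₁ W₂ x (misfitField ζ N x) ≤
        A * (1 + n ^ (p - 1) * ∑ q ∈ S, sourceFlow ζ N q x ^ p) := by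
      refine h2.trans ?_
      rw [hA, mul_assoc]
      refine mul_le_mul_of_nonneg_left ?_ hC₂.le
      rw [add_mul, one_mul]
      linarith
    refine (ENNReal.ofReal_le_ofReal h3).trans (le_of_eq ?_)
    rw [ENNReal.ofReal_mul hA0, ENNReal.ofReal_add zero_le_one hsum0, ENNReal.ofReal_one,
      ENNReal.ofReal_mul (Real.rpow_nonneg hn0 _),
      ENNReal.ofReal_sum_of_nonneg fun q _ => Real.rpow_nonneg (hq0 q x) p]
  have hmeas : ∀ q, Measurable fun x => ENNReal.ofReal (sourceFlow ζ N q x ^ p) := fun q =>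
    (((measurable_spread _).comp (measurable_coord_pair _ _)).pow_const p).ennreal_ofReal
  have hflow : ∀ q ∈ S, ∫⁻ x in slab 1 r, ENNReal.ofReal (sourceFlow ζ N q x ^ p) ≤
      ENNReal.ofReal (2 * r * J) := by
    intro q _
    obtain ⟨i, hi, hij⟩ : ∃ i : Fin 3, i ≠ 0 ∧ i ≠ q.1.succ := by
      generalize q.1 = j
      fin_cases j
      · exact ⟨2, by decide, by decide⟩
      · exact ⟨1, by decide, by decide⟩
    calc _ ≤ ∫⁻ x in {x : Pt | x 0 < 1 ∧ |x i| ≤ r}, ENNReal.ofReal (sourceFlow ζ N q x ^ p) :=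
          lintegral_mono_set (slab_subset hr0 hi)
      _ ≤ ENNReal.ofReal (2 * r) * I q.1 :=
          setLIntegral_spread_rpow_le hp.le (gap_pos _).le hi (Fin.succ_ne_zero _) hij _ _ _
      _ ≤ ENNReal.ofReal (2 * r) * ENNReal.ofReal J := mul_le_mul_right (hIJ _) _
      _ = _ := (ENNReal.ofReal_mul (by positivity)).symm
  have htot : ∫⁻ x in slab 1 r, ENNReal.ofReal (density W₁ W₂ x (misfitField ζ N x)) ≤
      ENNReal.ofReal (A * (8 * r ^ 2 + n ^ (p - 1) * (n * (2 * r * J)))) := by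
    refine (lintegral_mono hpt).trans ?_
    rw [lintegral_const_mul' _ _ ENNReal.ofReal_ne_top, lintegral_add_left measurable_const,
      lintegral_const_mul' _ _ ENNReal.ofReal_ne_top, lintegral_finsetSum _ fun q _ => hmeas q,
      lintegral_const, one_mul, Measure.restrict_apply_univ, ENNReal.ofReal_mul hA0,
      ENNReal.ofReal_add (by positivity) (by positivity),
      ENNReal.ofReal_mul (Real.rpow_nonneg hn0 (p - 1))]
    refine mul_le_mul_right (add_le_add (volume_slab_le hr0) (mul_le_mul_right ?_ _)) _
    refine (Finset.sum_le_sum hflow).trans (le_of_eq ?_)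
    rw [Finset.sum_const, nsmul_eq_mul, ENNReal.ofReal_mul hn0, hn, ENNReal.ofReal_natCast]
  have hcost : transitionCost p W₁ W₂ 1 (Matrix.diagonal ζ) r (misfitSystem ζ N r) ≤
      ENNReal.ofReal (A * (8 * r ^ 2 + n ^ (p - 1) * (n * (2 * r * J)))) :=
    iInf₂_le_of_le 1 one_pos (iInf₂_le_of_le (misfitField ζ N)
      (isTransition_misfitField hp.le hp2 ζ hr0 hcover) htot)
  refine hcost.trans
    (ENNReal.ofReal_le_ofReal ?_)
  have hrpos : 0 < r := by linarith
  have e1 : r ^ 2 ≤ r ^ (p + 1) := by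
    rw [← Real.rpow_natCast]
    exact Real.rpow_le_rpow_of_exponent_le hr (by push_cast; linarith)
  have e2 : n ^ (p - 1) * (n * (2 * r * J)) ≤ 2 * ν ^ p * J * r ^ (p + 1) := by
    have h1 : n ^ (p - 1) * n = n ^ p := by
      have hnpos : 0 < n := by
        rw [hn, hS, Finset.card_product, Finset.card_univ, Fintype.card_fin, Finset.card_range]
        positivity
      rw [Real.rpow_sub_one hnpos.ne']
      field_simp
    have h2 : n ^ p ≤ ν ^ p * r ^ p := by
      rw [← Real.mul_rpow (by positivity) hr0]
      exact Real.rpow_le_rpow hn0 hnν (by linarith)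
    calc n ^ (p - 1) * (n * (2 * r * J)) = n ^ p * (2 * r * J) := by rw [← h1]; ring
      _ ≤ ν ^ p * r ^ p * (2 * r * J) := mul_le_mul_of_nonneg_right h2 (by positivity)
      _ = _ := by rw [Real.rpow_add_one hrpos.ne']; ring
  calc A * (8 * r ^ 2 + n ^ (p - 1) * (n * (2 * r * J)))
      ≤ A * (8 * r ^ (p + 1) + 2 * ν ^ p * J * r ^ (p + 1)) :=
        mul_le_mul_of_nonneg_left (by linarith) hA0
    _ = _ := by ring

/-- If the wells are incompatible, they prescribe different lengths for a tangential direction of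
the interface; otherwise the identity would be rank-one connected to `diag ζ`. -/
lemma exists_ne_one {ζ : Fin 3 → ℝ}
    (h : ∀ R ∈ Matrix.specialOrthogonalGroup (Fin 3) ℝ, ∀ a : Fin 3 → ℝ,
      R - Matrix.diagonal ζ ≠ Matrix.vecMulVec a (Pi.single 0 1)) : ∃ j : Fin 2, ζ j.succ ≠ 1 := by
  by_contra! hcon
  have h1 : ζ 1 = 1 := hcon 0
  have h2 : ζ 2 = 1 := hcon 1
  refine h 1 (one_mem _) ![1 - ζ 0, 0, 0] ?_
  ext i j
  fin_cases i <;> fin_cases j <;> simp [Matrix.vecMulVec_apply, h1, h2]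

end Nanowire

end

/-! ### Comparison of the two costs -/

theorem theorem3p5 (p C₁ C₂ : ℝ) (hp₁ : 1 < p) (hp₂ : p < 2) (hC₁ : 0 < C₁) (hC₂ : 0 < C₂)
    (ζ : Fin 3 → ℝ) (hζ : ∀ i, 0 < ζ i)
    (W₁ W₂ : Nanowire.Mat → ℝ)
    (hW₁ : Nanowire.IsEnergyDensity p C₁ C₂ 1 W₁)
    (hW₂ : Nanowire.IsEnergyDensity p C₁ C₂ (Matrix.diagonal ζ) W₂)
    (hincompatible : ∀ R ∈ Matrix.specialOrthogonalGroup (Fin 3) ℝ, ∀ a : Fin 3 → ℝ,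
      R - Matrix.diagonal ζ ≠ Matrix.vecMulVec a (Pi.single 0 1)) :
    Filter.limsup (fun r : ℝ =>
        ⨅ (D : Nanowire.DislocationSystem r) (_ : 0 < D.num),
          Nanowire.transitionCost p W₁ W₂ 1 (Matrix.diagonal ζ) r D / ENNReal.ofReal (r ^ 3))
      Filter.atTop
    < Nanowire.transitionCost p W₁ W₂ 1 (Matrix.diagonal ζ) 1
        (Nanowire.DislocationSystem.empty 1) := by
  obtain ⟨j, hj⟩ := Nanowire.exists_ne_one hincompatible
  obtain ⟨δ, hδ, hlow⟩ :=
    Nanowire.exists_le_transitionCost_empty hp₁.le hC₁ hζ hW₁ hW₂ (Fin.succ_ne_zero j) hj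
  obtain ⟨C, hC⟩ := Nanowire.exists_transitionCost_misfitSystem_le hp₁ hp₂ hC₂ hζ hW₁ hW₂
  -- the quotient is at most `C r ^ (p - 2)`, hence eventually below `δ / 2`
  refine lt_of_le_of_lt ?_ (lt_of_lt_of_le
    ((ENNReal.ofReal_lt_ofReal_iff hδ).2 (half_lt_self hδ)) hlow)
  have hdecay : ∀ᶠ r : ℝ in Filter.atTop, C * r ^ (-(2 - p)) < δ / 2 := by
    have h := (tendsto_rpow_neg_atTop (show 0 < 2 - p by linarith)).const_mul C
    rw [mul_zero] at h
    exact h.eventually_lt_const (half_pos hδ)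
  refine Filter.limsup_le_of_le (by isBoundedDefault) ?_
  filter_upwards [hdecay, Filter.eventually_ge_atTop 1] with r hr hr1
  obtain ⟨N, hN⟩ := hC r hr1
  have hr0 : 0 < r := by linarith
  refine iInf_le_of_le (Nanowire.misfitSystem ζ N r)
    (iInf_le_of_le (Nanowire.misfitSystem_num_pos hj N hr0) ?_)
  refine ENNReal.div_le_of_le_mul (hN.trans ?_)
  rw [← ENNReal.ofReal_mul (half_pos hδ).le]
  refine ENNReal.ofReal_le_ofReal ?_
  have e : C * r ^ (p + 1) = C * r ^ (-(2 - p)) * r ^ 3 := by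
    rw [mul_assoc, ← Real.rpow_natCast, ← Real.rpow_add hr0]
    congr 2; push_cast; ring
  rw [e]
  exact mul_le_mul_of_nonneg_right hr.le (by positivity)
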